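/- Let $\mathbf{k}$ be a field of characteristic $0$, let $n\ge 0$, let $R_n=\mathbf{k}[x_0,\dots,x_{n-1}]$ be bigraded by giving $x_i$ the bidegree $(i,1)$, and let $I_n=\langle f_1,\dots,f_n\rangle\subseteq R_n$ with $f_m=\sum_{a=0}^{m-1}x_ax_{m-1-a}$. A bigraded free resolution of $R_n/I_n$ is an exact complex $$0\leftarrow R_n/I_n\leftarrow F(0,n)\leftarrow F(1,n)\leftarrow F(2,n)\leftarrow\cdots$$ of finitely generated bigraded free $R_n$-modules and maps preserving the bidegree; it is minimal if the image of $F(i+1,n)\to F(i,n)$ lies in $\langle x_0,\dots,x_{n-1}\rangle F(i,n)$ for every $i\ge 0$. Write $b(i,n)$ for the rank of $F(i,n)$, and $\widehat b(i,n)=\sum_e q^{d_1(e)}t^{d_2(e)}\in\mathbb{Z}[q,t]$, where $e$ runs over a bihomogeneous basis of $F(i,n)$ and $(d_1(e),d_2(e))$ is the bidegree of $e$. For integers $a,b$ let $\binom{a}{b}$ be the usual binomial coefficient and $$\binom{a}{b}_q=\frac{(1-q)\cdots(1-q^a)}{(1-q)\cdots(1-q^b)\,(1-q)\cdots(1-q^{a-b})}$$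 if $0\le b\le a$; otherwise (that is, if $b<0$ or $a<b$) both are $0$ by convention. Then $R_n/I_n$ has a minimal bigraded free resolution, and for every such resolution and every $i\ge 0$ $$b(i,n)=\sum_{p\ge 0}\left[\binom{n-2p+1}{p}\binom{p}{i-p}+\binom{n-2p-1}{p}\binom{p}{i-p-1}\right]$$ and $$\widehat b(i,n)=\sum_{p\ge 0}\left[q^{\frac{5p^2-3p+(i-p)(i-p-1)}{2}}\,t^{2p+(i-p)}\binom{n-2p+1}{p}_q\binom{p}{i-p}_q+q^{\frac{5p^2+5p+(i-p-1)(i-p-2)}{2}}\,t^{2p+2+(i-p-1)}\binom{n-2p-1}{p}_q\binom{p}{i-p-1}_q\right].$$ -/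

import Mathlib

open MvPolynomial

namespace JetDoublePoint

/-! ### The ideals -/

/-- For `j < n`, the polynomial `f_{j+1} = ∑_{a+b=j} x_a x_b`, i.e. the coefficient of `t^j` in
`(x_0 + x_1 t + ⋯ + x_{n-1} t^{n-1})^2`. -/
noncomputable def jetGen (k : Type*) [Field k] (n : ℕ) (j : Fin n) : MvPolynomial (Fin n) k :=
  ∑ a : Fin n, ∑ b : Fin n, if (a : ℕ) + (b : ℕ) = (j : ℕ) then X a * X b else 0

/-- The ideal `I_n = ⟨f_1, …, f_n⟩` of `R_n = k[x_0, …, x_{n-1}]`, which defines the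
`(n-1)`-st jet scheme of the double point `Spec k[x]/x^2`. -/
noncomputable def jetIdeal (k : Type*) [Field k] (n : ℕ) : Ideal (MvPolynomial (Fin n) k) :=
  Ideal.span (Set.range (jetGen k n))

/-! ### Bigraded free resolutions -/

/-- The bigrading of `R_n`: the variable `x_i` has bidegree `(i, 1)`. -/
def biweight (n : ℕ) (i : Fin n) : ℕ × ℕ := ((i : ℕ), 1)

/-- `p` is bihomogeneous of bidegree `c` (the zero polynomial has every bidegree). -/
def IsBihom {k : Type*} [Field k] {n : ℕ} (p : MvPolynomial (Fin n) k) (c : ℕ × ℕ) : Prop :=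
  IsWeightedHomogeneous (biweight n) p c

/-- `v` is a homogeneous element of bidegree `m` of the bigraded free module
`⨁_a R_n(-deg a)`, whose basis vector with index `a` sits in bidegree `deg a`. -/
def IsBihomVec {k : Type*} [Field k] {n : ℕ} {ι : Type} (deg : ι → ℕ × ℕ)
    (v : ι →₀ MvPolynomial (Fin n) k) (m : ℕ × ℕ) : Prop :=
  ∀ a, v a ≠ 0 → ∃ c, c + deg a = m ∧ IsBihom (v a) c

/-- A bigraded free resolution
`0 ← R_n/I ← F_0 ← F_1 ← F_2 ← ⋯` of `R_n/I` by finitely generated bigraded free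
`R_n`-modules `F_i = ⨁_{e ∈ ι i} R_n(-deg e)`, with maps preserving the bidegree. -/
structure BigradedFreeResolution {k : Type*} [Field k] {n : ℕ}
    (I : Ideal (MvPolynomial (Fin n) k)) where
  /-- the index type of the homogeneous basis of `F_i` -/
  ι : ℕ → Type
  /-- `F_i` is finitely generated -/
  fin : ∀ i, Fintype (ι i)
  /-- the bidegrees of the basis elements of `F_i` -/
  deg : ∀ i, ι i → ℕ × ℕ
  /-- the differential `F_{i+1} → F_i` -/
  d : ∀ i, (ι (i + 1) →₀ MvPolynomial (Fin n) k) →ₗ[MvPolynomial (Fin n) k]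
    (ι i →₀ MvPolynomial (Fin n) k)
  /-- the augmentation `F_0 → R_n/I` -/
  aug : (ι 0 →₀ MvPolynomial (Fin n) k) →ₗ[MvPolynomial (Fin n) k]
    (MvPolynomial (Fin n) k ⧸ I)
  /-- the differentials preserve the bidegree -/
  d_bihom : ∀ i (e : ι (i + 1)), IsBihomVec (deg i) (d i (Finsupp.single e 1)) (deg (i + 1) e)
  /-- the augmentation preserves the bidegree -/
  aug_bihom : ∀ e : ι 0, ∃ p, IsBihom p (deg 0 e) ∧
    aug (Finsupp.single e 1) = Ideal.Quotient.mk I p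
  /-- exactness at `R_n/I` -/
  aug_surjective : Function.Surjective aug
  /-- exactness at `F_0` -/
  exact_zero : Function.Exact (d 0) aug
  /-- exactness at `F_{i+1}` -/
  exact_succ : ∀ i, Function.Exact (d (i + 1)) (d i)

namespace BigradedFreeResolution

variable {k : Type*} [Field k] {n : ℕ} {I : Ideal (MvPolynomial (Fin n) k)}

instance (F : BigradedFreeResolution I) (i : ℕ) : Fintype (F.ι i) := F.fin i

/-- The resolution is minimal: `d(F_{i+1}) ⊆ 𝔪 F_i` with `𝔪 = ⟨x_0, …, x_{n-1}⟩`. -/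
def IsMinimal (F : BigradedFreeResolution I) : Prop :=
  ∀ i, LinearMap.range (F.d i) ≤
    Ideal.span (Set.range (X : Fin n → MvPolynomial (Fin n) k)) •
      (⊤ : Submodule (MvPolynomial (Fin n) k) (F.ι i →₀ MvPolynomial (Fin n) k))

/-- The rank of the `i`-th module `F_i`. -/
noncomputable def rank (F : BigradedFreeResolution I) (i : ℕ) : ℕ :=
  Module.finrank (MvPolynomial (Fin n) k) (F.ι i →₀ MvPolynomial (Fin n) k)

/-- The bigraded Hilbert polynomial `∑_e q^{deg_1 e} t^{deg_2 e} ∈ ℤ[q, t]` of the generating set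
of `F_i`, where `q` and `t` are the variables `X 0` and `X 1`. -/
noncomputable def hilbertGen (F : BigradedFreeResolution I) (i : ℕ) : MvPolynomial (Fin 2) ℤ :=
  ∑ e : F.ι i, X 0 ^ (F.deg i e).1 * X 1 ^ (F.deg i e).2

end BigradedFreeResolution

/-! ### Binomial and `q`-binomial coefficients -/

/-- The binomial coefficient of integers, equal to `0` unless `0 ≤ b ≤ a`. -/
def binom (a b : ℤ) : ℕ :=
  if 0 ≤ b ∧ b ≤ a then a.toNat.choose b.toNat else 0

/-- The Gaussian binomial coefficients of natural numbers, by the `q`-Pascal rule. -/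
def gaussNat {A : Type*} [CommRing A] (q : A) : ℕ → ℕ → A
  | _, 0 => 1
  | 0, _ + 1 => 0
  | a + 1, b + 1 => gaussNat q a b + q ^ (b + 1) * gaussNat q a (b + 1)

/-- The product `(1 - q)(1 - q^2) ⋯ (1 - q^a)`. -/
def qProd {A : Type*} [CommRing A] (q : A) (a : ℕ) : A :=
  ∏ j ∈ Finset.range a, (1 - q ^ (j + 1))

theorem gaussNat_eq_zero {A : Type*} [CommRing A] (q : A) :
    ∀ a b : ℕ, a < b → gaussNat q a b = 0
  | _, 0, h => absurd h (Nat.not_lt_zero _)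
  | 0, _ + 1, _ => rfl
  | a + 1, b + 1, h => by
      rw [gaussNat, gaussNat_eq_zero q a b (by omega), gaussNat_eq_zero q a (b + 1) (by omega)]
      simp

/-- The product formula that characterizes the Gaussian binomial coefficients: for `b ≤ a`,
`[a choose b]_q` is the quotient of `(1-q)⋯(1-q^a)` by
`(1-q)⋯(1-q^b) · (1-q)⋯(1-q^{a-b})`. -/
theorem gaussNat_mul_qProd {A : Type*} [CommRing A] (q : A) :
    ∀ b c : ℕ, gaussNat q (b + c) b * (qProd q b * qProd q c) = qProd q (b + c)
  | 0, c => by cases c <;> simp [gaussNat, qProd]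
  | b + 1, 0 => by
      have h := gaussNat_mul_qProd q b 0
      simp only [Nat.add_zero] at h ⊢
      rw [gaussNat, gaussNat_eq_zero q b (b + 1) (by omega)]
      have e : qProd q (b + 1) = qProd q b * (1 - q ^ (b + 1)) := Finset.prod_range_succ _ _
      rw [e]
      linear_combination (1 - q ^ (b + 1)) * h
  | b + 1, c + 1 => by
      have h1 := gaussNat_mul_qProd q b (c + 1)
      have h2 := gaussNat_mul_qProd q (b + 1) c
      have e1 : qProd q (b + 1) = qProd q b * (1 - q ^ (b + 1)) := Finset.prod_range_succ _ _
      have e2 : qProd q (c + 1) = qProd q c * (1 - q ^ (c + 1)) := Finset.prod_range_succ _ _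
      have e3 : qProd q (b + 1 + (c + 1)) = qProd q (b + (c + 1)) * (1 - q ^ (b + (c + 1) + 1)) := by
        rw [show b + 1 + (c + 1) = b + (c + 1) + 1 by omega]
        exact Finset.prod_range_succ _ _
      rw [show b + 1 + c = b + (c + 1) by omega] at h2
      rw [e3, show b + 1 + (c + 1) = (b + (c + 1)) + 1 by omega, gaussNat]
      rw [e1] at h2 ⊢
      rw [e2] at h1 ⊢
      linear_combination (1 - q ^ (b + 1)) * h1 + q ^ (b + 1) * (1 - q ^ (c + 1)) * h2

/-- The `q`-binomial coefficient of integers, equal to `0` unless `0 ≤ b ≤ a`. -/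
def qbinom {A : Type*} [CommRing A] (q : A) (a b : ℤ) : A :=
  if 0 ≤ b ∧ b ≤ a then gaussNat q a.toNat b.toNat else 0

end JetDoublePoint

/-! Write x(t) = Σ x_a t^a, so that f_1, …, f_n are the coefficients c_0, …, c_{n-1} of x(t)^2. The
ideal J_m = (c_0, …, c_{m-1}) is compared with the edge ideal P_m of a path with m edges, generated
by the products x_i x_{i+1} with i < m.

Degeneration. Under the substitution x_i ↦ x(i) the edges become x(i)x(i+1). The j-th finite
difference at s = 0 of x(s)x(s+1), divided by j!, is a combination of the edges with i ≤ j; expanded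
over ordered pairs (a, b), its coefficient at x_a x_b is 0 for a + b < j and 1 for a + b = j. Its
form of lowest first degree is therefore c_j. So J_m lies in the initial ideal of the transformed
P_m (`exists_degeneration`), and the Hilbert series of R/P_m is at most that of R/J_m. Conversely,
the identity x(x^2)' = 2x'x^2 puts m x_0 c_m into J_m; this bounds the series of R/J_m from above by
a recursion that the path ideals satisfy with equality. Hence the two series agree
(`hilbSeries_jI`), J_m is the whole initial ideal, and (J_{m+1} : c_{m+1}) is (x_0) plus the ideal
of the first m - 1 coefficients of (x_1 + x_2 t + ⋯)^2 (`colonIdeal_jI`).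

Resolutions. Mapping cones along these colon ideals give a bigraded resolution of J_m with ranks
`bettiSeq` (`exists_res_jI`), whose minimality is not visible. The same recursion resolves P_m, and
there the cones are minimal: multiplication by an edge uv is lifted by v times a lift of
multiplication by u, so the comparison map is divisible by v (`exists_res_pathI`). A bigraded
resolution of the initial ideal lifts to a resolution of the transformed P_m with the same ranks
(`GradedRes.exists_deform`). The lift has the ranks of a minimal resolution, so it is minimal, and
then so is the bigraded resolution (`isMin_of_hilb_eq`).

A path with n edges has n + 1 vertices, so all this takes place in R_{n+1}; the variable x_n, which
occurs in none of the generators, is set to 0 at the end (`exists_res_dropLast`). Graded ranks of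
minimal resolutions are unique (`GradedRes.hilb_eq`), and the q-Pascal rules solve the recursion for
the ranks (`bettiSeq_eq`). -/

namespace JetDoublePoint

/-! ### Supports of vectors of polynomials -/

section Support

variable {k : Type*} [Field k] {σ M : Type*} [AddCommMonoid M] (w : σ → M)

/-- Every monomial of `p` has weight in `Q`. -/
def PolyIn (Q : M → Prop) (p : MvPolynomial σ k) : Prop :=
  ∀ μ, coeff μ p ≠ 0 → Q (Finsupp.weight w μ)

/-- Every monomial `x^μ e_a` of `v` has degree in `Q`. -/
def VecIn {ι : Type*} (deg : ι → M) (Q : M → Prop) (v : ι →₀ MvPolynomial σ k) : Prop :=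
  ∀ a, PolyIn w (fun m => Q (m + deg a)) (v a)

variable {w} {ι κ : Type*} {deg : ι → M} {deg' : κ → M} {Q Q' : M → Prop}

theorem PolyIn.mono {p : MvPolynomial σ k} (h : PolyIn w Q p) (hQ : ∀ m, Q m → Q' m) :
    PolyIn w Q' p := fun μ hμ => hQ _ (h μ hμ)

theorem polyIn_zero : PolyIn w Q (0 : MvPolynomial σ k) := fun μ hμ => absurd (coeff_zero μ) hμ

theorem PolyIn.add {p q : MvPolynomial σ k} (hp : PolyIn w Q p) (hq : PolyIn w Q q) :
    PolyIn w Q (p + q) := by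
  intro μ hμ
  by_contra hQ
  rw [coeff_add, not_not.1 fun h => hQ (hp μ h), not_not.1 fun h => hQ (hq μ h), add_zero] at hμ
  exact hμ rfl

theorem PolyIn.neg {p : MvPolynomial σ k} (hp : PolyIn w Q p) : PolyIn w Q (-p) := by
  intro μ hμ
  rw [coeff_neg, neg_ne_zero] at hμ
  exact hp μ hμ

theorem PolyIn.sub {p q : MvPolynomial σ k} (hp : PolyIn w Q p) (hq : PolyIn w Q q) :
    PolyIn w Q (p - q) := sub_eq_add_neg p q ▸ hp.add hq.neg

theorem PolyIn.sum {α : Type*} {s : Finset α} {f : α → MvPolynomial σ k}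
    (h : ∀ a ∈ s, PolyIn w Q (f a)) : PolyIn w Q (∑ a ∈ s, f a) := by
  classical
  induction s using Finset.induction_on with
  | empty => exact polyIn_zero
  | insert a s ha ih =>
    rw [Finset.sum_insert ha]
    exact (h a (by simp)).add (ih fun b hb => h b (by simp [hb]))

theorem polyIn_monomial {μ : σ →₀ ℕ} {c : k} (h : Q (Finsupp.weight w μ)) :
    PolyIn w Q (monomial μ c) := by
  classical
  intro ν hν
  rw [coeff_monomial] at hν
  split_ifs at hν with e
  · exact e ▸ h
  · exact absurd rfl hν

theorem PolyIn.mul {p q : MvPolynomial σ k} {P : M → Prop} (hp : PolyIn w P p)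
    (hq : PolyIn w Q q) : PolyIn w (fun m => ∃ a b, P a ∧ Q b ∧ a + b = m) (p * q) := by
  classical
  intro μ hμ
  rw [coeff_mul] at hμ
  obtain ⟨x, hx, hne⟩ := Finset.exists_ne_zero_of_sum_ne_zero hμ
  refine ⟨_, _, hp x.1 (left_ne_zero_of_mul hne), hq x.2 (right_ne_zero_of_mul hne), ?_⟩
  rw [← map_add, Finset.HasAntidiagonal.mem_antidiagonal.1 hx]

theorem polyIn_iff_isWeightedHomogeneous {p : MvPolynomial σ k} {m : M} :
    PolyIn w (fun a => a = m) p ↔ IsWeightedHomogeneous w p m :=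
  ⟨fun h _ hμ => h _ hμ, fun h _ hμ => h hμ⟩

theorem PolyIn.eq_zero {p : MvPolynomial σ k} (hp : PolyIn w Q p)
    (hp' : PolyIn w (fun m => ¬ Q m) p) : p = 0 := by
  ext μ
  by_contra h
  exact hp' μ h (hp μ h)

variable (w Q) in
/-- The part of `p` supported on monomials of weight in `Q`. -/
noncomputable def polyPart (p : MvPolynomial σ k) : MvPolynomial σ k := by
  classical
  exact ∑ μ ∈ p.support with Q (Finsupp.weight w μ), monomial μ (coeff μ p)

theorem coeff_polyPart_of {p : MvPolynomial σ k} {μ : σ →₀ ℕ} (h : Q (Finsupp.weight w μ)) :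
    coeff μ (polyPart w Q p) = coeff μ p := by
  classical
  rw [polyPart, coeff_sum]
  simp only [coeff_monomial, Finset.sum_ite_eq', Finset.mem_filter, mem_support_iff, h, and_true]
  split_ifs with h0
  · rfl
  · exact (not_not.1 h0).symm

theorem coeff_polyPart_of_not {p : MvPolynomial σ k} {μ : σ →₀ ℕ}
    (h : ¬ Q (Finsupp.weight w μ)) : coeff μ (polyPart w Q p) = 0 := by
  classical
  rw [polyPart, coeff_sum]
  simp [coeff_monomial, h]

theorem polyIn_polyPart (p : MvPolynomial σ k) : PolyIn w Q (polyPart w Q p) := by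
  intro μ hμ
  by_contra h
  exact hμ (coeff_polyPart_of_not h)

theorem polyIn_sub_polyPart (p : MvPolynomial σ k) :
    PolyIn w (fun m => ¬ Q m) (p - polyPart w Q p) := by
  intro μ hμ h
  rw [coeff_sub, coeff_polyPart_of h, sub_self] at hμ
  exact hμ rfl

theorem polyPart_add (p q : MvPolynomial σ k) :
    polyPart w Q (p + q) = polyPart w Q p + polyPart w Q q := by
  ext μ
  by_cases h : Q (Finsupp.weight w μ)
  · simp [coeff_polyPart_of h]
  · simp [coeff_polyPart_of_not h]

theorem polyPart_smul (c : k) (p : MvPolynomial σ k) :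
    polyPart w Q (c • p) = c • polyPart w Q p := by
  ext μ
  by_cases h : Q (Finsupp.weight w μ)
  · simp [coeff_polyPart_of h]
  · simp [coeff_polyPart_of_not h]

theorem polyPart_eq_self {p : MvPolynomial σ k} (h : PolyIn w Q p) : polyPart w Q p = p := by
  ext μ
  by_cases hQ : Q (Finsupp.weight w μ)
  · exact coeff_polyPart_of hQ
  · rw [coeff_polyPart_of_not hQ]
    by_contra h0
    exact hQ (h μ (Ne.symm h0))

theorem polyPart_eq_zero {p : MvPolynomial σ k} (h : PolyIn w (fun m => ¬ Q m) p) :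
    polyPart w Q p = 0 := by
  ext μ
  by_cases hQ : Q (Finsupp.weight w μ)
  · rw [coeff_polyPart_of hQ, coeff_zero]
    by_contra h0
    exact h μ h0 hQ
  · exact coeff_polyPart_of_not hQ

variable (w Q) in
/-- `polyPart` as a linear map. -/
noncomputable def polyPartHom : MvPolynomial σ k →ₗ[k] MvPolynomial σ k where
  toFun := polyPart w Q
  map_add' := polyPart_add
  map_smul' := polyPart_smul

theorem VecIn.mono {v : ι →₀ MvPolynomial σ k} (h : VecIn w deg Q v) (hQ : ∀ m, Q m → Q' m) :
    VecIn w deg Q' v := fun a => (h a).mono fun _ => hQ _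

theorem vecIn_zero : VecIn w deg Q (0 : ι →₀ MvPolynomial σ k) := fun _ => polyIn_zero

theorem VecIn.add {u v : ι →₀ MvPolynomial σ k} (hu : VecIn w deg Q u) (hv : VecIn w deg Q v) :
    VecIn w deg Q (u + v) := fun a => (hu a).add (hv a)

theorem VecIn.neg {u : ι →₀ MvPolynomial σ k} (hu : VecIn w deg Q u) :
    VecIn w deg Q (-u) := fun a => (hu a).neg

theorem VecIn.sub {u v : ι →₀ MvPolynomial σ k} (hu : VecIn w deg Q u) (hv : VecIn w deg Q v) :
    VecIn w deg Q (u - v) := fun a => (hu a).sub (hv a)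

theorem VecIn.sum {α : Type*} {s : Finset α} {f : α → (ι →₀ MvPolynomial σ k)}
    (h : ∀ a ∈ s, VecIn w deg Q (f a)) : VecIn w deg Q (∑ a ∈ s, f a) := by
  intro a
  rw [Finsupp.finsetSum_apply]
  exact PolyIn.sum fun b hb => h b hb a

theorem VecIn.eq_zero {v : ι →₀ MvPolynomial σ k} (hv : VecIn w deg Q v)
    (hv' : VecIn w deg (fun m => ¬ Q m) v) : v = 0 :=
  Finsupp.ext fun a => (hv a).eq_zero (hv' a)

theorem vecIn_single {p : MvPolynomial σ k} {a : ι} (h : PolyIn w (fun m => Q (m + deg a)) p) :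
    VecIn w deg Q (Finsupp.single a p) := by
  classical
  intro b
  rw [Finsupp.single_apply]
  split_ifs with e
  · exact e ▸ h
  · exact polyIn_zero

variable (w deg Q) in
theorem exists_split (v : ι →₀ MvPolynomial σ k) : ∃ v₁ v₂, v = v₁ + v₂ ∧ VecIn w deg Q v₁ ∧
    VecIn w deg (fun m => ¬ Q m) v₂ := by
  have h0 : ∀ a, polyPart w (fun m => Q (m + deg a)) (0 : MvPolynomial σ k) = 0 := fun a =>
    polyPart_eq_zero polyIn_zero
  let v₁ : ι →₀ MvPolynomial σ k :=
    Finsupp.onFinset v.support (fun a => polyPart w (fun m => Q (m + deg a)) (v a)) fun a ha => by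
      rw [Finsupp.mem_support_iff]
      intro h
      rw [h] at ha
      exact ha (h0 a)
  refine ⟨v₁, v - v₁, by abel, fun a => polyIn_polyPart _, fun a => ?_⟩
  exact polyIn_sub_polyPart (v a)

theorem VecIn.add_left_cancel {u v u' v' : ι →₀ MvPolynomial σ k} (h : u + v = u' + v')
    (hu : VecIn w deg Q u) (hu' : VecIn w deg Q u') (hv : VecIn w deg (fun m => ¬ Q m) v)
    (hv' : VecIn w deg (fun m => ¬ Q m) v') : u = u' := by
  have e : u - u' = v' - v := by rw [sub_eq_sub_iff_add_eq_add, h, add_comm]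
  exact sub_eq_zero.1 ((hu.sub hu').eq_zero (e ▸ hv'.sub hv))

/-- A linear map that relates the degrees of basis vectors to those of their images by a
translation invariant relation does so for all vectors. -/
theorem VecIn.map {R : M → M → Prop} (hR : ∀ a b c, R a b → R (c + a) (c + b))
    (f : (ι →₀ MvPolynomial σ k) →ₗ[MvPolynomial σ k] (κ →₀ MvPolynomial σ k))
    (hf : ∀ e, VecIn w deg' (R (deg e)) (f (Finsupp.single e 1)))
    {v : ι →₀ MvPolynomial σ k} (hv : VecIn w deg Q v) :
    VecIn w deg' (fun m => ∃ a, Q a ∧ R a m) (f v) := by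
  have hsum : f v = ∑ e ∈ v.support, v e • f (Finsupp.single e 1) := by
    conv_lhs => rw [← Finsupp.sum_single v]
    rw [Finsupp.sum, map_sum]
    refine Finset.sum_congr rfl fun e _ => ?_
    rw [← map_smul, Finsupp.smul_single, smul_eq_mul, mul_one]
  rw [hsum]
  refine VecIn.sum fun e _ a => ?_
  rw [Finsupp.smul_apply, smul_eq_mul]
  refine ((hv e).mul (hf e a)).mono ?_
  rintro _ ⟨x, y, hx, hy, rfl⟩
  exact ⟨_, hx, add_assoc x y _ ▸ hR _ _ x hy⟩

theorem VecIn.map_eq (f : (ι →₀ MvPolynomial σ k) →ₗ[MvPolynomial σ k] (κ →₀ MvPolynomial σ k))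
    (hf : ∀ e, VecIn w deg' (fun m => m = deg e) (f (Finsupp.single e 1)))
    {v : ι →₀ MvPolynomial σ k} (hv : VecIn w deg Q v) : VecIn w deg' Q (f v) := by
  refine (VecIn.map (R := fun a b => b = a) ?_ f hf hv).mono ?_
  · rintro a b c rfl; rfl
  · rintro m ⟨a, ha, rfl⟩; exact ha

/-- It suffices to keep the part of a preimage supported in `Q`: since `f` preserves degrees, the
other part maps to a vector supported off `Q`, which must vanish. -/
theorem exists_preimage_vecIn
    (f : (ι →₀ MvPolynomial σ k) →ₗ[MvPolynomial σ k] (κ →₀ MvPolynomial σ k))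
    (hf : ∀ e, VecIn w deg' (fun m => m = deg e) (f (Finsupp.single e 1)))
    {v : κ →₀ MvPolynomial σ k} (hv : VecIn w deg' Q v) (h : v ∈ LinearMap.range f) :
    ∃ u, VecIn w deg Q u ∧ f u = v := by
  obtain ⟨u, rfl⟩ := h
  obtain ⟨u₁, u₂, rfl, h₁, h₂⟩ := exists_split w deg Q u
  refine ⟨u₁, h₁, ?_⟩
  rw [map_add] at hv ⊢
  exact VecIn.add_left_cancel (by rw [add_zero]) (VecIn.map_eq f hf h₁) hv
    (VecIn.map_eq f hf h₂) vecIn_zero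

end Support

/-! ### Reduction of matrices modulo the maximal ideal -/

section Reduction

variable {k : Type*} [Field k] {σ : Type*} {ι κ lam : Type*}

/-- Constant coefficients of a vector of polynomials. -/
noncomputable def constVec : (ι →₀ MvPolynomial σ k) →ₗ[k] (ι →₀ k) :=
  Finsupp.mapRange.linearMap (lcoeff k 0)

theorem constVec_apply (v : ι →₀ MvPolynomial σ k) (a : ι) :
    constVec v a = constantCoeff (v a) := rfl

theorem constVec_single (a : ι) (p : MvPolynomial σ k) :
    constVec (Finsupp.single a p) = Finsupp.single a (constantCoeff p) :=
  Finsupp.mapRange_single (hf := map_zero _)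

theorem constVec_smul (p : MvPolynomial σ k) (v : ι →₀ MvPolynomial σ k) :
    constVec (p • v) = constantCoeff p • constVec v := by
  ext a
  simp [constVec_apply]

/-- The reduction modulo the variables of a map of free modules. -/
noncomputable def redMap
    (f : (ι →₀ MvPolynomial σ k) →ₗ[MvPolynomial σ k] (κ →₀ MvPolynomial σ k)) :
    (ι →₀ k) →ₗ[k] (κ →₀ k) :=
  Finsupp.linearCombination k fun e => constVec (f (Finsupp.single e 1))

theorem redMap_single (f : (ι →₀ MvPolynomial σ k) →ₗ[MvPolynomial σ k] (κ →₀ MvPolynomial σ k))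
    (e : ι) : redMap f (Finsupp.single e 1) = constVec (f (Finsupp.single e 1)) := by
  simp [redMap]

theorem redMap_constVec
    (f : (ι →₀ MvPolynomial σ k) →ₗ[MvPolynomial σ k] (κ →₀ MvPolynomial σ k))
    (v : ι →₀ MvPolynomial σ k) : redMap f (constVec v) = constVec (f v) := by
  induction v using Finsupp.induction_linear with
  | zero => simp
  | add u v hu hv => simp [hu, hv]
  | single e p =>
    have h : (Finsupp.single e p : ι →₀ MvPolynomial σ k) = p • Finsupp.single e 1 := by simp
    rw [h, map_smul f, constVec_smul, constVec_smul, constVec_single, map_smul, map_one,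
      redMap_single]

theorem redMap_comp
    (g : (κ →₀ MvPolynomial σ k) →ₗ[MvPolynomial σ k] (lam →₀ MvPolynomial σ k))
    (f : (ι →₀ MvPolynomial σ k) →ₗ[MvPolynomial σ k] (κ →₀ MvPolynomial σ k)) :
    redMap (g ∘ₗ f) = redMap g ∘ₗ redMap f := by
  ext e : 2
  simp only [LinearMap.comp_apply, Finsupp.lsingle_apply]
  rw [redMap_single, redMap_single, redMap_constVec, LinearMap.comp_apply]

theorem redMap_id : redMap (LinearMap.id : (ι →₀ MvPolynomial σ k) →ₗ[MvPolynomial σ k] _) =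
    LinearMap.id := by
  ext e : 2
  simp [redMap_single, constVec_single]

theorem redMap_add
    (f g : (ι →₀ MvPolynomial σ k) →ₗ[MvPolynomial σ k] (κ →₀ MvPolynomial σ k)) :
    redMap (f + g) = redMap f + redMap g := by
  ext e : 2
  simp [redMap_single]

end Reduction

/-! ### Graded free resolutions of cyclic modules -/

/-- A free resolution of `R/I`, graded with respect to the weights `w` of the variables. -/
structure GradedRes {k : Type*} [Field k] {σ M : Type*} [AddCommMonoid M] (w : σ → M)
    (I : Ideal (MvPolynomial σ k)) where
  ι : ℕ → Type
  fin : ∀ i, Fintype (ι i)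
  deg : ∀ i, ι i → M
  d : ∀ i, (ι (i + 1) →₀ MvPolynomial σ k) →ₗ[MvPolynomial σ k] (ι i →₀ MvPolynomial σ k)
  aug : (ι 0 →₀ MvPolynomial σ k) →ₗ[MvPolynomial σ k] (MvPolynomial σ k ⧸ I)
  d_hom : ∀ i e, VecIn w (deg i) (fun m => m = deg (i + 1) e) (d i (Finsupp.single e 1))
  aug_hom : ∀ e, ∃ p, PolyIn w (fun m => m = deg 0 e) p ∧
    aug (Finsupp.single e 1) = Ideal.Quotient.mk I p
  aug_surjective : Function.Surjective aug
  exact_zero : Function.Exact (d 0) aug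
  exact_succ : ∀ i, Function.Exact (d (i + 1)) (d i)

namespace GradedRes

variable {k : Type*} [Field k] {σ M : Type*} [AddCommMonoid M] {w : σ → M}
  {I J : Ideal (MvPolynomial σ k)}

instance (F : GradedRes w I) (i : ℕ) : Fintype (F.ι i) := F.fin i

/-- The `i`-th module of the resolution. -/
abbrev X (F : GradedRes w I) (i : ℕ) := F.ι i →₀ MvPolynomial σ k

/-- Minimality: the entries of the differentials have no constant term. -/
def IsMin (F : GradedRes w I) : Prop := ∀ i, redMap (F.d i) = 0

/-- The submodule of cycles. -/
noncomputable def cycles (F : GradedRes w I) : ∀ i, Submodule (MvPolynomial σ k) (F.X i)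
  | 0 => LinearMap.ker F.aug
  | i + 1 => LinearMap.ker (F.d i)

theorem range_d (F : GradedRes w I) : ∀ i, LinearMap.range (F.d i) = F.cycles i
  | 0 => (LinearMap.exact_iff.1 F.exact_zero).symm
  | i + 1 => (LinearMap.exact_iff.1 (F.exact_succ i)).symm

theorem d_mem_cycles (F : GradedRes w I) (i : ℕ) (v : F.X (i + 1)) : F.d i v ∈ F.cycles i :=
  F.range_d i ▸ LinearMap.mem_range_self _ v

theorem d_d (F : GradedRes w I) (i : ℕ) (v : F.X (i + 2)) : F.d i (F.d (i + 1) v) = 0 :=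
  F.d_mem_cycles (i + 1) v

/-- A graded map into `F_i` with values in the cycles lifts to `F_{i+1}`. -/
theorem exists_lift (F : GradedRes w I) {κ : Type*} {Q : κ → M → Prop} (i : ℕ)
    (f : (κ →₀ MvPolynomial σ k) →ₗ[MvPolynomial σ k] F.X i)
    (hf : ∀ e, VecIn w (F.deg i) (Q e) (f (Finsupp.single e 1)))
    (hc : ∀ v, f v ∈ F.cycles i) :
    ∃ g : (κ →₀ MvPolynomial σ k) →ₗ[MvPolynomial σ k] F.X (i + 1),
      (∀ e, VecIn w (F.deg (i + 1)) (Q e) (g (Finsupp.single e 1))) ∧ F.d i ∘ₗ g = f := by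
  have h : ∀ e, ∃ u, VecIn w (F.deg (i + 1)) (Q e) u ∧ F.d i u = f (Finsupp.single e 1) := by
    intro e
    refine exists_preimage_vecIn (F.d i) (F.d_hom i) (hf e) ?_
    rw [F.range_d i]
    exact hc _
  choose u hu hu' using h
  refine ⟨Finsupp.linearCombination _ u, fun e => ?_, ?_⟩
  · simpa using hu e
  · ext e : 2
    simp [hu']

/-- A chain map of degree `c` given by multiplication by `b` on the resolved modules. -/
theorem exists_chainMap (F : GradedRes w J) (G : GradedRes w I) (b : MvPolynomial σ k) (c : M)
    (hF : ∀ p m, PolyIn w (fun a => a = m) p → ∃ v, VecIn w (F.deg 0) (fun a => a = m) v ∧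
      F.aug v = Ideal.Quotient.mk J p)
    (hb : PolyIn w (fun a => a = c) b) (hbI : ∀ s ∈ I, s * b ∈ J) :
    ∃ f : ∀ i, G.X i →ₗ[MvPolynomial σ k] F.X i,
      (∀ i e, VecIn w (F.deg i) (fun m => m = c + G.deg i e) (f i (Finsupp.single e 1))) ∧
      (∀ i, F.d i ∘ₗ f (i + 1) = f i ∘ₗ G.d i) ∧
      (∀ v p, G.aug v = Ideal.Quotient.mk I p → F.aug (f 0 v) = Ideal.Quotient.mk J (p * b)) := by
  have hR : ∀ x y z : M, y = c + x → z + y = c + (z + x) := by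
    rintro x _ z rfl
    exact add_left_comm _ _ _
  -- Each stage carries along that cycles go to cycles; this invariant is what permits the next
  -- lift.
  let T : ℕ → Type _ := fun i => {f : G.X i →ₗ[MvPolynomial σ k] F.X i //
    (∀ e, VecIn w (F.deg i) (fun m => m = c + G.deg i e) (f (Finsupp.single e 1))) ∧
    ∀ v ∈ G.cycles i, f v ∈ F.cycles i}
  have h0 : ∃ f : T 0, ∀ v p, G.aug v = Ideal.Quotient.mk I p →
      F.aug (f.1 v) = Ideal.Quotient.mk J (p * b) := by
    choose p hp hp' using G.aug_hom
    have h : ∀ e, ∃ v, VecIn w (F.deg 0) (fun a => a = c + G.deg 0 e) v ∧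
        F.aug v = Ideal.Quotient.mk J (p e * b) := by
      intro e
      refine hF _ _ (((hp e).mul hb).mono ?_)
      rintro _ ⟨x, y, rfl, rfl, rfl⟩
      exact add_comm _ _
    choose v hv hv' using h
    have key : ∀ u q, G.aug u = Ideal.Quotient.mk I q →
        F.aug (Finsupp.linearCombination (MvPolynomial σ k) v u) =
          Ideal.Quotient.mk J (q * b) := by
      intro u q hq
      have hsum : G.aug u = Ideal.Quotient.mk I (u.sum fun e r => r * p e) := by
        conv_lhs => rw [← Finsupp.sum_single u]
        rw [Finsupp.sum, Finsupp.sum, map_sum, map_sum]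
        refine Finset.sum_congr rfl fun e _ => ?_
        have : (Finsupp.single e (u e) : G.X 0) = u e • Finsupp.single e 1 := by simp
        rw [this, map_smul, hp', map_mul]
        rfl
      have hsum' : F.aug (Finsupp.linearCombination (MvPolynomial σ k) v u) =
          Ideal.Quotient.mk J ((u.sum fun e r => r * p e) * b) := by
        rw [Finsupp.linearCombination_apply, Finsupp.sum, Finsupp.sum, map_sum, Finset.sum_mul,
          map_sum]
        refine Finset.sum_congr rfl fun e _ => ?_
        rw [map_smul, hv', mul_assoc, map_mul]
        rfl
      rw [hsum', Ideal.Quotient.eq, ← sub_mul]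
      exact hbI _ (Ideal.Quotient.eq.1 (hsum.symm.trans hq))
    refine ⟨⟨Finsupp.linearCombination _ v, fun e => by simpa using hv e, fun u hu => ?_⟩, key⟩
    have := key u 0 (by rw [map_zero]; exact hu)
    rwa [zero_mul, map_zero] at this
  have hs : ∀ i (f : T i), ∃ g : T (i + 1), F.d i ∘ₗ g.1 = f.1 ∘ₗ G.d i := by
    intro i f
    obtain ⟨g, hg, hg'⟩ := F.exists_lift (Q := fun e m => m = c + G.deg (i + 1) e) i
      (f.1 ∘ₗ G.d i) (fun e => ((G.d_hom i e).map (R := fun x y => y = c + x) hR f.1 f.2.1).mono (by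
        rintro m ⟨a, rfl, rfl⟩; rfl)) (fun v => f.2.2 _ (G.d_mem_cycles i v))
    refine ⟨⟨g, hg, fun v hv => ?_⟩, hg'⟩
    have := LinearMap.congr_fun hg' v
    simp only [LinearMap.comp_apply] at this
    change F.d i (g v) = 0
    rw [this, show G.d i v = 0 from hv, map_zero]
  obtain ⟨f0, hf0⟩ := h0
  choose step hstep using hs
  let f : ∀ i, T i := fun i => Nat.rec f0 step i
  exact ⟨fun i => (f i).1, fun i => (f i).2.1, fun i => hstep i (f i), hf0⟩

/-- A chain endomorphism of a minimal resolution that lifts the identity is the identity modulo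
the variables. -/
theorem redMap_eq_id (F : GradedRes w I) (hF : F.IsMin)
    (f : ∀ i, F.X i →ₗ[MvPolynomial σ k] F.X i) (hf : ∀ i, F.d i ∘ₗ f (i + 1) = f i ∘ₗ F.d i)
    (h0 : ∀ v, F.aug (f 0 v) = F.aug v) (i : ℕ) : redMap (f i) = LinearMap.id := by
  -- The homotopy `h` carries the relation d h d = (f - 1) d, which says exactly that f - 1 - h d
  -- one step higher takes values in cycles and can be lifted.
  let T : ℕ → Type _ := fun i => {h : F.X i →ₗ[MvPolynomial σ k] F.X (i + 1) //
    ∀ v, F.d i (h (F.d i v)) = f i (F.d i v) - F.d i v}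
  have hf' : ∀ i v, F.d i (f (i + 1) v) = f i (F.d i v) := fun i v => LinearMap.congr_fun (hf i) v
  have triv : ∀ {κ : Type} (i : ℕ) (g : (κ →₀ MvPolynomial σ k) →ₗ[MvPolynomial σ k] F.X i),
      (∀ v, g v ∈ F.cycles i) → ∃ h : (κ →₀ MvPolynomial σ k) →ₗ[MvPolynomial σ k] F.X (i + 1),
        F.d i ∘ₗ h = g := fun i g hg => by
    obtain ⟨h, -, hh⟩ := F.exists_lift (Q := fun _ _ => True) i g (fun _ _ _ _ => trivial) hg
    exact ⟨h, hh⟩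
  have hz : ∃ h : T 0, F.d 0 ∘ₗ h.1 = f 0 - LinearMap.id := by
    obtain ⟨h, hh⟩ := triv 0 (f 0 - LinearMap.id) fun v => by
      change F.aug _ = 0
      simp [h0]
    exact ⟨⟨h, fun v => by simpa using LinearMap.congr_fun hh (F.d 0 v)⟩, hh⟩
  have hs : ∀ i (h : T i), ∃ g : T (i + 1),
      F.d (i + 1) ∘ₗ g.1 = f (i + 1) - LinearMap.id - h.1 ∘ₗ F.d i := by
    intro i h
    obtain ⟨g, hg⟩ := triv (i + 1) (f (i + 1) - LinearMap.id - h.1 ∘ₗ F.d i) fun v => by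
      change F.d i _ = 0
      simp [hf', h.2]
    exact ⟨⟨g, fun v => by simpa [F.d_d] using LinearMap.congr_fun hg (F.d (i + 1) v)⟩, hg⟩
  obtain ⟨s0, hs0⟩ := hz
  choose step hstep using hs
  let s : ∀ i, T i := fun i => Nat.rec s0 step i
  cases i with
  | zero =>
    have e : f 0 = F.d 0 ∘ₗ s0.1 + LinearMap.id := by rw [hs0]; abel
    rw [e, redMap_add, redMap_comp, hF, redMap_id, LinearMap.zero_comp, zero_add]
  | succ i =>
    have e : f (i + 1) = F.d (i + 1) ∘ₗ (s (i + 1)).1 + (s i).1 ∘ₗ F.d i + LinearMap.id := by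
      rw [show F.d (i + 1) ∘ₗ (s (i + 1)).1 = _ from hstep i (s i)]; abel
    rw [e, redMap_add, redMap_add, redMap_comp, redMap_comp, hF, hF, redMap_id,
      LinearMap.zero_comp, LinearMap.comp_zero, zero_add, zero_add]

/-- Homogeneous polynomials lift homogeneously along the augmentation, if `I` is homogeneous. -/
def AugLifts (F : GradedRes w I) : Prop :=
  ∀ p m, PolyIn w (fun a => a = m) p → ∃ v, VecIn w (F.deg 0) (fun a => a = m) v ∧
      F.aug v = Ideal.Quotient.mk I p

/-- Comparison maps between two resolutions of the same module. -/
theorem exists_comparison (F G : GradedRes w I) (hG : G.AugLifts) :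
    ∃ f : ∀ i, F.X i →ₗ[MvPolynomial σ k] G.X i,
      (∀ i e, VecIn w (G.deg i) (fun m => m = F.deg i e) (f i (Finsupp.single e 1))) ∧
      (∀ i, G.d i ∘ₗ f (i + 1) = f i ∘ₗ F.d i) ∧ ∀ v, G.aug (f 0 v) = F.aug v := by
  obtain ⟨f, hf, hf', h0⟩ := exists_chainMap G F 1 0 hG
    (fun μ hμ => by
      classical
      rw [coeff_one] at hμ
      split_ifs at hμ with e
      · rw [← e, map_zero]
      · exact absurd rfl hμ) (fun s hs => by rwa [mul_one])
  refine ⟨f, fun i e => (hf i e).mono fun m hm => by rw [hm, zero_add], hf', fun v => ?_⟩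
  obtain ⟨p, hp⟩ := Ideal.Quotient.mk_surjective (F.aug v)
  rw [h0 v p hp.symm, mul_one, hp]

/-- Only `F` has to be minimal. The one-sided conclusion makes the reduction of `f` injective even
when nothing is known about `G`. -/
theorem redMap_comp_eq_id (F G : GradedRes w I) (hF : F.IsMin)
    {f : ∀ i, F.X i →ₗ[MvPolynomial σ k] G.X i} {g : ∀ i, G.X i →ₗ[MvPolynomial σ k] F.X i}
    (hf : ∀ i, G.d i ∘ₗ f (i + 1) = f i ∘ₗ F.d i) (hf0 : ∀ v, G.aug (f 0 v) = F.aug v)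
    (hg : ∀ i, F.d i ∘ₗ g (i + 1) = g i ∘ₗ G.d i) (hg0 : ∀ v, F.aug (g 0 v) = G.aug v) (i : ℕ) :
    redMap (g i) ∘ₗ redMap (f i) = LinearMap.id := by
  rw [← redMap_comp]
  refine F.redMap_eq_id hF (fun i => g i ∘ₗ f i) (fun i => ?_) (fun v => ?_) i
  · rw [← LinearMap.comp_assoc, hg, LinearMap.comp_assoc, hf, LinearMap.comp_assoc]
  · simp [hf0, hg0]

/-- A resolution whose ranks are those of a minimal one is minimal. -/
theorem isMin_of_card_eq (F G : GradedRes w I) (hF : F.IsMin) (hF0 : F.AugLifts)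
    (hG0 : G.AugLifts) (h : ∀ i, Fintype.card (F.ι i) = Fintype.card (G.ι i)) : G.IsMin := by
  obtain ⟨f, -, hf, hf0⟩ := exists_comparison F G hG0
  obtain ⟨g, -, hg, hg0⟩ := exists_comparison G F hF0
  have hinj : ∀ i, Function.Injective (redMap (f i)) := fun i =>
    Function.LeftInverse.injective (g := redMap (g i)) fun v =>
      LinearMap.congr_fun (redMap_comp_eq_id F G hF hf hf0 hg hg0 i) v
  intro i
  -- Equal ranks turn injectivity into surjectivity; the reduction of the differential of `G`
  -- vanishes on the image of this map, because that of `F` is zero.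
  have hsurj : Function.Surjective (redMap (f (i + 1))) :=
    (LinearMap.injective_iff_surjective_of_finrank_eq_finrank (by
      simp [h])).1 (hinj (i + 1))
  refine LinearMap.ext fun v => ?_
  obtain ⟨u, rfl⟩ := hsurj v
  have := LinearMap.congr_fun (congrArg redMap (hf i)) u
  rw [redMap_comp, redMap_comp, hF, LinearMap.comp_zero] at this
  exact this

-- The images of the basis vectors of degree `m` are linearly independent and lie in the span of the
-- target basis vectors of degree `m`.
omit [AddCommMonoid M] in
theorem card_deg_le {ι κ : Type} [Fintype ι] [Fintype κ] [DecidableEq M] (deg : ι → M)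
    (deg' : κ → M) (f : (ι →₀ k) →ₗ[k] (κ →₀ k)) (hf : Function.Injective f)
    (h : ∀ e a, f (Finsupp.single e 1) a ≠ 0 → deg' a = deg e) (m : M) :
    Fintype.card {e // deg e = m} ≤ Fintype.card {a // deg' a = m} := by
  have hli : LinearIndependent k fun e : {e // deg e = m} =>
      (⟨f (Finsupp.single e.1 1), by
        rw [Finsupp.mem_supported]
        intro a ha
        exact (h _ _ (Finsupp.mem_support_iff.1 ha)).trans e.2⟩ :
        Finsupp.supported k k {a | deg' a = m}) := by
    rw [← LinearMap.linearIndependent_iff_of_injOn (Submodule.subtype _)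
      (Submodule.subtype_injective _).injOn]
    have h1 : LinearIndependent k fun e : ι => f (Finsupp.single e 1) :=
      (LinearMap.linearIndependent_iff f (LinearMap.ker_eq_bot.2 hf)).2
        (Finsupp.linearIndependent_single_one k ι)
    exact h1.comp _ Subtype.val_injective
  have := hli.fintype_card_le_finrank
  rw [(Finsupp.supportedEquivFinsupp {a | deg' a = m}).finrank_eq] at this
  rw [Module.finrank_finsupp_self] at this
  exact this.trans_eq (Fintype.card_congr (Equiv.refl _))

/-- Two minimal graded resolutions have the same graded ranks. -/
theorem card_deg_eq [DecidableEq M] (F G : GradedRes w I) (hF : F.IsMin) (hG : G.IsMin)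
    (hF0 : F.AugLifts) (hG0 : G.AugLifts) (i : ℕ) (m : M) :
    Fintype.card {e // F.deg i e = m} = Fintype.card {e // G.deg i e = m} := by
  obtain ⟨f, hfd, hf, hf0⟩ := exists_comparison F G hG0
  obtain ⟨g, hgd, hg, hg0⟩ := exists_comparison G F hF0
  have key : ∀ {ι κ : Type} (deg : ι → M) (deg' : κ → M)
      (f : (ι →₀ MvPolynomial σ k) →ₗ[MvPolynomial σ k] (κ →₀ MvPolynomial σ k)),
      (∀ e, VecIn w deg' (fun m => m = deg e) (f (Finsupp.single e 1))) →
      ∀ e a, redMap f (Finsupp.single e 1) a ≠ 0 → deg' a = deg e := by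
    intro ι κ deg deg' f hf e a ha
    rw [redMap_single, constVec_apply] at ha
    have := hf e a 0 ha
    rwa [map_zero, zero_add] at this
  refine le_antisymm
    (card_deg_le _ _ (redMap (f i)) (Function.LeftInverse.injective (g := redMap (g i)) fun v =>
      LinearMap.congr_fun (redMap_comp_eq_id F G hF hf hf0 hg hg0 i) v) (key _ _ _ (hfd i)) m)
    (card_deg_le _ _ (redMap (g i)) (Function.LeftInverse.injective (g := redMap (f i)) fun v =>
      LinearMap.congr_fun (redMap_comp_eq_id G F hG hg hg0 hf hf0 i) v) (key _ _ _ (hgd i)) m)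

/-- The generating function of the degrees of the basis of `F_i`. -/
noncomputable def hilb (F : GradedRes w I) {A : Type*} [CommRing A] (χ : M → A) (i : ℕ) : A :=
  ∑ e, χ (F.deg i e)

theorem hilb_eq (F G : GradedRes w I) (hF : F.IsMin) (hG : G.IsMin)
    (hF0 : F.AugLifts) (hG0 : G.AugLifts) {A : Type*} [CommRing A] (χ : M → A) (i : ℕ) :
    F.hilb χ i = G.hilb χ i := by
  classical
  have e : ∀ m, Nonempty ({e // F.deg i e = m} ≃ {e // G.deg i e = m}) := fun m =>
    Fintype.card_eq.1 (card_deg_eq F G hF hG hF0 hG0 i m)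
  let E := (Equiv.sigmaFiberEquiv (F.deg i)).symm.trans
    ((Equiv.sigmaCongrRight fun m => (e m).some).trans (Equiv.sigmaFiberEquiv (G.deg i)))
  refine Fintype.sum_equiv E _ _ fun x => ?_
  congr 1
  exact (((e (F.deg i x)).some ⟨x, rfl⟩).2).symm

end GradedRes

/-! ### Mapping cones -/

namespace GradedRes

variable {k : Type*} [Field k] {σ M : Type*} [AddCommMonoid M] {w : σ → M}
  {I J J' : Ideal (MvPolynomial σ k)}

/-- `F_0 = R`, and the augmentation is the quotient map. -/
def IsStd (F : GradedRes w I) : Prop :=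
  ∃ e₀ : F.ι 0, (∀ e, e = e₀) ∧ F.deg 0 e₀ = 0 ∧
    F.aug (Finsupp.single e₀ 1) = Ideal.Quotient.mk I 1

theorem IsStd.augLifts {F : GradedRes w I} (h : F.IsStd) : F.AugLifts := by
  obtain ⟨e₀, -, hd, ha⟩ := h
  intro p m hp
  refine ⟨Finsupp.single e₀ p, vecIn_single (by simpa [hd] using hp), ?_⟩
  have e : (Finsupp.single e₀ p : F.X 0) = p • Finsupp.single e₀ 1 := by simp
  rw [e, map_smul, ha, ← mul_one p, map_mul, mul_one]
  rfl

theorem isMin_iff {F : GradedRes w I} :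
    F.IsMin ↔ ∀ i e a, constantCoeff (F.d i (Finsupp.single e 1) a) = 0 := by
  constructor
  · intro h i e a
    have := congrArg (· a) (LinearMap.congr_fun (h i) (Finsupp.single e 1))
    simpa [redMap_single, constVec_apply] using this
  · intro h i
    ext e a
    simpa [redMap_single, constVec_apply] using h i e a

/-- Index types of the mapping cone. -/
def coneι (F : GradedRes w J) (G : GradedRes w J') : ℕ → Type
  | 0 => F.ι 0
  | i + 1 => F.ι (i + 1) ⊕ G.ι i

/-- Degrees in the mapping cone of a map of degree `c`. -/
def coneDeg (F : GradedRes w J) (G : GradedRes w J') (c : M) : ∀ i, coneι F G i → M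
  | 0 => F.deg 0
  | i + 1 => Sum.elim (F.deg (i + 1)) fun e => c + G.deg i e

/-- The differential of the mapping cone. -/
noncomputable def coneD (F : GradedRes w J) (G : GradedRes w J')
    (f : ∀ i, G.X i →ₗ[MvPolynomial σ k] F.X i) :
    ∀ i, (coneι F G (i + 1) →₀ MvPolynomial σ k) →ₗ[MvPolynomial σ k]
      (coneι F G i →₀ MvPolynomial σ k)
  | 0 => ((F.d 0).coprod (f 0)) ∘ₗ
      (Finsupp.sumFinsuppLEquivProdFinsupp (MvPolynomial σ k)).toLinearMap
  | i + 1 => (Finsupp.sumFinsuppLEquivProdFinsupp (MvPolynomial σ k)).symm.toLinearMap ∘ₗ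
      (((F.d (i + 1)).coprod (f (i + 1))).prod (-(G.d i ∘ₗ LinearMap.snd _ _ _))) ∘ₗ
      (Finsupp.sumFinsuppLEquivProdFinsupp (MvPolynomial σ k)).toLinearMap

theorem vecIn_sum_symm {ι κ : Type*} {deg : ι → M} {deg' : κ → M} {Q : M → Prop}
    {u : ι →₀ MvPolynomial σ k} {v : κ →₀ MvPolynomial σ k}
    (hu : VecIn w deg Q u) (hv : VecIn w deg' Q v) : VecIn w (Sum.elim deg deg') Q
      ((Finsupp.sumFinsuppLEquivProdFinsupp (MvPolynomial σ k)).symm (u, v)) := by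
  rintro (a | a)
  · simpa using hu a
  · simpa using hv a

theorem sumEquiv_single_inl {ι κ : Type*} (e : ι) (p : MvPolynomial σ k) :
    Finsupp.sumFinsuppLEquivProdFinsupp (MvPolynomial σ k)
      (Finsupp.single (Sum.inl e : ι ⊕ κ) p) = (Finsupp.single e p, 0) := by
  rw [← LinearEquiv.eq_symm_apply]
  classical
  ext (a | a)
  · simp [Finsupp.single_apply]
  · simp

theorem sumEquiv_single_inr {ι κ : Type*} (e : κ) (p : MvPolynomial σ k) :
    Finsupp.sumFinsuppLEquivProdFinsupp (MvPolynomial σ k)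
      (Finsupp.single (Sum.inr e : ι ⊕ κ) p) = (0, Finsupp.single e p) := by
  rw [← LinearEquiv.eq_symm_apply]
  classical
  ext (a | a)
  · simp
  · simp [Finsupp.single_apply]

/-- The mapping cone of multiplication by `a * b` from `R/(J : a * b)` to `R/J`. -/
theorem exists_cone (F : GradedRes w J) (G : GradedRes w J') (hF : F.IsStd)
    {a b : MvPolynomial σ k} {ca cb : M} (ha : PolyIn w (fun m => m = ca) a)
    (hb : PolyIn w (fun m => m = cb) b) (hJ : ∀ s ∈ J', s * b ∈ J)
    (hJ' : ∀ s, s * (a * b) ∈ J → s ∈ J') :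
    ∃ H : GradedRes w (J ⊔ Ideal.span {a * b}), H.IsStd ∧
      (F.IsMin → G.IsMin → constantCoeff a = 0 → H.IsMin) ∧
      ∀ {A : Type*} [CommRing A] (χ : M → A), H.hilb χ 0 = F.hilb χ 0 ∧
        ∀ i, H.hilb χ (i + 1) = F.hilb χ (i + 1) + ∑ e, χ (ca + cb + G.deg i e) := by
  obtain ⟨f, hfd, hfc, hf0⟩ := exists_chainMap F G b cb hF.augLifts hb hJ
  -- Since `J'` already multiplies `b` into `J`, multiplication by `a * b` is lifted by `a` times a
  -- lift of multiplication by `b`. The entries of this comparison map are multiples of `a`, hence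
  -- without constant term if `a` has none.
  let g : ∀ i, G.X i →ₗ[MvPolynomial σ k] F.X i := fun i => a • f i
  have hgd : ∀ i e, VecIn w (F.deg i) (fun m => m = ca + cb + G.deg i e)
      (g i (Finsupp.single e 1)) := by
    intro i e x
    refine (ha.mul (hfd i e x)).mono ?_
    rintro _ ⟨y, z, rfl, hz, rfl⟩
    rw [add_assoc, hz, add_assoc]
  have hgc : ∀ i v, F.d i (g (i + 1) v) = g i (G.d i v) := fun i v => by
    have := LinearMap.congr_fun (hfc i) v
    simp only [LinearMap.comp_apply] at this
    simp [g, this]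
  have hg0 : ∀ v p, G.aug v = Ideal.Quotient.mk J' p →
      F.aug (g 0 v) = Ideal.Quotient.mk J (p * (a * b)) := fun v p h => by
    rw [show p * (a * b) = a * (p * b) by ring, map_mul, ← hf0 v p h]
    simp only [g, LinearMap.smul_apply, map_smul]
    rfl
  have hle : J ≤ J ⊔ Ideal.span {a * b} := le_sup_left
  let π := (Ideal.Quotient.factorₐ (MvPolynomial σ k) hle).toLinearMap
  have hπ : ∀ p, π (Ideal.Quotient.mk J p) = Ideal.Quotient.mk _ p := fun _ => rfl
  let E := fun i => Finsupp.sumFinsuppLEquivProdFinsupp (α := F.ι (i + 1)) (β := G.ι i)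
    (M := MvPolynomial σ k) (MvPolynomial σ k)
  have hmkF : ∀ v, ∃ p, F.aug v = Ideal.Quotient.mk J p := fun v =>
    (Ideal.Quotient.mk_surjective (F.aug v)).imp fun _ h => h.symm
  have hmkG : ∀ v, ∃ p, G.aug v = Ideal.Quotient.mk J' p := fun v =>
    (Ideal.Quotient.mk_surjective (G.aug v)).imp fun _ h => h.symm
  -- cycles of the cone, at the level `F_{i+1} ⊕ G_i`
  have hstep : ∀ i (u : F.X (i + 1)) (v : G.X i), F.d i u + g i v = 0 → v ∈ G.cycles i →
      ∃ u' v', F.d (i + 1) u' + g (i + 1) v' = u ∧ -G.d i v' = v := by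
    intro i u v h hv
    rw [← G.range_d i] at hv
    obtain ⟨v', rfl⟩ := hv
    have h1 : u + g (i + 1) v' ∈ F.cycles (i + 1) := by
      change F.d i _ = 0
      rw [map_add, hgc, h]
    rw [← F.range_d] at h1
    obtain ⟨u', hu'⟩ := h1
    exact ⟨u', -v', by rw [hu', map_neg]; abel, by rw [map_neg, neg_neg]⟩
  let H : GradedRes w (J ⊔ Ideal.span {a * b}) :=
    { ι := coneι F G
      fin := fun i => match i with
        | 0 => F.fin 0
        | i + 1 => @instFintypeSum _ _ (F.fin (i + 1)) (G.fin i)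
      deg := coneDeg F G (ca + cb)
      d := coneD F G g
      aug := π ∘ₗ F.aug
      d_hom := by
        rintro (_ | i) (e | e)
        · change VecIn w _ _ (((F.d 0).coprod (g 0)) (E 0 (Finsupp.single (Sum.inl e) 1)))
          rw [sumEquiv_single_inl, LinearMap.coprod_apply, map_zero, add_zero]
          exact F.d_hom 0 e
        · change VecIn w _ _ (((F.d 0).coprod (g 0)) (E 0 (Finsupp.single (Sum.inr e) 1)))
          rw [sumEquiv_single_inr]
          simp only [LinearMap.coprod_apply, map_zero, zero_add (g 0 _)]
          exact hgd 0 e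
        · change VecIn w _ _ ((E i).symm (((F.d (i + 1)).coprod (g (i + 1))).prod
            (-(G.d i ∘ₗ LinearMap.snd _ _ _)) (E (i + 1) (Finsupp.single (Sum.inl e) 1))))
          rw [sumEquiv_single_inl]
          refine vecIn_sum_symm ?_ ?_
          · rw [LinearMap.coprod_apply, map_zero, add_zero]
            exact F.d_hom (i + 1) e
          · rw [LinearMap.neg_apply, LinearMap.comp_apply, LinearMap.snd_apply, map_zero, neg_zero]
            exact vecIn_zero
        · change VecIn w _ _ ((E i).symm (((F.d (i + 1)).coprod (g (i + 1))).prod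
            (-(G.d i ∘ₗ LinearMap.snd _ _ _)) (E (i + 1) (Finsupp.single (Sum.inr e) 1))))
          rw [sumEquiv_single_inr]
          refine vecIn_sum_symm ?_ ?_
          · rw [LinearMap.coprod_apply, map_zero, zero_add]
            exact hgd (i + 1) e
          · simp only [LinearMap.neg_apply, LinearMap.comp_apply, LinearMap.snd_apply]
            refine VecIn.neg fun x => (G.d_hom i e x).mono fun m hm => ?_
            change m + (ca + cb + G.deg i x) = ca + cb + G.deg (i + 1) e
            rw [← hm, add_left_comm]
      aug_hom := by
        intro e
        obtain ⟨p, hp, hp'⟩ := F.aug_hom e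
        refine ⟨p, hp, ?_⟩
        change π (F.aug (Finsupp.single e 1)) = _
        rw [hp', hπ]
      aug_surjective := by
        intro x
        obtain ⟨p, rfl⟩ := Ideal.Quotient.mk_surjective x
        obtain ⟨v, hv⟩ := F.aug_surjective (Ideal.Quotient.mk J p)
        refine ⟨v, ?_⟩
        change π (F.aug v) = _
        rw [hv, hπ]
      exact_zero := by
        intro (v : F.X 0)
        obtain ⟨p, hp⟩ := hmkF v
        change π (F.aug v) = 0 ↔ _
        rw [hp, hπ, Ideal.Quotient.eq_zero_iff_mem]
        constructor
        · intro h
          obtain ⟨j, hj, y, hy, rfl⟩ := Submodule.mem_sup.1 h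
          obtain ⟨s, rfl⟩ := Ideal.mem_span_singleton'.1 hy
          obtain ⟨x, hx⟩ := G.aug_surjective (Ideal.Quotient.mk J' s)
          have h1 : v - g 0 x ∈ F.cycles 0 := by
            change F.aug _ = 0
            rw [map_sub, hp, hg0 x s hx, ← map_sub, Ideal.Quotient.eq_zero_iff_mem]
            simpa using hj
          rw [← F.range_d] at h1
          obtain ⟨u, hu⟩ := h1
          refine ⟨(E 0).symm (u, x), ?_⟩
          change ((F.d 0).coprod (g 0)) (E 0 ((E 0).symm (u, x))) = v
          rw [LinearEquiv.apply_symm_apply, LinearMap.coprod_apply, hu, sub_add_cancel]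
        · rintro ⟨z, rfl⟩
          obtain ⟨⟨u, x⟩, rfl⟩ := (E 0).symm.surjective z
          obtain ⟨s, hs⟩ := hmkG x
          have h1 : F.aug (((F.d 0).coprod (g 0)) (E 0 ((E 0).symm (u, x)))) =
              Ideal.Quotient.mk J p := hp
          rw [LinearEquiv.apply_symm_apply, LinearMap.coprod_apply, map_add,
            show F.aug (F.d 0 u) = 0 from F.d_mem_cycles 0 u, zero_add, hg0 x s hs,
            Ideal.Quotient.eq] at h1
          have h2 : s * (a * b) - (s * (a * b) - p) ∈ J ⊔ Ideal.span {a * b} :=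
            sub_mem (Ideal.mul_mem_left _ _ (le_sup_right (a := J)
              (Ideal.mem_span_singleton_self _))) (hle h1)
          rwa [sub_sub_cancel] at h2
      exact_succ := by
        rintro (_ | i) z
        · obtain ⟨⟨u, x⟩, rfl⟩ := (E 0).symm.surjective z
          change ((F.d 0).coprod (g 0)) (E 0 ((E 0).symm (u, x))) = 0 ↔ _
          rw [LinearEquiv.apply_symm_apply, LinearMap.coprod_apply]
          constructor
          · intro h
            obtain ⟨s, hs⟩ := hmkG x
            -- The augmentation kills the boundary of `u`, which leaves `s * (a * b) ∈ J`; here the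
            -- inclusion of (J : ab) in `J'` enters.
            have h1 : x ∈ G.cycles 0 := by
              have h2 := congrArg F.aug h
              rw [map_add, show F.aug (F.d 0 u) = 0 from F.d_mem_cycles 0 u, zero_add, map_zero,
                hg0 x s hs, Ideal.Quotient.eq_zero_iff_mem] at h2
              change G.aug x = 0
              rw [hs, Ideal.Quotient.eq_zero_iff_mem]
              exact hJ' s h2
            obtain ⟨u', v', h2, h3⟩ := hstep 0 u x h h1
            refine ⟨(E 1).symm (u', v'), ?_⟩
            change (E 0).symm (((F.d 1).coprod (g 1)).prod
              (-(G.d 0 ∘ₗ LinearMap.snd _ _ _)) (E 1 ((E 1).symm (u', v')))) = _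
            rw [LinearEquiv.apply_symm_apply]
            exact congrArg _ (Prod.ext h2 h3)
          · rintro ⟨z, hz⟩
            obtain ⟨⟨u', v'⟩, rfl⟩ := (E 1).symm.surjective z
            change (E 0).symm (((F.d 1).coprod (g 1)).prod
              (-(G.d 0 ∘ₗ LinearMap.snd _ _ _)) (E 1 ((E 1).symm (u', v')))) = _ at hz
            rw [LinearEquiv.apply_symm_apply, EmbeddingLike.apply_eq_iff_eq, Prod.ext_iff] at hz
            obtain ⟨rfl, rfl⟩ := hz
            simp [F.d_d, hgc]
        · obtain ⟨⟨u, x⟩, rfl⟩ := (E (i + 1)).symm.surjective z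
          change (E i).symm (((F.d (i + 1)).coprod (g (i + 1))).prod
            (-(G.d i ∘ₗ LinearMap.snd _ _ _)) (E (i + 1) ((E (i + 1)).symm (u, x)))) = 0 ↔ _
          rw [LinearEquiv.apply_symm_apply, EmbeddingLike.map_eq_zero_iff, Prod.ext_iff]
          constructor
          · rintro ⟨h, h'⟩
            have h1 : x ∈ G.cycles (i + 1) := by
              change G.d i x = 0
              simpa using h'
            obtain ⟨u', v', h2, h3⟩ := hstep (i + 1) u x h h1
            refine ⟨(E (i + 2)).symm (u', v'), ?_⟩
            change (E (i + 1)).symm (((F.d (i + 2)).coprod (g (i + 2))).prod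
              (-(G.d (i + 1) ∘ₗ LinearMap.snd _ _ _)) (E (i + 2) ((E (i + 2)).symm (u', v')))) = _
            rw [LinearEquiv.apply_symm_apply]
            exact congrArg _ (Prod.ext h2 h3)
          · rintro ⟨z, hz⟩
            obtain ⟨⟨u', v'⟩, rfl⟩ := (E (i + 2)).symm.surjective z
            change (E (i + 1)).symm (((F.d (i + 2)).coprod (g (i + 2))).prod
              (-(G.d (i + 1) ∘ₗ LinearMap.snd _ _ _)) (E (i + 2) ((E (i + 2)).symm (u', v')))) = _
              at hz
            rw [LinearEquiv.apply_symm_apply, EmbeddingLike.apply_eq_iff_eq, Prod.ext_iff] at hz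
            obtain ⟨rfl, rfl⟩ := hz
            simp [F.d_d, G.d_d, hgc] }
  refine ⟨H, ?_, ?_, ?_⟩
  · obtain ⟨e₀, h1, h2, h3⟩ := hF
    refine ⟨e₀, h1, h2, ?_⟩
    change π (F.aug (Finsupp.single e₀ 1)) = _
    rw [h3, hπ]
  · intro hFm hGm ha0
    rw [isMin_iff] at hFm hGm ⊢
    have hg : ∀ i e x, constantCoeff (g i (Finsupp.single e 1) x) = 0 := fun i e x => by
      simp [g, ha0]
    rintro (_ | i) (e | e) x
    · change constantCoeff (((F.d 0).coprod (g 0)) (E 0 (Finsupp.single (Sum.inl e) 1)) x) = 0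
      rw [sumEquiv_single_inl, LinearMap.coprod_apply, map_zero, add_zero]
      exact hFm 0 e x
    · change constantCoeff (((F.d 0).coprod (g 0)) (E 0 (Finsupp.single (Sum.inr e) 1)) x) = 0
      rw [sumEquiv_single_inr, LinearMap.coprod_apply, map_zero, zero_add]
      exact hg 0 e x
    · change constantCoeff ((E i).symm (((F.d (i + 1)).coprod (g (i + 1))).prod
        (-(G.d i ∘ₗ LinearMap.snd _ _ _)) (E (i + 1) (Finsupp.single (Sum.inl e) 1))) x) = 0
      rw [sumEquiv_single_inl]
      obtain x | x := x
      · simpa [E] using hFm (i + 1) e x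
      · simp [E]
    · change constantCoeff ((E i).symm (((F.d (i + 1)).coprod (g (i + 1))).prod
        (-(G.d i ∘ₗ LinearMap.snd _ _ _)) (E (i + 1) (Finsupp.single (Sum.inr e) 1))) x) = 0
      rw [sumEquiv_single_inr]
      obtain x | x := x
      · simpa [E] using hg (i + 1) e x
      · simpa [E] using hGm i e x
  · intro A _ χ
    refine ⟨rfl, fun i => ?_⟩
    exact Fintype.sum_sum_type _

end GradedRes

/-! ### Lifting a bigraded resolution to a filtered deformation -/

section Deformation

variable {k : Type*} [Field k] {σ : Type*} {w : σ → ℕ × ℕ} {ι κ : Type*}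
  {deg : ι → ℕ × ℕ} {deg' : κ → ℕ × ℕ}

/-- `x` has the same second degree as `m` and larger first degree. -/
def Higher (m x : ℕ × ℕ) : Prop := x.2 = m.2 ∧ m.1 < x.1

/-- `Z'` is a deformation of the bigraded submodule `Z`: it is graded by the second degree, and
`Z` consists of the forms of lowest first degree of the elements of `Z'`. -/
structure IsDeform (w : σ → ℕ × ℕ) (deg : ι → ℕ × ℕ)
    (Z Z' : Submodule (MvPolynomial σ k) (ι →₀ MvPolynomial σ k)) : Prop where
  initial_mem : ∀ v₁ v₂ m, v₁ + v₂ ∈ Z' → VecIn w deg (fun x => x = m) v₁ →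
    VecIn w deg (Higher m) v₂ → v₁ ∈ Z
  exists_lift : ∀ v m, v ∈ Z → VecIn w deg (fun x => x = m) v →
    ∃ v' ∈ Z', VecIn w deg (Higher m) (v' - v)
  graded : ∀ v₁ v₂ T, v₁ + v₂ ∈ Z' → VecIn w deg (fun x => x.2 = T) v₁ →
    VecIn w deg (fun x => ¬ x.2 = T) v₂ → v₁ ∈ Z'

theorem PolyIn.and {M : Type*} [AddCommMonoid M] {w : σ → M} {P Q : M → Prop}
    {p : MvPolynomial σ k} (hP : PolyIn w P p) (hQ : PolyIn w Q p) :
    PolyIn w (fun m => P m ∧ Q m) p := fun μ h => ⟨hP μ h, hQ μ h⟩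

theorem VecIn.and {M : Type*} [AddCommMonoid M] {w : σ → M} {deg : ι → M} {P Q : M → Prop}
    {v : ι →₀ MvPolynomial σ k} (hP : VecIn w deg P v) (hQ : VecIn w deg Q v) :
    VecIn w deg (fun m => P m ∧ Q m) v := fun a => (hP a).and (hQ a)

theorem exists_snd_lt (w : σ → ℕ × ℕ) (deg : ι → ℕ × ℕ) (v : ι →₀ MvPolynomial σ k) :
    ∃ B, VecIn w deg (fun x => x.2 < B) v := by
  classical
  refine ⟨(v.support.sup fun a => (v a).support.sup fun μ => (Finsupp.weight w μ + deg a).2) + 1,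
    fun a μ hμ => Nat.lt_succ_of_le ?_⟩
  have ha : a ∈ v.support := by
    rw [Finsupp.mem_support_iff]
    rintro h
    rw [h, coeff_zero] at hμ
    exact hμ rfl
  exact (Finset.le_sup (f := fun μ => (Finsupp.weight w μ + deg a).2)
    (mem_support_iff.2 hμ)).trans (Finset.le_sup
    (f := fun a => (v a).support.sup fun μ => (Finsupp.weight w μ + deg a).2) ha)

theorem weight_fst_le {C : ℕ} (hw : ∀ i, (w i).1 ≤ C * (w i).2) (μ : σ →₀ ℕ) :
    (Finsupp.weight w μ).1 ≤ C * (Finsupp.weight w μ).2 := by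
  rw [Finsupp.weight_apply, Finsupp.sum, Prod.fst_sum, Prod.snd_sum, Finset.mul_sum]
  refine Finset.sum_le_sum fun i _ => ?_
  simp only [Prod.smul_fst, Prod.smul_snd, smul_eq_mul]
  rw [mul_left_comm]
  exact Nat.mul_le_mul_left _ (hw i)

/-- A monomial of second degree at most T has first degree at most C·T, and there are finitely many
basis vectors. So the filtration by first degree is finite in each second degree, which makes
successive approximation terminate. -/
theorem exists_fst_bound [Finite ι] {C : ℕ} (hw : ∀ i, (w i).1 ≤ C * (w i).2)
    (deg : ι → ℕ × ℕ) (T : ℕ) : ∃ B, ∀ v : ι →₀ MvPolynomial σ k,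
      VecIn w deg (fun x => x.2 = T ∧ B ≤ x.1) v → v = 0 := by
  cases nonempty_fintype ι
  refine ⟨C * T + (Finset.univ.sup fun a => (deg a).1) + 1, fun v hv => ?_⟩
  ext a μ
  by_contra h
  obtain ⟨h1, h2⟩ := hv a μ h
  have h3 := weight_fst_le hw μ
  have h4 : (deg a).1 ≤ Finset.univ.sup fun a => (deg a).1 :=
    Finset.le_sup (f := fun a => (deg a).1) (Finset.mem_univ a)
  simp only [Prod.snd_add, Prod.fst_add] at h1 h2
  have h5 : C * (Finsupp.weight w μ).2 ≤ C * T := Nat.mul_le_mul_left _ (by omega)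
  omega

variable [Finite ι] {C : ℕ} (hw : ∀ i, (w i).1 ≤ C * (w i).2)
include hw

/-- The inductive step of lifting a resolution. Send each basis vector to an element of `Z'` whose
lowest form is its image under `d`. Every element of `Z'` has its lowest form in `Z`, the range of
`d`, so it is reached by successive approximation, without lowering the order of the preimage. This
strictness is what makes the kernel of `d'` a deformation of the kernel of `d`. -/
theorem IsDeform.exists_map {Z Z' : Submodule (MvPolynomial σ k) (ι →₀ MvPolynomial σ k)}
    (h : IsDeform w deg Z Z')
    (d : (κ →₀ MvPolynomial σ k) →ₗ[MvPolynomial σ k] (ι →₀ MvPolynomial σ k))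
    (hd : ∀ e, VecIn w deg (fun m => m = deg' e) (d (Finsupp.single e 1)))
    (hZ : LinearMap.range d = Z) :
    ∃ d' : (κ →₀ MvPolynomial σ k) →ₗ[MvPolynomial σ k] (ι →₀ MvPolynomial σ k),
      (∀ e, VecIn w deg (Higher (deg' e)) (d' (Finsupp.single e 1) - d (Finsupp.single e 1))) ∧
      LinearMap.range d' = Z' ∧ IsDeform w deg' (LinearMap.ker d) (LinearMap.ker d') := by
  have h1 : ∀ e, ∃ v ∈ Z', VecIn w deg (Higher (deg' e)) (v - d (Finsupp.single e 1)) :=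
    fun e => h.exists_lift _ _ (hZ ▸ LinearMap.mem_range_self d _) (hd e)
  choose v hv hv' using h1
  let d' := Finsupp.linearCombination (MvPolynomial σ k) v
  have hd' : ∀ e, d' (Finsupp.single e 1) = v e := fun e => by simp [d']
  have hmem : ∀ u, d' u ∈ Z' := fun u =>
    Submodule.sum_mem _ fun e _ => Z'.smul_mem _ (hv e)
  let δ := d' - d
  have hsum : ∀ u, d' u = d u + δ u := fun u => by simp [δ]
  have hR : ∀ a b c, Higher a b → Higher (c + a) (c + b) := by
    rintro a b c ⟨h1, h2⟩
    exact ⟨by simp [h1], by simpa using h2⟩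
  have hδ : ∀ {Q : ℕ × ℕ → Prop} {u : κ →₀ MvPolynomial σ k}, VecIn w deg' Q u →
      VecIn w deg (fun m => ∃ a, Q a ∧ Higher a m) (δ u) := fun {Q u} hu =>
    VecIn.map (R := Higher) hR δ (fun e => by simpa [δ, hd'] using hv' e) hu
  have hd2 : ∀ {Q : ℕ × ℕ → Prop} {u : κ →₀ MvPolynomial σ k}, VecIn w deg' Q u →
      VecIn w deg Q (d u) := fun hu => VecIn.map_eq d hd hu
  -- strict surjectivity
  have strict : ∀ T p u, u ∈ Z' → VecIn w deg (fun x => x.2 = T ∧ p ≤ x.1) u →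
      ∃ y, VecIn w deg' (fun x => x.2 = T ∧ p ≤ x.1) y ∧ d' y = u := by
    intro T p
    obtain ⟨B, hB⟩ := exists_fst_bound (k := k) hw deg T
    -- Descending induction on the order `p`: nothing nonzero of second degree `T` has first degree
    -- `B` or more.
    induction hn : B - p generalizing p with
    | zero =>
      intro u _ hu
      refine ⟨0, vecIn_zero, ?_⟩
      rw [map_zero, hB u (hu.mono fun m hm => ⟨hm.1, by omega⟩)]
    | succ n ih =>
      intro u huZ hu
      obtain ⟨u₁, u₂, rfl, h1, h2⟩ := exists_split w deg (fun x => x = (p, T)) u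
      have h3 : VecIn w deg (fun x => x.2 = T ∧ p + 1 ≤ x.1) u₂ := by
        have h4 : VecIn w deg (fun x => x.2 = T ∧ p ≤ x.1) u₂ := by
          have := hu.sub (h1.mono (Q' := fun x => x.2 = T ∧ p ≤ x.1) (by
            rintro _ rfl; exact ⟨rfl, le_rfl⟩))
          rwa [add_sub_cancel_left] at this
        refine (h2.and h4).mono ?_
        rintro ⟨a, b⟩ ⟨h5, rfl, h6⟩
        refine ⟨rfl, lt_of_le_of_ne h6 ?_⟩
        rintro rfl
        exact h5 rfl
      have hu₁ := h.initial_mem u₁ u₂ (p, T) huZ h1 (h3.mono fun m hm => ⟨hm.1, hm.2⟩)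
      rw [← hZ] at hu₁
      obtain ⟨y₁, hy₁, rfl⟩ := exists_preimage_vecIn d hd h1 hu₁
      -- `y₁` removes the form of first degree `p`; the error `δ y₁` only has larger first degree.
      obtain ⟨y₂, hy₂, he⟩ := ih (p + 1) (by omega) (u₂ - δ y₁) (by
        have := Z'.sub_mem huZ (hmem y₁)
        rwa [hsum, add_sub_add_left_eq_sub] at this) (h3.sub ((hδ hy₁).mono (by
          rintro x ⟨_, rfl, h5, h6⟩; exact ⟨h5, h6⟩)))
      refine ⟨y₁ + y₂, (hy₁.mono ?_).add (hy₂.mono ?_), ?_⟩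
      · rintro _ rfl; exact ⟨rfl, le_rfl⟩
      · rintro m ⟨h5, h6⟩; exact ⟨h5, by omega⟩
      · rw [map_add, he, hsum]; abel
  refine ⟨d', fun e => by simpa [hd'] using hv' e, le_antisymm ?_ ?_, ?_, ?_, ?_⟩
  · rintro _ ⟨u, rfl⟩
    exact hmem u
  · intro u hu
    -- Strict surjectivity treats one second degree at a time, so the components of `u` are split
    -- off from the top.
    obtain ⟨B, hB⟩ := exists_snd_lt w deg u
    induction B generalizing u with
    | zero =>
      have : u = 0 := hB.eq_zero (hB.mono fun m hm => absurd hm (Nat.not_lt_zero _))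
      rw [this]
      exact Submodule.zero_mem _
    | succ B ih =>
      obtain ⟨u₁, u₂, rfl, h1, h2⟩ := exists_split w deg (fun x => x.2 = B) u
      have hu₁ := h.graded u₁ u₂ B hu h1 h2
      have hu₂ : u₂ ∈ Z' := by simpa using Z'.sub_mem hu hu₁
      have h3 : VecIn w deg (fun x => x.2 < B) u₂ := by
        have h4 := hB.sub (h1.mono (Q' := fun x => x.2 < B + 1) fun m hm => by omega)
        rw [add_sub_cancel_left] at h4
        exact (h2.and h4).mono fun m hm => by omega
      obtain ⟨y, -, hy⟩ := strict B 0 u₁ hu₁ (h1.mono fun m hm => ⟨hm, Nat.zero_le _⟩)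
      exact Submodule.add_mem _ ⟨y, hy⟩ (ih hu₂ h3)
  · intro v₁ v₂ m hv₁₂ h1 h2
    have h3 : VecIn w deg (Higher m) (δ v₁ + (d v₂ + δ v₂)) := by
      refine ((hδ h1).mono ?_).add ((hd2 h2).add ((hδ h2).mono ?_))
      · rintro x ⟨_, rfl, hx⟩; exact hx
      · rintro x ⟨y, hy, hx⟩; exact ⟨hx.1.trans hy.1, hy.2.trans hx.2⟩
    have h4 : d v₁ = -(δ v₁ + (d v₂ + δ v₂)) := by
      have h5 : d' (v₁ + v₂) = 0 := hv₁₂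
      rw [map_add, hsum, hsum, add_assoc] at h5
      exact eq_neg_of_add_eq_zero_left h5
    refine (hd2 h1).eq_zero ?_
    rw [h4]
    refine h3.neg.mono ?_
    rintro x ⟨-, hx⟩ rfl
    exact lt_irrefl _ hx
  -- For `u` in the kernel of `d`, the vector `d' u` has order above `m`. A preimage `y` of order
  -- above `m` corrects `u` to `u - y` in the kernel of `d'`.
  · intro u m hu hum
    have h1 : VecIn w deg (Higher m) (d' u) := by
      rw [hsum, show d u = 0 from hu, zero_add]
      refine (hδ hum).mono ?_
      rintro x ⟨_, rfl, hx⟩; exact hx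
    obtain ⟨y, hy, he⟩ := strict m.2 (m.1 + 1) (d' u) (hmem u) (h1.mono fun x hx => ⟨hx.1, hx.2⟩)
    refine ⟨u - y, ?_, ?_⟩
    · rw [LinearMap.mem_ker, map_sub, he, sub_self]
    · rw [sub_sub_cancel_left]
      exact (hy.mono fun x hx => ⟨hx.1, hx.2⟩).neg
  · intro v₁ v₂ T hv₁₂ h1 h2
    have hd3 : ∀ {Q : ℕ → Prop} {u : κ →₀ MvPolynomial σ k}, VecIn w deg' (fun x => Q x.2) u →
        VecIn w deg (fun x => Q x.2) (d' u) := fun hu => by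
      rw [hsum]
      refine (hd2 hu).add ((hδ hu).mono ?_)
      rintro x ⟨y, hy, hx, -⟩
      rwa [hx]
    have h3 := hd3 (Q := fun x => x = T) h1
    refine VecIn.add_left_cancel (Q := fun x : ℕ × ℕ => x.2 = T) (v := d' v₂) (v' := 0) ?_ h3 vecIn_zero
      (hd3 (Q := fun x => ¬ x = T) h2) vecIn_zero
    rw [← map_add, add_zero]
    exact hv₁₂

omit hw in
/-- The resolution of a bigraded ideal lifts to a resolution of a deformation of the ideal. -/
theorem GradedRes.exists_deform (hw : ∀ i, (w i).1 ≤ C * (w i).2)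
    {I I' : Ideal (MvPolynomial σ k)} (G : GradedRes w I) (hG : G.IsStd)
    (h1 : ∀ p q m, p + q ∈ I' → PolyIn w (fun x => x = m) p → PolyIn w (Higher m) q → p ∈ I)
    (h2 : ∀ p m, p ∈ I → PolyIn w (fun x => x = m) p → ∃ p' ∈ I', PolyIn w (Higher m) (p' - p))
    (h3 : ∀ p q T, p + q ∈ I' → PolyIn w (fun x => x.2 = T) p →
      PolyIn w (fun x => ¬ x.2 = T) q → p ∈ I') :
    ∃ H : GradedRes (fun _ : σ => ()) I', H.IsStd ∧
      (∀ i, Fintype.card (H.ι i) = Fintype.card (G.ι i)) ∧ (H.IsMin → G.IsMin) := by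
  obtain ⟨e₀, he₀, hdeg, haug⟩ := hG
  have hv0 : ∀ v : G.X 0, v = Finsupp.single e₀ (v e₀) := fun v => by
    ext a : 1
    rw [he₀ a, Finsupp.single_eq_same]
  have haug' : ∀ v, G.aug v = Ideal.Quotient.mk I (v e₀) := fun v => by
    have e : v = v e₀ • Finsupp.single e₀ (1 : MvPolynomial σ k) := by
      rw [Finsupp.smul_single, smul_eq_mul, mul_one]
      exact hv0 v
    conv_lhs => rw [e, map_smul, haug, ← Ideal.Quotient.mk_eq_mk, ← Submodule.Quotient.mk_smul,
      smul_eq_mul, mul_one]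
    rfl
  let aug' : G.X 0 →ₗ[MvPolynomial σ k] MvPolynomial σ k ⧸ I' :=
    (Ideal.Quotient.mkₐ (MvPolynomial σ k) I').toLinearMap ∘ₗ Finsupp.lapply e₀
  have haug'' : ∀ v, aug' v = Ideal.Quotient.mk I' (v e₀) := fun v => rfl
  have hcyc : ∀ v, v ∈ G.cycles 0 ↔ v e₀ ∈ I := fun v => by
    change G.aug v = 0 ↔ _
    rw [haug', Ideal.Quotient.eq_zero_iff_mem]
  have hker : ∀ v, v ∈ LinearMap.ker aug' ↔ v e₀ ∈ I' := fun v => by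
    rw [LinearMap.mem_ker, haug'', Ideal.Quotient.eq_zero_iff_mem]
  have hpv : ∀ {Q : ℕ × ℕ → Prop} {v : G.X 0}, VecIn w (G.deg 0) Q v → PolyIn w Q (v e₀) :=
    fun {Q v} hv => by simpa [hdeg] using hv e₀
  have hvp : ∀ {Q : ℕ × ℕ → Prop} {p : MvPolynomial σ k}, PolyIn w Q p →
      VecIn w (G.deg 0) Q (Finsupp.single e₀ p) := fun hp => vecIn_single (by simpa [hdeg] using hp)
  have hdef0 : IsDeform w (G.deg 0) (G.cycles 0) (LinearMap.ker aug') := by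
    refine ⟨fun v₁ v₂ m h h1' h2' => ?_, fun v m h h' => ?_, fun v₁ v₂ T h h1' h2' => ?_⟩
    · exact (hcyc _).2 (h1 _ _ m ((hker _).1 h) (hpv h1') (hpv h2'))
    · obtain ⟨p', hp', hd⟩ := h2 _ m ((hcyc v).1 h) (hpv h')
      refine ⟨Finsupp.single e₀ p', (hker _).2 (by rwa [Finsupp.single_eq_same]), ?_⟩
      rw [hv0 v, ← Finsupp.single_sub]
      exact hvp hd
    · exact (hker _).2 (h3 _ _ T ((hker _).1 h) (hpv h1') (hpv h2'))
  let T : ℕ → Type _ := fun i =>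
    {Z : Submodule (MvPolynomial σ k) (G.X i) // IsDeform w (G.deg i) (G.cycles i) Z}
  have hstep : ∀ i (Z : T i), ∃ d' : G.X (i + 1) →ₗ[MvPolynomial σ k] G.X i,
      (∀ e, VecIn w (G.deg i) (Higher (G.deg (i + 1) e))
        (d' (Finsupp.single e 1) - G.d i (Finsupp.single e 1))) ∧
      LinearMap.range d' = Z.1 ∧
      IsDeform w (G.deg (i + 1)) (G.cycles (i + 1)) (LinearMap.ker d') := fun i Z =>
    Z.2.exists_map hw (G.d i) (G.d_hom i) (G.range_d i)
  choose D hD1 hD2 hD3 using hstep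
  let Z : ∀ i, T i := fun i => Nat.rec ⟨_, hdef0⟩ (fun i Z => ⟨LinearMap.ker (D i Z), hD3 i Z⟩) i
  have triv : ∀ {ι : Type} {deg : ι → Unit} {Q : Unit → Prop} (_ : ∀ u, Q u)
      (v : ι →₀ MvPolynomial σ k), VecIn (fun _ : σ => ()) deg Q v := fun hQ v a μ _ => hQ _
  -- The ideal `I'` need not be homogeneous for the first degree; as only ranks and constant terms
  -- matter from here on, the grading is by the trivial monoid.
  let H : GradedRes (fun _ : σ => ()) I' :=
    { ι := G.ι
      fin := G.fin
      deg := fun _ _ => ()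
      d := fun i => D i (Z i)
      aug := aug'
      d_hom := fun i e => triv (fun _ => rfl) _
      aug_hom := fun e => ⟨_, fun _ _ => rfl, haug'' _⟩
      aug_surjective := by
        intro x
        obtain ⟨p, rfl⟩ := Ideal.Quotient.mk_surjective x
        exact ⟨Finsupp.single e₀ p, by rw [haug'', Finsupp.single_eq_same]⟩
      exact_zero := LinearMap.exact_iff.2 (hD2 0 (Z 0)).symm
      exact_succ := fun i => LinearMap.exact_iff.2 (hD2 (i + 1) (Z (i + 1))).symm }
  refine ⟨H, ⟨e₀, he₀, rfl, ?_⟩, fun i => rfl, fun hH => ?_⟩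
  · rw [show H.aug = aug' from rfl, haug'', Finsupp.single_eq_same]
  · rw [GradedRes.isMin_iff] at hH ⊢
    intro i e a
    by_contra hne
    -- A nonzero constant entry of `G.d` joins basis vectors of equal degree, while the deformation
    -- adds only terms of strictly larger first degree and cannot cancel it.
    have e1 := G.d_hom i e a 0 hne
    rw [map_zero, zero_add] at e1
    have e2 : constantCoeff ((D i (Z i) (Finsupp.single e 1) - G.d i (Finsupp.single e 1)) a) ≠ 0 := by
      rw [Finsupp.sub_apply, map_sub, show constantCoeff (D i (Z i) (Finsupp.single e 1) a) = 0
        from hH i e a, zero_sub]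
      exact neg_ne_zero.2 hne
    have e3 := hD1 i (Z i) e a 0 e2
    rw [map_zero, zero_add, ← e1] at e3
    exact lt_irrefl _ e3.2

end Deformation

/-! ### Homogeneous ideals and Hilbert series -/

section Hilbert

variable {k : Type*} [Field k] {σ : Type*}

theorem polyPart_mul {M : Type*} [AddCommMonoid M] {w : σ → M} {Q : M → Prop} {m : M}
    (p : MvPolynomial σ k) {g : MvPolynomial σ k} (hg : PolyIn w (fun x => x = m) g) :
    polyPart w Q (p * g) = polyPart w (fun x => Q (x + m)) p * g := by
  have h1 := polyIn_polyPart (w := w) (Q := fun x => Q (x + m)) p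
  have h2 := polyIn_sub_polyPart (w := w) (Q := fun x => Q (x + m)) p
  have h3 : p * g = polyPart w (fun x => Q (x + m)) p * g +
      (p - polyPart w (fun x => Q (x + m)) p) * g := by ring
  have e1 := polyPart_eq_self (w := w) (Q := Q)
    (p := polyPart w (fun x => Q (x + m)) p * g) ((h1.mul hg).mono (by
      rintro _ ⟨a, b, ha, rfl, rfl⟩; exact ha))
  have e2 := polyPart_eq_zero (w := w) (Q := Q)
    (p := (p - polyPart w (fun x => Q (x + m)) p) * g) ((h2.mul hg).mono (by
      rintro _ ⟨a, b, ha, rfl, rfl⟩; exact ha))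
  rw [h3, polyPart_add, e1, e2, add_zero]

/-- An ideal is graded with respect to `w`. -/
def IsGradedIdeal {M : Type*} [AddCommMonoid M] (w : σ → M) (I : Ideal (MvPolynomial σ k)) : Prop :=
  ∀ (Q : M → Prop), ∀ p ∈ I, polyPart w Q p ∈ I

theorem polyPart_zero {M : Type*} [AddCommMonoid M] {w : σ → M} {Q : M → Prop} :
    polyPart w Q (0 : MvPolynomial σ k) = 0 := polyPart_eq_zero polyIn_zero

theorem isGradedIdeal_span {M : Type*} [AddCommMonoid M] {w : σ → M}
    {G : Set (MvPolynomial σ k)} (hG : ∀ g ∈ G, ∃ m, PolyIn w (fun x => x = m) g) :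
    IsGradedIdeal w (Ideal.span G) := by
  intro Q p hp
  induction hp using Submodule.closure_induction with
  | zero => rw [polyPart_zero]; exact Ideal.zero_mem _
  | add x y _ _ hx hy => rw [polyPart_add]; exact Ideal.add_mem _ hx hy
  | smul_mem a x hx =>
    obtain ⟨m, hm⟩ := hG x hx
    rw [smul_eq_mul, polyPart_mul a hm]
    exact Ideal.mul_mem_left _ _ (Ideal.subset_span hx)

theorem IsGradedIdeal.sup {M : Type*} [AddCommMonoid M] {w : σ → M}
    {I J : Ideal (MvPolynomial σ k)} (hI : IsGradedIdeal w I) (hJ : IsGradedIdeal w J) :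
    IsGradedIdeal w (I ⊔ J) := by
  intro Q p hp
  obtain ⟨a, ha, b, hb, rfl⟩ := Submodule.mem_sup.1 hp
  rw [polyPart_add]
  exact Submodule.add_mem_sup (hI Q a ha) (hJ Q b hb)

theorem isGradedIdeal_span_singleton {M : Type*} [AddCommMonoid M] {w : σ → M} {m : M}
    {g : MvPolynomial σ k} (hg : PolyIn w (fun x => x = m) g) :
    IsGradedIdeal w (Ideal.span {g}) :=
  isGradedIdeal_span (by rintro _ rfl; exact ⟨m, hg⟩)

/-- The colon ideal `(J : f)`. -/
noncomputable def colonIdeal (J : Ideal (MvPolynomial σ k)) (f : MvPolynomial σ k) : Ideal (MvPolynomial σ k) :=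
  Submodule.comap (LinearMap.toSpanSingleton _ _ f) J

theorem mem_colonIdeal {J : Ideal (MvPolynomial σ k)} {f s : MvPolynomial σ k} :
    s ∈ colonIdeal J f ↔ s * f ∈ J := Iff.rfl

/-- Multiplication by `f` shifts degrees by `m`; cancellation in `M` lets a part of `p` be recovered
from the corresponding part of `p * f`. -/
theorem IsGradedIdeal.colonIdeal {M : Type*} [AddCancelCommMonoid M] {w : σ → M} {m : M}
    {J : Ideal (MvPolynomial σ k)} (hJ : IsGradedIdeal w J) {f : MvPolynomial σ k}
    (hf : PolyIn w (fun x => x = m) f) : IsGradedIdeal w (colonIdeal J f) := by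
  intro Q p hp
  rw [mem_colonIdeal] at hp ⊢
  have h := hJ (fun x => ∃ y, y + m = x ∧ Q y) _ hp
  rw [polyPart_mul p hf] at h
  convert h using 3
  ext x
  simp

/-- The standard grading by degree. -/
abbrev stdW (σ : Type*) : σ → ℕ := fun _ => 1

/-- The part of degree `d` of an ideal. -/
def idealPart (I : Ideal (MvPolynomial σ k)) (d : ℕ) : Submodule k (MvPolynomial σ k) where
  carrier := {p | p ∈ I ∧ PolyIn (stdW σ) (fun x => x = d) p}
  zero_mem' := ⟨I.zero_mem, polyIn_zero⟩
  add_mem' h h' := ⟨I.add_mem h.1 h'.1, h.2.add h'.2⟩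
  smul_mem' c p h := by
    refine ⟨?_, fun μ hμ => h.2 μ ?_⟩
    · rw [smul_eq_C_mul]
      exact I.mul_mem_left _ h.1
    · rw [coeff_smul, smul_eq_mul] at hμ
      exact right_ne_zero_of_mul hμ

theorem mem_idealPart {I : Ideal (MvPolynomial σ k)} {d : ℕ} {p : MvPolynomial σ k} :
    p ∈ idealPart I d ↔ p ∈ I ∧ PolyIn (stdW σ) (fun x => x = d) p := Iff.rfl

theorem idealPart_mono {I J : Ideal (MvPolynomial σ k)} (h : I ≤ J) (d : ℕ) :
    idealPart I d ≤ idealPart J d := fun _ hp => ⟨h hp.1, hp.2⟩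

instance [Finite σ] (I : Ideal (MvPolynomial σ k)) (d : ℕ) :
    FiniteDimensional k (idealPart I d) := by
  have h : idealPart I d ≤ weightedHomogeneousSubmodule k (stdW σ) d := fun p hp =>
    polyIn_iff_isWeightedHomogeneous.1 hp.2
  have h2 : FiniteDimensional k (weightedHomogeneousSubmodule k (stdW σ) d) :=
    Module.Finite.iff_fg.2 (weightedHomogeneousSubmodule_fg k _ (fun _ => one_ne_zero) d)
  exact Submodule.finiteDimensional_of_le h

/-- The Hilbert series of `R/I`. -/
noncomputable def hilbSeries (I : Ideal (MvPolynomial σ k)) : PowerSeries ℤ :=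
  PowerSeries.mk fun d => (Module.finrank k (idealPart (⊤ : Ideal (MvPolynomial σ k)) d) : ℤ) -
    Module.finrank k (idealPart I d)

theorem coeff_hilbSeries_le [Finite σ] {I J : Ideal (MvPolynomial σ k)} (h : I ≤ J) (d : ℕ) :
    PowerSeries.coeff d (hilbSeries J) ≤ PowerSeries.coeff d (hilbSeries I) := by
  rw [hilbSeries, hilbSeries, PowerSeries.coeff_mk, PowerSeries.coeff_mk]
  have := Submodule.finrank_mono (idealPart_mono h d)
  omega

/-- Equal dimensions make the homogeneous pieces of the two ideals equal, and a graded `J` is the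
sum of its pieces. -/
theorem eq_of_hilbSeries_eq [Finite σ] {I J : Ideal (MvPolynomial σ k)} (h : I ≤ J)
    (hJ : IsGradedIdeal (stdW σ) J) (he : hilbSeries I = hilbSeries J) : I = J := by
  refine le_antisymm h fun p hp => ?_
  have hpart : ∀ d, idealPart I d = idealPart J d := fun d => by
    refine Submodule.eq_of_le_of_finrank_eq (idealPart_mono h d) ?_
    have := congrArg (PowerSeries.coeff d) he
    rw [hilbSeries, hilbSeries, PowerSeries.coeff_mk, PowerSeries.coeff_mk] at this
    omega
  have key : ∀ B, ∀ p ∈ J, PolyIn (stdW σ) (fun x => x < B) p → p ∈ I := by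
    intro B
    induction B with
    | zero =>
      intro p _ hB
      rw [hB.eq_zero (hB.mono fun m hm => absurd hm (Nat.not_lt_zero _))]
      exact I.zero_mem
    | succ B ih =>
      intro p hp hB
      have h1 : polyPart (stdW σ) (fun x => x = B) p ∈ idealPart I B := by
        rw [hpart]
        exact ⟨hJ _ p hp, polyIn_polyPart p⟩
      have h2 : p - polyPart (stdW σ) (fun x => x = B) p ∈ I := by
        refine ih _ (J.sub_mem hp (hJ _ p hp)) ?_
        have h3 := hB.sub ((polyIn_polyPart (w := stdW σ) (Q := fun x => x = B) p).mono
          (Q' := fun x => x < B + 1) fun m hm => by omega)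
        intro μ hμ
        have h4 := h3 μ hμ
        have h5 := polyIn_sub_polyPart p μ hμ
        omega
      simpa using I.add_mem h2 h1.1
  refine key ((p.support.sup fun μ => Finsupp.weight (stdW σ) μ) + 1) p hp fun μ hμ => ?_
  exact Nat.lt_succ_of_le (Finset.le_sup (f := fun μ => Finsupp.weight (stdW σ) μ)
    (mem_support_iff.2 hμ))

/-- The Hilbert series of `R/(J + (f))`. -/
theorem hilbSeries_sup_span [Finite σ] {J : Ideal (MvPolynomial σ k)}
    (hJ : IsGradedIdeal (stdW σ) J) {f : MvPolynomial σ k} {e : ℕ}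
    (hf : PolyIn (stdW σ) (fun x => x = e) f) :
    hilbSeries (J ⊔ Ideal.span {f}) =
      hilbSeries J - PowerSeries.X ^ e * hilbSeries (colonIdeal J f) := by
  have hmem : ∀ d, ∀ p ∈ idealPart (J ⊔ Ideal.span {f}) d, ∃ j ∈ idealPart J d, ∃ s,
      PolyIn (stdW σ) (fun x => x + e = d) s ∧ p = j + s * f := by
    rintro d p ⟨hp, hd⟩
    obtain ⟨j, hj, y, hy, rfl⟩ := Submodule.mem_sup.1 hp
    obtain ⟨s, rfl⟩ := Ideal.mem_span_singleton'.1 hy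
    refine ⟨polyPart (stdW σ) (fun x => x = d) j, ⟨hJ _ j hj, polyIn_polyPart j⟩,
      polyPart (stdW σ) (fun x => x + e = d) s, polyIn_polyPart s, ?_⟩
    rw [← polyPart_mul (Q := fun x => x = d) s hf, ← polyPart_add, polyPart_eq_self hd]
  ext d
  rw [map_sub, PowerSeries.coeff_X_pow_mul']
  simp only [hilbSeries, PowerSeries.coeff_mk]
  split_ifs with hed
  · obtain ⟨d, rfl⟩ := Nat.exists_eq_add_of_le' hed
    rw [Nat.add_sub_cancel]
    have hsf : ∀ s ∈ idealPart (⊤ : Ideal (MvPolynomial σ k)) d,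
        PolyIn (stdW σ) (fun x => x = d + e) (s * f) := fun s hs => by
      refine (hs.2.mul hf).mono ?_
      rintro _ ⟨a, b, rfl, rfl, rfl⟩
      rfl
    -- The exact sequence 0 → (J : f)_d → R_d ⊕ J_{d+e} → (J + (f))_{d+e} → 0, with first map s ↦
    -- (s, -sf), gives the dimension count.
    let ψ : (idealPart (⊤ : Ideal (MvPolynomial σ k)) d × idealPart J (d + e)) →ₗ[k]
        idealPart (J ⊔ Ideal.span {f}) (d + e) :=
      { toFun := fun x => ⟨x.1.1 * f + x.2.1, Ideal.add_mem _
          (Ideal.mul_mem_left _ _ (le_sup_right (a := J) (Ideal.mem_span_singleton_self f)))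
          (le_sup_left (b := Ideal.span {f}) x.2.2.1), (hsf _ x.1.2).add x.2.2.2⟩
        map_add' := fun x y => Subtype.ext (by simp; ring)
        map_smul' := fun c x => Subtype.ext (by simp) }
    have hψ : Function.Surjective ψ := by
      rintro ⟨p, hp⟩
      obtain ⟨j, hj, s, hs, rfl⟩ := hmem _ p hp
      exact ⟨⟨⟨s, trivial, hs.mono fun m hm => by omega⟩, ⟨j, hj⟩⟩, Subtype.ext (add_comm _ _)⟩
    let ε : idealPart (colonIdeal J f) d ≃ₗ[k] LinearMap.ker ψ :=
      { toFun := fun s => ⟨⟨⟨s.1, trivial, s.2.2⟩, ⟨-(s.1 * f), J.neg_mem s.2.1,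
          (hsf s.1 ⟨trivial, s.2.2⟩).neg⟩⟩, by
            rw [LinearMap.mem_ker]
            exact Subtype.ext (by simp [ψ])⟩
        map_add' := fun x y => Subtype.ext (Prod.ext (Subtype.ext (by simp))
          (Subtype.ext (by simp; ring)))
        map_smul' := fun c x => Subtype.ext (Prod.ext (Subtype.ext (by simp))
          (Subtype.ext (by simp)))
        invFun := fun x => ⟨x.1.1.1, by
          rw [mem_idealPart, mem_colonIdeal]
          refine ⟨?_, x.1.1.2.2⟩
          have h : x.1.1.1 * f + x.1.2.1 = 0 := congrArg Subtype.val x.2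
          rw [eq_neg_of_add_eq_zero_left h]
          exact J.neg_mem x.1.2.2.1⟩
        left_inv := fun s => rfl
        right_inv := fun x => by
          have h : x.1.1.1 * f + x.1.2.1 = 0 := congrArg Subtype.val x.2
          exact Subtype.ext (Prod.ext rfl (Subtype.ext (neg_eq_of_add_eq_zero_right h))) }
    have h1 := LinearMap.finrank_range_add_finrank_ker ψ
    rw [LinearMap.range_eq_top.2 hψ, finrank_top, ← ε.finrank_eq, Module.finrank_prod] at h1
    omega
  · rw [sub_zero]
    suffices h : idealPart (J ⊔ Ideal.span {f}) d = idealPart J d by rw [h]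
    refine le_antisymm (fun p hp => ?_) (idealPart_mono le_sup_left d)
    obtain ⟨j, hj, s, hs, rfl⟩ := hmem d p hp
    have h0 : s = 0 := hs.eq_zero (hs.mono fun m hm => by omega)
    rwa [h0, zero_mul, add_zero]

end Hilbert

/-! ### Jet ideals and path ideals -/

section Ideals

variable {A : Type*} [CommRing A] (x : ℕ → A)

/-- The coefficient of `t^j` in `(x_r + x_{r+1} t + ⋯)^2`. -/
def jc (r j : ℕ) : A := ∑ p ∈ Finset.HasAntidiagonal.antidiagonal j, x (r + p.1) * x (r + p.2)

/-- The ideal generated by the first `m` coefficients of `(x_r + x_{r+1} t + ⋯)^2`. -/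
def jI (r m : ℕ) : Ideal A := Ideal.span (jc x r '' Set.Iio m)

/-- The edge ideal of the path with `m` edges on the vertices `x_r, x_{r+1}, …`. -/
def pathI (r m : ℕ) : Ideal A := Ideal.span ((fun i => x (r + i) * x (r + i + 1)) '' Set.Iio m)

theorem Iio_succ_eq_insert (m : ℕ) : Set.Iio (m + 1) = insert m (Set.Iio m) := by
  ext a
  simp only [Set.mem_Iio, Set.mem_insert_iff]
  omega

theorem jI_zero (r : ℕ) : jI x r 0 = ⊥ := by simp [jI]

theorem pathI_zero (r : ℕ) : pathI x r 0 = ⊥ := by simp [pathI]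

theorem jI_succ (r m : ℕ) : jI x r (m + 1) = jI x r m ⊔ Ideal.span {jc x r m} := by
  rw [jI, Iio_succ_eq_insert, Set.image_insert_eq, Ideal.span_insert,
    sup_comm, jI]

theorem pathI_succ (r m : ℕ) :
    pathI x r (m + 1) = pathI x r m ⊔ Ideal.span {x (r + m) * x (r + m + 1)} := by
  rw [pathI, Iio_succ_eq_insert, Set.image_insert_eq, Ideal.span_insert,
    sup_comm, pathI]

theorem jc_mem {r m j : ℕ} (h : j < m) : jc x r j ∈ jI x r m :=
  Ideal.subset_span ⟨j, h, rfl⟩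

theorem path_mem {r m j : ℕ} (h : j < m) : x (r + j) * x (r + j + 1) ∈ pathI x r m :=
  Ideal.subset_span ⟨j, h, rfl⟩

theorem jI_mono {r m m' : ℕ} (h : m ≤ m') : jI x r m ≤ jI x r m' :=
  Ideal.span_mono (Set.image_mono (Set.Iio_subset_Iio h))

theorem pathI_mono {r m m' : ℕ} (h : m ≤ m') : pathI x r m ≤ pathI x r m' :=
  Ideal.span_mono (Set.image_mono (Set.Iio_subset_Iio h))

theorem jc_zero (r : ℕ) : jc x r 0 = x r * x r := by simp [jc]

theorem jc_one (r : ℕ) : jc x r 1 = 2 * (x r * x (r + 1)) := by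
  simp [jc, Finset.Nat.sum_antidiagonal_succ]
  ring

theorem jc_add_two (r j : ℕ) :
    jc x r (j + 2) = 2 * (x r * x (r + j + 2)) + jc x (r + 1) j := by
  rw [jc, Finset.Nat.sum_antidiagonal_succ, Finset.Nat.sum_antidiagonal_succ', jc]
  have e : ∀ p : ℕ × ℕ, x (r + (p.1 + 1)) * x (r + (p.2 + 1)) =
      x (r + 1 + p.1) * x (r + 1 + p.2) := fun p => by
    rw [show r + (p.1 + 1) = r + 1 + p.1 by ring, show r + (p.2 + 1) = r + 1 + p.2 by ring]
  simp only [e]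
  rw [show r + (j + 1 + 1) = r + j + 2 by ring, show r + 0 = r from rfl]
  ring

/-- The relation `m x_r c_m ∈ (c_0, …, c_{m-1})`, from `x (x^2)' = 2 x' x^2`. -/
theorem natCast_mul_jc_mem (r m : ℕ) : (m : A) * (x r * jc x r m) ∈ jI x r m := by
  obtain _ | m := m
  · simp
  let f : PowerSeries A := PowerSeries.mk fun a => x (r + a)
  have hf : ∀ a, PowerSeries.coeff a f = x (r + a) := fun a => PowerSeries.coeff_mk _ _
  have hf2 : ∀ j, PowerSeries.coeff j (f * f) = jc x r j := fun j => by
    rw [PowerSeries.coeff_mul, jc]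
    simp only [hf]
  have hd : f * PowerSeries.derivative A (f * f) = 2 * (PowerSeries.derivative A f * (f * f)) := by
    rw [Derivation.leibniz, smul_eq_mul]
    ring
  have h := congrArg (PowerSeries.coeff m) hd
  rw [two_mul, map_add, PowerSeries.coeff_mul] at h
  have h1 : PowerSeries.coeff m (PowerSeries.derivative A f * (f * f)) ∈ jI x r (m + 1) := by
    rw [PowerSeries.coeff_mul]
    refine Ideal.sum_mem _ fun p hp => Ideal.mul_mem_left _ _ ?_
    rw [hf2]
    have := Finset.HasAntidiagonal.mem_antidiagonal.1 hp
    exact jc_mem x (by omega)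
  have h2 : ∑ p ∈ (Finset.HasAntidiagonal.antidiagonal m).erase (0, m), PowerSeries.coeff p.1 f *
      PowerSeries.coeff p.2 (PowerSeries.derivative A (f * f)) ∈ jI x r (m + 1) := by
    refine Ideal.sum_mem _ fun p hp => Ideal.mul_mem_left _ _ ?_
    rw [PowerSeries.coeff_derivative, hf2]
    obtain ⟨hp1, hp2⟩ := Finset.mem_erase.1 hp
    have := Finset.HasAntidiagonal.mem_antidiagonal.1 hp2
    refine Ideal.mul_mem_right _ _ (jc_mem x ?_)
    by_contra hlt
    exact hp1 (Prod.ext (by simp; omega) (by simp; omega))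
  -- With the index shifted by one, the term (0, m) of x·(x^2)' is x_r (m+1) c_{m+1}; every other
  -- term contains some c_j with j ≤ m.
  rw [← Finset.add_sum_erase _ _ (show ((0, m) : ℕ × ℕ) ∈ Finset.HasAntidiagonal.antidiagonal m by simp)] at h
  have h3 := sub_mem (add_mem h1 h1) h2
  rw [← h, add_sub_cancel_right] at h3
  simp only [PowerSeries.coeff_derivative, hf, hf2, add_zero] at h3
  convert h3 using 1
  push_cast
  ring

/-- Modulo x_r the coefficients c_0 and c_1 vanish and c_{j+2} becomes the j-th coefficient of the
square of the shifted series. Truncated subtraction covers m < 2. -/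
theorem jI_sup_span (r m : ℕ) :
    jI x r m ⊔ Ideal.span {x r} = jI x (r + 1) (m - 2) ⊔ Ideal.span {x r} := by
  have hx : x r ∈ Ideal.span {x r} := Ideal.mem_span_singleton_self _
  apply le_antisymm
  · refine sup_le (Ideal.span_le.2 ?_) le_sup_right
    rintro _ ⟨j, hj, rfl⟩
    obtain _ | _ | j := j
    · rw [jc_zero]
      exact le_sup_right (a := jI x (r + 1) (m - 2)) (Ideal.mul_mem_left _ _ hx)
    · rw [zero_add, jc_one]
      exact le_sup_right (a := jI x (r + 1) (m - 2))
        (Ideal.mul_mem_left _ _ (Ideal.mul_mem_right _ _ hx))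
    · rw [jc_add_two]
      refine add_mem (le_sup_right (a := jI x (r + 1) (m - 2))
        (Ideal.mul_mem_left _ _ (Ideal.mul_mem_right _ _ hx)))
        (le_sup_left (a := jI x (r + 1) (m - 2)) (jc_mem x ?_))
      have : j + 2 < m := hj
      omega
  · refine sup_le (Ideal.span_le.2 ?_) le_sup_right
    rintro _ ⟨j, hj, rfl⟩
    have hj' : j < m - 2 := hj
    rw [show jc x (r + 1) j = jc x r (j + 2) - 2 * (x r * x (r + j + 2)) by rw [jc_add_two]; ring]
    exact sub_mem (le_sup_left (a := jI x r m) (jc_mem x (by omega)))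
      (le_sup_right (a := jI x r m) (Ideal.mul_mem_left _ _ (Ideal.mul_mem_right _ _ hx)))

/-- The near endpoint of the next edge alone already carries the colon ideal into the path ideal.
The far endpoint is thus left over as a factor of the comparison map, which makes the cones for
paths minimal. -/
theorem mul_vertex_mem {r m : ℕ} {s : A}
    (hs : s ∈ pathI x r (m - 1) ⊔ Ideal.span {x (r + m)}) :
    s * x (r + m + 1) ∈ pathI x r (m + 1) := by
  obtain ⟨p, hp, y, hy, rfl⟩ := Submodule.mem_sup.1 hs
  obtain ⟨a, rfl⟩ := Ideal.mem_span_singleton'.1 hy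
  rw [add_mul, mul_assoc]
  exact add_mem (Ideal.mul_mem_right _ _ (pathI_mono _ (by omega) hp))
    (Ideal.mul_mem_left _ _ (path_mem _ (by omega)))

variable {k : Type*} [Field k] [CharZero k] [Algebra k A]

theorem mem_of_natCast_mul_mem {I : Ideal A} {m : ℕ} (hm : m ≠ 0) {s : A}
    (h : (m : A) * s ∈ I) (k : Type*) [Field k] [CharZero k] [Algebra k A] : s ∈ I := by
  have e : s = algebraMap k A (m : k)⁻¹ * ((m : A) * s) := by
    rw [← mul_assoc, ← map_natCast (algebraMap k A), ← map_mul,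
      inv_mul_cancel₀ (Nat.cast_ne_zero.2 hm), map_one, one_mul]
  rw [e]
  exact I.mul_mem_left _ h

variable (k) in
include k in
theorem mul_jc_mem (r : ℕ) {m : ℕ} (hm : m ≠ 0) : x r * jc x r m ∈ jI x r m :=
  mem_of_natCast_mul_mem hm (natCast_mul_jc_mem x r m) k

-- This bounds the colon ideal by x_r from below. Modulo x_r^2 and x_r x_{r+1}, the product of x_r
-- with the j-th generator for r + 2 is x_r c_{j+4}. Since j + 4 ≤ m, this is in the ideal trivially
-- or, when j + 4 = m, by the relation from x(x^2)' = 2x'x^2.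
variable (k) in
include k in
theorem mul_mem_jI (r : ℕ) {m : ℕ} (hm : 2 ≤ m) {s : A}
    (hs : s ∈ jI x (r + 2) (m - 3) ⊔ Ideal.span {x r} ⊔ Ideal.span {x (r + 1)}) :
    s * x r ∈ jI x r m := by
  have h0 : x r * x r ∈ jI x r m := jc_zero x r ▸ jc_mem x (by omega)
  have h1 : x r * x (r + 1) ∈ jI x r m :=
    mem_of_natCast_mul_mem two_ne_zero (by
      have := jc_mem x (r := r) (m := m) (j := 1) (by omega)
      rwa [jc_one] at this) k
  suffices h : jI x (r + 2) (m - 3) ⊔ Ideal.span {x r} ⊔ Ideal.span {x (r + 1)} ≤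
      Submodule.comap (LinearMap.toSpanSingleton A A (x r)) (jI x r m) from h hs
  refine sup_le (sup_le (Ideal.span_le.2 ?_) (Ideal.span_le.2 ?_)) (Ideal.span_le.2 ?_)
  · rintro _ ⟨j, hj, rfl⟩
    have hj' : j < m - 3 := hj
    change jc x (r + 2) j * x r ∈ jI x r m
    have h2 : x r * jc x r (j + 4) ∈ jI x r m := by
      rcases lt_or_ge (j + 4) m with h | h
      · exact Ideal.mul_mem_left _ _ (jc_mem x h)
      · have h3 := mul_jc_mem x k r (m := j + 4) (by omega)
        exact jI_mono x (by omega) h3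
    have e : jc x (r + 2) j * x r = x r * jc x r (j + 4) - 2 * x (r + (j + 2) + 2) * (x r * x r) -
        2 * x (r + 1 + j + 2) * (x r * x (r + 1)) := by
      rw [show j + 4 = j + 2 + 2 from rfl, jc_add_two, jc_add_two]
      ring
    rw [e]
    exact sub_mem (sub_mem h2 (Ideal.mul_mem_left _ _ h0)) (Ideal.mul_mem_left _ _ h1)
  · rintro _ rfl
    exact h0
  · rintro _ rfl
    change x (r + 1) * x r ∈ jI x r m
    rwa [mul_comm]

end Ideals

/-! ### Variables that are nonzerodivisors -/

section Variables

variable {k : Type*} [Field k] {σ : Type*}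

open Classical in
/-- The substitution `X_v = 0`. -/
noncomputable def killVar (v : σ) : MvPolynomial σ k →ₐ[k] MvPolynomial σ k :=
  aeval fun i => if i = v then 0 else X i

theorem exists_killVar (v : σ) (p : MvPolynomial σ k) : ∃ q, p = X v * q + killVar v p := by
  induction p using MvPolynomial.induction_on with
  | C a => exact ⟨0, by rw [mul_zero, zero_add, ← algebraMap_eq, AlgHom.commutes]⟩
  | add p q hp hq =>
    obtain ⟨a, ha⟩ := hp
    obtain ⟨b, hb⟩ := hq
    exact ⟨a + b, by rw [map_add]; linear_combination ha + hb⟩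
  | mul_X p i hp =>
    obtain ⟨a, ha⟩ := hp
    by_cases h : i = v
    · refine ⟨p, ?_⟩
      subst h
      simp [killVar, mul_comm]
    · refine ⟨a * X i, ?_⟩
      rw [map_mul, show killVar v (X i : MvPolynomial σ k) = X i by simp [killVar, h]]
      linear_combination X i * ha

/-- If the generators do not involve X_v, then in the splitting z = X_v z' + z|_{X_v = 0} of an
element of the ideal both z' and the second summand stay in the ideal. For z = s X_v the second
summand is 0, so s = z'. -/
theorem mem_span_of_mul_X_mem {G : Set (MvPolynomial σ k)} {v : σ}
    (hG : ∀ g ∈ G, killVar v g = g) {s : MvPolynomial σ k} (hs : s * X v ∈ Ideal.span G) :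
    s ∈ Ideal.span G := by
  have key : ∀ z ∈ Ideal.span G, ∃ z' ∈ Ideal.span G, z = X v * z' + killVar v z ∧
      killVar v z ∈ Ideal.span G := by
    intro z hz
    induction hz using Submodule.closure_induction with
    | zero => exact ⟨0, Ideal.zero_mem _, by simp, by simp⟩
    | add y z _ _ hy hz =>
      obtain ⟨y', hy, ey, hy'⟩ := hy
      obtain ⟨z', hz, ez, hz'⟩ := hz
      refine ⟨y' + z', Ideal.add_mem _ hy hz, ?_, ?_⟩
      · rw [map_add]; linear_combination ey + ez
      · rw [map_add]; exact Ideal.add_mem _ hy' hz'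
    | smul_mem a g hg =>
      obtain ⟨a', ha⟩ := exists_killVar v a
      refine ⟨a' * g, Ideal.mul_mem_left _ _ (Ideal.subset_span hg), ?_, ?_⟩
      · rw [smul_eq_mul, map_mul, hG g hg]; linear_combination g * ha
      · rw [smul_eq_mul, map_mul, hG g hg]
        exact Ideal.mul_mem_left _ _ (Ideal.subset_span hg)
  obtain ⟨z', hz', e, -⟩ := key _ hs
  have h0 : killVar v (s * X v) = 0 := by rw [map_mul]; simp [killVar]
  rw [h0, add_zero, mul_comm] at e
  rwa [mul_left_cancel₀ (X_ne_zero v) e]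

/-- The variables `x_0, …, x_{N-1}`, extended by `0`. -/
noncomputable def jv (k : Type*) [Field k] (N a : ℕ) : MvPolynomial (Fin N) k :=
  if h : a < N then X ⟨a, h⟩ else 0

variable {N : ℕ}

theorem jv_of_lt {a : ℕ} (h : a < N) : jv k N a = X ⟨a, h⟩ := dif_pos h

theorem killVar_jv {v : Fin N} {a : ℕ} (h : a ≠ v) : killVar v (jv k N a) = jv k N a := by
  rw [jv]
  split_ifs with ha
  · have : (⟨a, ha⟩ : Fin N) ≠ v := fun e => h (congrArg Fin.val e)
    simp [killVar, this]
  · simp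

theorem killVar_jc {v : Fin N} {r : ℕ} (h : v < r) (j : ℕ) :
    killVar v (jc (jv k N) r j) = jc (jv k N) r j := by
  rw [jc, map_sum]
  refine Finset.sum_congr rfl fun p _ => ?_
  rw [map_mul, killVar_jv (by omega), killVar_jv (by omega)]

theorem mem_jI_of_mul_mem {r m v : ℕ} (hv : v < r) (hN : v < N) {s : MvPolynomial (Fin N) k}
    (h : s * jv k N v ∈ jI (jv k N) r m) : s ∈ jI (jv k N) r m := by
  rw [jv_of_lt hN] at h
  refine mem_span_of_mul_X_mem ?_ h
  rintro _ ⟨j, -, rfl⟩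
  exact killVar_jc (by simpa using hv) j

theorem mem_jI_sup_of_mul_mem {r m u v : ℕ} (hv : v < r) (hN : v < N) (huv : u ≠ v)
    {s : MvPolynomial (Fin N) k}
    (h : s * jv k N v ∈ jI (jv k N) r m ⊔ Ideal.span {jv k N u}) :
    s ∈ jI (jv k N) r m ⊔ Ideal.span {jv k N u} := by
  rw [jv_of_lt hN] at h
  rw [jI, ← Ideal.span_union] at h ⊢
  refine mem_span_of_mul_X_mem ?_ h
  rintro _ (⟨j, -, rfl⟩ | rfl)
  · exact killVar_jc (by simpa using hv) j
  · exact killVar_jv huv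

theorem mem_pathI_of_mul_mem {r m v : ℕ} (hv : r + m < v) (hN : v < N)
    {s : MvPolynomial (Fin N) k}
    (h : s * jv k N v ∈ pathI (jv k N) r m) : s ∈ pathI (jv k N) r m := by
  rw [jv_of_lt hN] at h
  refine mem_span_of_mul_X_mem ?_ h
  rintro _ ⟨j, hj, rfl⟩
  have hj' : j < m := hj
  rw [map_mul, killVar_jv (by simp; omega), killVar_jv (by simp; omega)]

/-- The colon ideal of a path by the next edge. -/
theorem mem_of_mul_edge_mem {r m : ℕ} (hN : r + m + 2 < N) {s : MvPolynomial (Fin N) k} :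
    s * (jv k N (r + m + 1) * jv k N (r + m + 2)) ∈ pathI (jv k N) r (m + 1) →
      s ∈ pathI (jv k N) r (m - 1) ⊔ Ideal.span {jv k N (r + m)} := by
  intro h
  rw [← mul_assoc] at h
  -- The far endpoint is not a vertex of the path with m + 1 edges and can be cancelled.
  have h1 := mem_pathI_of_mul_mem (by omega) hN h
  rw [pathI_succ] at h1
  obtain ⟨p, hp, y, hy, e⟩ := Submodule.mem_sup.1 h1
  obtain ⟨a, rfl⟩ := Ideal.mem_span_singleton'.1 hy
  -- After the multiple of the last edge is moved to the left, the near endpoint is off the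
  -- remaining path and cancels too.
  have h2 : (s - a * jv k N (r + m)) * jv k N (r + m + 1) ∈ pathI (jv k N) r m := by
    convert hp using 1
    linear_combination -e
  have h3 := mem_pathI_of_mul_mem (by omega) (by omega) h2
  have h4 : pathI (jv k N) r m ≤ pathI (jv k N) r (m - 1) ⊔ Ideal.span {jv k N (r + m)} := by
    obtain _ | m := m
    · exact le_sup_left
    · rw [pathI_succ, Nat.add_sub_cancel]
      exact sup_le le_sup_left ((Ideal.span_singleton_le_iff_mem _).2
        (le_sup_right (a := pathI (jv k N) r m)
          (Ideal.mul_mem_left _ _ (Ideal.mem_span_singleton_self _))))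
  have h5 := add_mem (h4 h3) (le_sup_right (a := pathI (jv k N) r (m - 1))
    (Ideal.mul_mem_left _ a (Ideal.mem_span_singleton_self (jv k N (r + m)))))
  rwa [sub_add_cancel] at h5

end Variables

/-! ### Initial forms and dimensions -/

section Initial

variable {k : Type*} [Field k] {σ : Type*} {w : σ → ℕ × ℕ}

/-- Lifting the generators suffices: the component of degree `m` of Σ a_g g is Σ b_g g with b_g the
component of a_g of complementary degree, and it is lifted by Σ b_g g'. -/
theorem exists_higher_lift {G : Set (MvPolynomial σ k)} {I' : Ideal (MvPolynomial σ k)}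
    (hG : ∀ g ∈ G, ∃ c, PolyIn w (fun x => x = c) g ∧ ∃ g' ∈ I', PolyIn w (Higher c) (g' - g))
    {p : MvPolynomial σ k} (hp : p ∈ Ideal.span G) {m : ℕ × ℕ}
    (hm : PolyIn w (fun x => x = m) p) : ∃ p' ∈ I', PolyIn w (Higher m) (p' - p) := by
  suffices h : ∀ p ∈ Ideal.span G, ∃ p' ∈ I',
      PolyIn w (Higher m) (p' - polyPart w (fun x => x = m) p) by
    have := h p hp
    rwa [polyPart_eq_self hm] at this
  intro p hp
  induction hp using Submodule.closure_induction with
  | zero => exact ⟨0, I'.zero_mem, by rw [polyPart_zero, sub_zero]; exact polyIn_zero⟩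
  | add x y _ _ hx hy =>
    obtain ⟨x', hx', hx⟩ := hx
    obtain ⟨y', hy', hy⟩ := hy
    refine ⟨x' + y', I'.add_mem hx' hy', ?_⟩
    rw [polyPart_add, add_sub_add_comm]
    exact hx.add hy
  | smul_mem a g hg =>
    obtain ⟨c, hc, g', hg', hh⟩ := hG g hg
    refine ⟨polyPart w (fun x => x + c = m) a * g', I'.mul_mem_left _ hg', ?_⟩
    rw [smul_eq_mul, polyPart_mul a hc, ← mul_sub]
    refine ((polyIn_polyPart a).mul hh).mono ?_
    rintro _ ⟨x, y, rfl, ⟨h1, h2⟩, rfl⟩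
    exact ⟨by simp [h1], by simpa using h2⟩

theorem polyPartHom_apply (Q : ℕ × ℕ → Prop) (p : MvPolynomial σ k) :
    polyPartHom w Q p = polyPart w Q p := rfl

variable (w) in
/-- The elements of second degree `T` and of first degree at least `a`. -/
def filtPart (I : Ideal (MvPolynomial σ k)) (T a : ℕ) : Submodule k (MvPolynomial σ k) where
  carrier := {p | p ∈ I ∧ PolyIn w (fun x => x.2 = T ∧ a ≤ x.1) p}
  zero_mem' := ⟨I.zero_mem, polyIn_zero⟩
  add_mem' h h' := ⟨I.add_mem h.1 h'.1, h.2.add h'.2⟩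
  smul_mem' c p h := by
    refine ⟨?_, fun μ hμ => h.2 μ ?_⟩
    · rw [smul_eq_C_mul]
      exact I.mul_mem_left _ h.1
    · rw [coeff_smul, smul_eq_mul] at hμ
      exact right_ne_zero_of_mul hμ

theorem mem_filtPart {I : Ideal (MvPolynomial σ k)} {T a : ℕ} {p : MvPolynomial σ k} :
    p ∈ filtPart w I T a ↔ p ∈ I ∧ PolyIn w (fun x => x.2 = T ∧ a ≤ x.1) p := Iff.rfl

variable (w) in
/-- The forms of lowest first degree. -/
noncomputable def grPart (I : Ideal (MvPolynomial σ k)) (T a : ℕ) : Submodule k (MvPolynomial σ k) :=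
  (filtPart w I T a).map (polyPartHom w fun x => x = (a, T))

theorem filtPart_succ_le (I : Ideal (MvPolynomial σ k)) (T a : ℕ) :
    filtPart w I T (a + 1) ≤ filtPart w I T a :=
  fun _ h => ⟨h.1, h.2.mono fun _ hm => ⟨hm.1, by omega⟩⟩

theorem polyPart_eq_zero_iff {I : Ideal (MvPolynomial σ k)} {T a : ℕ} {p : MvPolynomial σ k}
    (hp : p ∈ filtPart w I T a) :
    polyPart w (fun x => x = (a, T)) p = 0 ↔ p ∈ filtPart w I T (a + 1) := by
  constructor
  · intro h
    have h1 := polyIn_sub_polyPart (w := w) (Q := fun x => x = (a, T)) p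
    rw [h, sub_zero] at h1
    refine ⟨hp.1, (h1.and hp.2).mono ?_⟩
    rintro ⟨b, c⟩ ⟨h5, rfl, h6⟩
    refine ⟨rfl, lt_of_le_of_ne h6 ?_⟩
    rintro rfl
    exact h5 rfl
  · intro h
    refine polyPart_eq_zero (h.2.mono ?_)
    rintro _ h rfl
    have := h.2
    simp at this

/-- Rank-nullity for taking the component of first degree `a`; iterated, it writes the dimension of
a graded piece of an ideal as the sum of the dimensions of its spaces of lowest forms. -/
theorem finrank_filtPart (I : Ideal (MvPolynomial σ k)) (T a : ℕ)
    [FiniteDimensional k (filtPart w I T a)] : Module.finrank k (filtPart w I T a) =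
      Module.finrank k (grPart w I T a) + Module.finrank k (filtPart w I T (a + 1)) := by
  have h := LinearMap.finrank_range_add_finrank_ker
    ((polyPartHom w fun x => x = (a, T)).domRestrict (filtPart w I T a))
  rw [← h, LinearMap.range_domRestrict]
  congr 1
  refine LinearEquiv.finrank_eq (LinearEquiv.symm ?_)
  refine (Submodule.comapSubtypeEquivOfLe (filtPart_succ_le I T a)).symm.trans
    (LinearEquiv.ofEq _ _ ?_)
  ext p
  exact (polyPart_eq_zero_iff p.2).symm

theorem grPart_le {I : Ideal (MvPolynomial σ k)} (hI : IsGradedIdeal w I) {T a : ℕ}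
    {p : MvPolynomial σ k} (hp : p ∈ grPart w I T a) : p ∈ I := by
  obtain ⟨p, hp, rfl⟩ := hp
  rw [polyPartHom_apply]
  exact hI _ p hp.1

theorem grPart_le_grPart {I I' : Ideal (MvPolynomial σ k)} (hI : IsGradedIdeal w I)
    (h2 : ∀ p m, p ∈ I → PolyIn w (fun x => x = m) p → ∃ p' ∈ I', PolyIn w (Higher m) (p' - p))
    (T a : ℕ) : grPart w I T a ≤ grPart w I' T a := by
  rintro _ ⟨p, hp, rfl⟩
  obtain ⟨p', hp', h⟩ := h2 _ (a, T) (hI (fun x => x = (a, T)) p hp.1) (polyIn_polyPart p)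
  have e : p' = (p' - polyPart w (fun x => x = (a, T)) p) + polyPart w (fun x => x = (a, T)) p := by
    ring
  refine ⟨p', ⟨hp', ?_⟩, ?_⟩
  · rw [e]
    refine (h.mono ?_).add ((polyIn_polyPart p).mono ?_)
    · rintro m ⟨h1, h2⟩; exact ⟨h1, h2.le⟩
    · rintro _ rfl; exact ⟨rfl, le_rfl⟩
  · rw [polyPartHom_apply, polyPartHom_apply, e, polyPart_add, polyPart_eq_zero (h.mono ?_), zero_add,
      polyPart_eq_self (polyIn_polyPart p)]
    rintro _ ⟨-, h⟩ rfl
    exact lt_irrefl _ h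

end Initial

/-! ### Comparing Hilbert series through the filtration by first degree -/

section Bigraded

variable {k : Type*} [Field k] {N : ℕ}

theorem weight_biweight_snd (μ : Fin N →₀ ℕ) :
    (Finsupp.weight (biweight N) μ).2 = Finsupp.weight (stdW (Fin N)) μ := by
  rw [Finsupp.weight_apply, Finsupp.weight_apply, Finsupp.sum, Finsupp.sum, Prod.snd_sum]
  rfl

theorem biweight_fst_le (i : Fin N) : (biweight N i).1 ≤ N * (biweight N i).2 := by
  simp only [biweight, mul_one]
  exact i.2.le

theorem polyIn_stdW_iff {Q : ℕ → Prop} {p : MvPolynomial (Fin N) k} :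
    PolyIn (stdW (Fin N)) Q p ↔ PolyIn (biweight N) (fun x => Q x.2) p := by
  simp only [PolyIn, weight_biweight_snd]

theorem filtPart_zero (I : Ideal (MvPolynomial (Fin N) k)) (T : ℕ) :
    filtPart (biweight N) I T 0 = idealPart I T := by
  ext p
  simp [mem_filtPart, mem_idealPart, polyIn_stdW_iff]

theorem filtPart_le_idealPart (I : Ideal (MvPolynomial (Fin N) k)) (T a : ℕ) :
    filtPart (biweight N) I T a ≤ idealPart I T := fun _ h =>
  ⟨h.1, polyIn_stdW_iff.2 (h.2.mono fun _ hm => hm.1)⟩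

instance (I : Ideal (MvPolynomial (Fin N) k)) (T a : ℕ) :
    FiniteDimensional k (filtPart (biweight N) I T a) :=
  Submodule.finiteDimensional_of_le (filtPart_le_idealPart I T a)

theorem filtPart_eq_bot (I : Ideal (MvPolynomial (Fin N) k)) (T : ℕ) :
    filtPart (biweight N) I T (N * T + 1) = ⊥ := by
  rw [eq_bot_iff]
  intro p hp
  have h : p = 0 := hp.2.eq_zero fun μ hμ h => by
    have h1 := weight_fst_le biweight_fst_le μ
    rw [h.1] at h1
    omega
  rw [h]
  exact Submodule.zero_mem _

variable {I I' : Ideal (MvPolynomial (Fin N) k)} (hI : IsGradedIdeal (biweight N) I)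
  (h2 : ∀ p m, p ∈ I → PolyIn (biweight N) (fun x => x = m) p →
    ∃ p' ∈ I', PolyIn (biweight N) (Higher m) (p' - p))
include hI h2

theorem finrank_grPart_le (T a : ℕ) : Module.finrank k (grPart (biweight N) I T a) ≤
    Module.finrank k (grPart (biweight N) I' T a) := by
  have : FiniteDimensional k (grPart (biweight N) I' T a) := by
    rw [grPart]; infer_instance
  exact Submodule.finrank_mono (grPart_le_grPart hI h2 T a)

theorem finrank_filtPart_le (T a : ℕ) : Module.finrank k (filtPart (biweight N) I T a) ≤
    Module.finrank k (filtPart (biweight N) I' T a) := by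
  have key : ∀ c a, N * T + 1 ≤ a + c → Module.finrank k (filtPart (biweight N) I T a) ≤
      Module.finrank k (filtPart (biweight N) I' T a) := by
    intro c
    induction c with
    | zero =>
      intro a ha
      have : filtPart (biweight N) I T a = ⊥ := by
        rw [eq_bot_iff, ← filtPart_eq_bot I T]
        exact fun p hp => ⟨hp.1, hp.2.mono fun m hm => ⟨hm.1, by omega⟩⟩
      rw [this, finrank_bot]
      exact Nat.zero_le _
    | succ c ih =>
      intro a ha
      rw [finrank_filtPart I, finrank_filtPart I']
      exact add_le_add (finrank_grPart_le hI h2 T a) (ih (a + 1) (by omega))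
  exact key (N * T + 1) a (by omega)

/-- Each bihomogeneous piece of `I` consists of lowest forms of `I'`; summing dimensions over first
degrees shows that `I'` is at least as large as `I` in every second degree. -/
theorem coeff_hilbSeries_le_of_lift (T : ℕ) :
    PowerSeries.coeff T (hilbSeries I') ≤ PowerSeries.coeff T (hilbSeries I) := by
  rw [hilbSeries, hilbSeries, PowerSeries.coeff_mk, PowerSeries.coeff_mk]
  have := finrank_filtPart_le hI h2 T 0
  rw [filtPart_zero, filtPart_zero] at this
  omega

/-- The pieces of `I` are contained in the spaces of lowest forms of `I'`. If the total dimensions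
agree, every one of these inclusions is an equality, so `I` contains all lowest forms of `I'`. -/
theorem initial_mem_of_hilbSeries_eq (he : hilbSeries I = hilbSeries I')
    (p q : MvPolynomial (Fin N) k) (m : ℕ × ℕ) (h : p + q ∈ I')
    (hp : PolyIn (biweight N) (fun x => x = m) p) (hq : PolyIn (biweight N) (Higher m) q) :
    p ∈ I := by
  obtain ⟨a, T⟩ := m
  have h0 : Module.finrank k (filtPart (biweight N) I T 0) =
      Module.finrank k (filtPart (biweight N) I' T 0) := by
    have := congrArg (PowerSeries.coeff T) he
    rw [hilbSeries, hilbSeries, PowerSeries.coeff_mk, PowerSeries.coeff_mk] at this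
    rw [filtPart_zero, filtPart_zero]
    omega
  have hall : ∀ b, Module.finrank k (filtPart (biweight N) I T b) =
      Module.finrank k (filtPart (biweight N) I' T b) := by
    intro b
    induction b with
    | zero => exact h0
    | succ b ih =>
      rw [finrank_filtPart I, finrank_filtPart I'] at ih
      have h1 := finrank_grPart_le hI h2 T b
      have h3 := finrank_filtPart_le hI h2 T (b + 1)
      omega
  have hgr : grPart (biweight N) I T a = grPart (biweight N) I' T a := by
    have : FiniteDimensional k (grPart (biweight N) I' T a) := by
      rw [grPart]; infer_instance
    refine Submodule.eq_of_le_of_finrank_eq (grPart_le_grPart hI h2 T a) ?_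
    have h1 := hall a
    rw [finrank_filtPart I, finrank_filtPart I', hall (a + 1)] at h1
    omega
  refine grPart_le hI (T := T) (a := a) ?_
  rw [hgr]
  refine ⟨p + q, ⟨h, (hp.mono ?_).add (hq.mono ?_)⟩, ?_⟩
  · rintro _ rfl; exact ⟨rfl, le_rfl⟩
  · rintro m ⟨h1, h2⟩; exact ⟨h1, h2.le⟩
  · rw [polyPartHom_apply, polyPart_add, polyPart_eq_self hp, polyPart_eq_zero (hq.mono ?_), add_zero]
    rintro _ ⟨-, h⟩ rfl
    exact lt_irrefl _ h

end Bigraded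

/-! ### Linear substitutions -/

section LinSub

variable {k : Type*} [Field k] {N : ℕ}

/-- The linear substitution given by a matrix. -/
noncomputable def linSub (V : Matrix (Fin N) (Fin N) k) :
    MvPolynomial (Fin N) k →ₐ[k] MvPolynomial (Fin N) k :=
  aeval fun i => ∑ a, C (V i a) * X a

theorem linSub_X (V : Matrix (Fin N) (Fin N) k) (i : Fin N) :
    linSub V (X i) = ∑ a, C (V i a) * X a := aeval_X _ _

theorem linSub_C (V : Matrix (Fin N) (Fin N) k) (c : k) : linSub V (C c) = C c := aeval_C _ _

theorem linSub_comp (V W : Matrix (Fin N) (Fin N) k) :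
    (linSub V).comp (linSub W) = linSub (W * V) := by
  refine MvPolynomial.algHom_ext fun i => ?_
  rw [AlgHom.comp_apply, linSub_X, linSub_X, map_sum]
  simp only [map_mul, linSub_C, linSub_X, Matrix.mul_apply, map_sum, Finset.mul_sum,
    Finset.sum_mul, mul_assoc]
  exact Finset.sum_comm

theorem linSub_one : linSub (1 : Matrix (Fin N) (Fin N) k) = AlgHom.id k _ := by
  refine MvPolynomial.algHom_ext fun i => ?_
  rw [linSub_X]
  simp [Matrix.one_apply]

/-- An invertible linear substitution. -/
noncomputable def linSubEquiv {V W : Matrix (Fin N) (Fin N) k} (h : V * W = 1) (h' : W * V = 1) :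
    MvPolynomial (Fin N) k ≃ₐ[k] MvPolynomial (Fin N) k :=
  AlgEquiv.ofAlgHom (linSub V) (linSub W) (by rw [linSub_comp, h', linSub_one])
    (by rw [linSub_comp, h, linSub_one])

theorem polyIn_linSub (V : Matrix (Fin N) (Fin N) k) {d : ℕ} {p : MvPolynomial (Fin N) k}
    (hp : PolyIn (stdW (Fin N)) (fun x => x = d) p) :
    PolyIn (stdW (Fin N)) (fun x => x = d) (linSub V p) := by
  rw [polyIn_iff_isWeightedHomogeneous] at hp ⊢
  have h : (linSub V p).IsHomogeneous (1 * d) :=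
    IsHomogeneous.aeval (φ := p) hp _ fun i => IsHomogeneous.sum _ _ _ fun a _ =>
      isHomogeneous_C_mul_X _ _
  rw [one_mul] at h
  exact h

theorem mem_map_algEquiv {A : Type*} [CommRing A] [Algebra k A] (e : A ≃ₐ[k] A) {I : Ideal A}
    {s : A} : s ∈ I.map e ↔ e.symm s ∈ I := by
  rw [Ideal.mem_map_iff_of_surjective e e.surjective]
  constructor
  · rintro ⟨x, hx, rfl⟩
    rwa [e.symm_apply_apply]
  · exact fun h => ⟨_, h, e.apply_symm_apply s⟩

theorem hilbSeries_map_linSubEquiv {V W : Matrix (Fin N) (Fin N) k} (h : V * W = 1)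
    (h' : W * V = 1) (I : Ideal (MvPolynomial (Fin N) k)) :
    hilbSeries (I.map (linSubEquiv h h')) = hilbSeries I := by
  ext d
  rw [hilbSeries, hilbSeries, PowerSeries.coeff_mk, PowerSeries.coeff_mk]
  have e : idealPart (I.map (linSubEquiv h h')) d =
      (idealPart I d).map ((linSubEquiv h h').toLinearEquiv : _ →ₗ[k] _) := by
    ext p
    rw [Submodule.mem_map_equiv, mem_idealPart, mem_idealPart, mem_map_algEquiv]
    refine and_congr Iff.rfl ⟨fun hp => polyIn_linSub W hp, fun hp => ?_⟩
    have := polyIn_linSub V hp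
    change PolyIn _ _ (linSubEquiv h h' ((linSubEquiv h h').symm p)) at this
    rwa [AlgEquiv.apply_symm_apply] at this
  rw [e, LinearEquiv.finrank_map_eq]

/-- The identity on the first `r` variables and a Vandermonde block with nodes 0, 1, 2, … on the
others, so that x_{r+i} is replaced by the value at t = i of x_r + x_{r+1} t + ⋯. Characteristic 0
keeps the nodes distinct. -/
theorem exists_vandermonde [CharZero k] {r : ℕ} (hr : r ≤ N) : ∃ V W : Matrix (Fin N) (Fin N) k,
    V * W = 1 ∧ W * V = 1 ∧ ∀ i a : Fin N, r ≤ i →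
      V i a = if (a : ℕ) < r then 0 else (((i : ℕ) - r : ℕ) : k) ^ ((a : ℕ) - r) := by
  obtain ⟨M, rfl⟩ := Nat.exists_eq_add_of_le hr
  let V : Matrix (Fin (r + M)) (Fin (r + M)) k := Matrix.of fun i a =>
    if (i : ℕ) < r then if a = i then 1 else 0
    else if (a : ℕ) < r then 0 else (((i : ℕ) - r : ℕ) : k) ^ ((a : ℕ) - r)
  have hinj : Function.Injective V.mulVec := by
    refine (injective_iff_map_eq_zero V.mulVecLin).2 fun v hv => ?_
    have h1 : ∀ i : Fin r, v (Fin.castAdd M i) = 0 := fun i => by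
      have := congrFun hv (Fin.castAdd M i)
      simpa [V, Matrix.mulVec, dotProduct] using this
    have h2 : (fun a : Fin M => v (Fin.natAdd r a)) = 0 := by
      refine Matrix.eq_zero_of_forall_index_sum_pow_mul_eq_zero
        (f := fun i : Fin M => ((i : ℕ) : k)) (fun i j h => Fin.ext (Nat.cast_injective (R := k) h))
        fun j => ?_
      have := congrFun hv (Fin.natAdd r j)
      simpa [V, Matrix.mulVec, dotProduct, Fin.sum_univ_add] using this
    funext a
    refine Fin.addCases h1 (fun a => congrFun h2 a) a
  have hu : IsUnit V := Matrix.mulVec_injective_iff_isUnit.1 hinj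
  obtain ⟨u, hu⟩ := hu
  refine ⟨V, (u⁻¹ : (Matrix (Fin (r + M)) (Fin (r + M)) k)ˣ), by rw [← hu, Units.mul_inv],
    by rw [← hu, Units.inv_mul], fun i a hi => ?_⟩
  simp only [V, Matrix.of_apply]
  rw [if_neg (by omega)]

end LinSub

/-! ### Finite differences -/

section Differences

variable {k : Type*} [Field k]

/-- The normalized `j`-th difference of `X^a (X+1)^b` at `0`. -/
noncomputable def diffCoeff (k : Type*) [Field k] (j a b : ℕ) : k :=
  (j.factorial : k)⁻¹ * ∑ i ∈ Finset.range (j + 1),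
    ((-1 : k) ^ (j - i) * j.choose i) * ((i : k) ^ a * (i + 1 : k) ^ b)

theorem diffCoeff_eq (j a b : ℕ) : diffCoeff k j a b = (j.factorial : k)⁻¹ *
    (fwdDiff (1 : k))^[j] (Polynomial.X ^ a * (Polynomial.X + 1) ^ b : Polynomial k).eval 0 := by
  rw [diffCoeff, fwdDiff_iter_eq_sum_shift]
  congr 1
  refine Finset.sum_congr rfl fun i _ => ?_
  simp

theorem monic_aux (a b : ℕ) :
    (Polynomial.X ^ a * (Polynomial.X + 1) ^ b : Polynomial k).Monic := by
  have : (Polynomial.X + 1 : Polynomial k).Monic := Polynomial.monic_X_add_C 1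
  exact (Polynomial.monic_X_pow a).mul (this.pow b)

theorem natDegree_aux (a b : ℕ) :
    (Polynomial.X ^ a * (Polynomial.X + 1) ^ b : Polynomial k).natDegree = a + b := by
  have : (Polynomial.X + 1 : Polynomial k).Monic := Polynomial.monic_X_add_C 1
  rw [(Polynomial.monic_X_pow a).natDegree_mul (this.pow b), Polynomial.natDegree_X_pow,
    this.natDegree_pow]
  congr 1
  have := Polynomial.natDegree_X_add_C (1 : k)
  rw [map_one] at this
  rw [this, mul_one]

/-- A j-th difference kills polynomials of degree below j; on monic ones of degree j it is j!,
whence the normalization. -/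
theorem diffCoeff_of_lt {j a b : ℕ} (h : a + b < j) : diffCoeff k j a b = 0 := by
  rw [diffCoeff_eq, Polynomial.fwdDiff_iter_eq_zero_of_degree_lt (by rwa [natDegree_aux])]
  simp

theorem diffCoeff_of_eq [CharZero k] {j a b : ℕ} (h : a + b = j) : diffCoeff k j a b = 1 := by
  have h1 := Polynomial.fwdDiff_iter_degree_eq_factorial
    (Polynomial.X ^ a * (Polynomial.X + 1) ^ b : Polynomial k)
  rw [natDegree_aux, (monic_aux a b).leadingCoeff, h] at h1
  rw [diffCoeff_eq, h1]
  simp [Nat.factorial_ne_zero]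

end Differences

/-! ### Degeneration of path ideals to jet ideals -/

section Degeneration

variable {k : Type*} [Field k] {N : ℕ}

theorem jc_eq_sum {A : Type*} [CommRing A] (x : ℕ → A) (r : ℕ) {j M : ℕ} (hj : j < M) :
    jc x r j = ∑ a ∈ Finset.range M, ∑ b ∈ Finset.range M,
      if a + b = j then x (r + a) * x (r + b) else 0 := by
  rw [← Finset.sum_product', ← Finset.sum_filter, jc]
  refine Finset.sum_congr ?_ fun _ _ => rfl
  ext p
  simp only [Finset.HasAntidiagonal.mem_antidiagonal, Finset.mem_filter, Finset.mem_product, Finset.mem_range]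
  omega

theorem polyIn_jv (a : ℕ) : PolyIn (biweight N) (fun x => x = (a, 1)) (jv k N a) := by
  rw [jv]
  split_ifs with h
  · refine polyIn_monomial ?_
    rw [Finsupp.weight_single, one_smul, biweight]
  · exact polyIn_zero

theorem polyIn_jv_mul (a b : ℕ) :
    PolyIn (biweight N) (fun x => x = (a + b, 2)) (jv k N a * jv k N b) := by
  refine ((polyIn_jv a).mul (polyIn_jv b)).mono ?_
  rintro _ ⟨_, _, rfl, rfl, rfl⟩
  rfl

theorem polyIn_jc (r j : ℕ) :
    PolyIn (biweight N) (fun x => x = (2 * r + j, 2)) (jc (jv k N) r j) := by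
  refine PolyIn.sum fun p hp => (polyIn_jv_mul _ _).mono ?_
  have := Finset.HasAntidiagonal.mem_antidiagonal.1 hp
  rintro _ rfl
  rw [← this]
  congr 1
  ring

theorem isGradedIdeal_jI (r m : ℕ) : IsGradedIdeal (biweight N) (jI (jv k N) r m) := by
  refine isGradedIdeal_span ?_
  rintro _ ⟨j, -, rfl⟩
  exact ⟨_, polyIn_jc r j⟩

theorem polyIn_stdW_of {c : ℕ × ℕ} {p : MvPolynomial (Fin N) k}
    (h : PolyIn (biweight N) (fun x => x = c) p) : PolyIn (stdW (Fin N)) (fun x => x = c.2) p :=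
  polyIn_stdW_iff.2 (h.mono (by rintro _ rfl; rfl))

theorem isGradedIdeal_jI' (r m : ℕ) : IsGradedIdeal (stdW (Fin N)) (jI (jv k N) r m) := by
  refine isGradedIdeal_span ?_
  rintro _ ⟨j, -, rfl⟩
  exact ⟨_, polyIn_stdW_of (polyIn_jc r j)⟩

theorem isGradedIdeal_pathI (r m : ℕ) : IsGradedIdeal (stdW (Fin N)) (pathI (jv k N) r m) := by
  refine isGradedIdeal_span ?_
  rintro _ ⟨j, -, rfl⟩
  exact ⟨_, polyIn_stdW_of (polyIn_jv_mul _ _)⟩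

theorem map_pathI {A B : Type*} [CommRing A] [CommRing B] (f : A →+* B) (x : ℕ → A) (r m : ℕ) :
    (pathI x r m).map f = pathI (fun a => f (x a)) r m := by
  rw [pathI, Ideal.map_span, pathI, ← Set.image_comp]
  congr 1
  ext y
  simp

variable [CharZero k]

/-- A linear change of variables degenerates the path ideal to the jet ideal. -/
theorem exists_degeneration {r m : ℕ} (hN : r + m < N) :
    ∃ (V W : Matrix (Fin N) (Fin N) k) (h : V * W = 1) (h' : W * V = 1),
      ∀ p c, p ∈ jI (jv k N) r m → PolyIn (biweight N) (fun x => x = c) p →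
        ∃ p' ∈ (pathI (jv k N) r m).map (linSubEquiv h h'),
          PolyIn (biweight N) (Higher c) (p' - p) := by
  obtain ⟨V, W, h, h', hV⟩ := exists_vandermonde (k := k) (N := N) (r := r) (by omega)
  refine ⟨V, W, h, h', fun p c hp hc => exists_higher_lift ?_ hp hc⟩
  rintro _ ⟨j, hj, rfl⟩
  have hj' : j < m := hj
  refine ⟨_, polyIn_jc r j, ?_⟩
  obtain ⟨M, rfl⟩ := Nat.exists_eq_add_of_le (show r ≤ N by omega)
  have hy : ∀ i, i < M → linSubEquiv h h' (jv k (r + M) (r + i)) =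
      ∑ a ∈ Finset.range M, C ((i : k) ^ a) * jv k (r + M) (r + a) := by
    intro i hi
    rw [jv_of_lt (show r + i < r + M by omega)]
    change linSub V _ = _
    rw [linSub_X, Fin.sum_univ_add, Finset.sum_range]
    have e1 : ∀ a : Fin r, V ⟨r + i, by omega⟩ (Fin.castAdd M a) = 0 := fun a => by
      rw [hV _ _ (by simp)]
      simp
    have e2 : ∀ a : Fin M, V ⟨r + i, by omega⟩ (Fin.natAdd r a) = (i : k) ^ (a : ℕ) := fun a => by
      rw [hV _ _ (by simp)]
      simp
    simp only [e1, e2, map_zero, zero_mul, Finset.sum_const_zero, zero_add]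
    refine Finset.sum_congr rfl fun a _ => ?_
    rw [jv_of_lt (show r + (a : ℕ) < r + M by omega)]
    rfl
  -- The j-th difference at s = 0 of x(s)x(s+1), divided by j!. It uses the transformed edges 0, …,
  -- j, hence the vertices up to r + j + 1 ≤ r + m, which exist because r + m < N.
  let F : MvPolynomial (Fin (r + M)) k := C (j.factorial : k)⁻¹ * ∑ i ∈ Finset.range (j + 1),
    C ((-1 : k) ^ (j - i) * j.choose i) *
      linSubEquiv h h' (jv k (r + M) (r + i) * jv k (r + M) (r + i + 1))
  have hF : F = ∑ a ∈ Finset.range M, ∑ b ∈ Finset.range M,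
      C (diffCoeff k j a b) * (jv k (r + M) (r + a) * jv k (r + M) (r + b)) := by
    have e : ∀ i ∈ Finset.range (j + 1), C ((-1 : k) ^ (j - i) * j.choose i) *
        linSubEquiv h h' (jv k (r + M) (r + i) * jv k (r + M) (r + i + 1)) =
        ∑ a ∈ Finset.range M, ∑ b ∈ Finset.range M,
          C (((-1 : k) ^ (j - i) * j.choose i) * ((i : k) ^ a * (i + 1 : k) ^ b)) *
            (jv k (r + M) (r + a) * jv k (r + M) (r + b)) := fun i hi => by
      have hi' := Finset.mem_range.1 hi
      rw [map_mul (linSubEquiv h h'), hy i (by omega), add_assoc, hy (i + 1) (by omega), Finset.sum_mul_sum,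
        Finset.mul_sum]
      refine Finset.sum_congr rfl fun a _ => ?_
      rw [Finset.mul_sum]
      refine Finset.sum_congr rfl fun b _ => ?_
      rw [map_mul C (_ * _) (_ * _), map_mul C (_ ^ a), Nat.cast_add, Nat.cast_one]
      ring
    simp only [F]
    rw [Finset.sum_congr rfl e, Finset.sum_comm, Finset.mul_sum]
    refine Finset.sum_congr rfl fun a _ => ?_
    rw [Finset.sum_comm, Finset.mul_sum]
    refine Finset.sum_congr rfl fun b _ => ?_
    rw [diffCoeff, map_mul, map_sum, ← Finset.sum_mul, mul_assoc]
  refine ⟨F, Ideal.mul_mem_left _ _ (Ideal.sum_mem _ fun i hi => Ideal.mul_mem_left _ _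
    (Ideal.mem_map_of_mem _ (path_mem _ ?_))), ?_⟩
  · have := Finset.mem_range.1 hi
    omega
  · rw [hF, jc_eq_sum (jv k (r + M)) r (show j < M by omega), ← Finset.sum_sub_distrib]
    refine PolyIn.sum fun a _ => ?_
    rw [← Finset.sum_sub_distrib]
    refine PolyIn.sum fun b _ => ?_
    -- Pairs with a + b < j contribute nothing, those with a + b = j add up to c_j, and those with a
    -- + b > j have larger first degree.
    rcases lt_trichotomy (a + b) j with hab | hab | hab
    · rw [diffCoeff_of_lt hab, if_neg hab.ne, map_zero, zero_mul, sub_zero]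
      exact polyIn_zero
    · rw [diffCoeff_of_eq hab, if_pos hab, map_one, one_mul, sub_self]
      exact polyIn_zero
    · rw [if_neg hab.ne', sub_zero]
      refine ((polyIn_monomial (w := biweight (r + M)) (Q := fun x => x = 0) (μ := 0)
        (map_zero _)).mul (polyIn_jv_mul _ _)).mono ?_
      rintro _ ⟨_, _, rfl, rfl, rfl⟩
      refine ⟨rfl, ?_⟩
      simp only [zero_add]
      omega

end Degeneration

/-! ### The Hilbert series of path ideals and jet ideals -/

/-- The Hilbert series of path ideals, by deletion of the last edge. -/
noncomputable def pathSeries (h0 : PowerSeries ℤ) : ℕ → PowerSeries ℤ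
  | 0 => h0
  | 1 => (1 - PowerSeries.X ^ 2) * h0
  | m + 2 => pathSeries h0 (m + 1) -
      PowerSeries.X ^ 2 * ((1 - PowerSeries.X) * pathSeries h0 (m - 1))

theorem pathSeries_add_two (h0 : PowerSeries ℤ) (m : ℕ) : pathSeries h0 (m + 2) =
    pathSeries h0 (m + 1) - PowerSeries.X ^ 2 * ((1 - PowerSeries.X) * pathSeries h0 (m - 1)) := by
  rw [pathSeries]

/-- The recursion for deletion of the first vertex. -/
theorem pathSeries_eq (h0 : PowerSeries ℤ) (m : ℕ) : pathSeries h0 (m + 2) =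
    (1 - PowerSeries.X) * pathSeries h0 m +
      PowerSeries.X * ((1 - PowerSeries.X) * ((1 - PowerSeries.X) * pathSeries h0 (m - 1))) := by
  have e1 : pathSeries h0 1 = (1 - PowerSeries.X ^ 2) * h0 := by rw [pathSeries]
  have e0 : pathSeries h0 0 = h0 := by rw [pathSeries]
  have e2 := pathSeries_add_two h0 0
  have e3 := pathSeries_add_two h0 1
  have e4 := pathSeries_add_two h0 2
  norm_num at e2 e3 e4
  induction m using Nat.strong_induction_on with
  | _ m ih =>
    -- Truncation of m - 1 at 0 forces three base cases; beyond them the last-edge recursion carries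
    -- the identity along.
    obtain _ | _ | _ | m := m
    · norm_num
      rw [e2, e1, e0]
      ring
    · norm_num
      rw [e3, e2, e1, e0]
      ring
    · norm_num
      rw [e4, e3, e2, e1, e0]
      ring
    · have h1 := ih (m + 2) (by omega)
      have h2 := ih m (by omega)
      have h3 := pathSeries_add_two h0 (m + 1 + 2)
      have h4 := pathSeries_add_two h0 (m + 1)
      have h5 := pathSeries_add_two h0 m
      have i1 : m + 1 + 2 - 1 = m + 2 := by omega
      have i2 : m + 2 - 1 = m + 1 := by omega
      rw [i1] at h3
      rw [i2] at h1
      rw [Nat.add_sub_cancel] at h4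
      simp only [show m + 1 + 1 + 1 = m + 1 + 2 from rfl, i1]
      rw [show m + 1 + 2 + 1 = m + 2 + 2 from rfl] at h3
      rw [show m + 1 + 1 = m + 2 from rfl] at h4
      linear_combination h3 + h1 - (1 - PowerSeries.X) * h4 -
        PowerSeries.X ^ 2 * (1 - PowerSeries.X) * h2 - PowerSeries.X * (1 - PowerSeries.X) ^ 2 * h5

section Series

variable {k : Type*} [Field k] {N : ℕ}

theorem hilbSeries_sup_of_mul_mem {J : Ideal (MvPolynomial (Fin N) k)}
    (hJ : IsGradedIdeal (stdW (Fin N)) J) {f : MvPolynomial (Fin N) k} {e : ℕ}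
    (hf : PolyIn (stdW (Fin N)) (fun x => x = e) f) (h : ∀ s, s * f ∈ J → s ∈ J) :
    hilbSeries (J ⊔ Ideal.span {f}) = (1 - PowerSeries.X ^ e) * hilbSeries J := by
  rw [hilbSeries_sup_span hJ hf, show colonIdeal J f = J from
    le_antisymm (fun s hs => h s hs) fun s hs => J.mul_mem_right _ hs]
  ring

theorem polyIn_jv' (a : ℕ) : PolyIn (stdW (Fin N)) (fun x => x = 1) (jv k N a) :=
  polyIn_stdW_of (polyIn_jv a)

theorem hilbSeries_sup_jv {J : Ideal (MvPolynomial (Fin N) k)}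
    (hJ : IsGradedIdeal (stdW (Fin N)) J) {v : ℕ} (h : ∀ s, s * jv k N v ∈ J → s ∈ J) :
    hilbSeries (J ⊔ Ideal.span {jv k N v}) = (1 - PowerSeries.X) * hilbSeries J := by
  rw [hilbSeries_sup_of_mul_mem hJ (polyIn_jv' v) h, pow_one]

theorem jv_ne_zero {a : ℕ} (h : a < N) : jv k N a ≠ 0 := by
  rw [jv_of_lt h]
  exact X_ne_zero _

theorem hilbSeries_bot_sup {a b : ℕ} (ha : a < N) (hb : b < N) :
    hilbSeries ((⊥ : Ideal (MvPolynomial (Fin N) k)) ⊔ Ideal.span {jv k N a * jv k N b}) =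
      (1 - PowerSeries.X ^ 2) * hilbSeries (⊥ : Ideal (MvPolynomial (Fin N) k)) := by
  refine hilbSeries_sup_of_mul_mem ?_ (polyIn_stdW_of (polyIn_jv_mul a b)) fun s hs => ?_
  · intro Q p hp
    rw [Ideal.mem_bot] at hp ⊢
    rw [hp, polyPart_zero]
  · rw [Ideal.mem_bot] at hs ⊢
    exact (mul_eq_zero.1 hs).resolve_right (mul_ne_zero (jv_ne_zero ha) (jv_ne_zero hb))

theorem mem_pathI_pred_of_mul_mem {r m : ℕ} (hN : r + m < N) {s : MvPolynomial (Fin N) k}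
    (h : s * jv k N (r + m) ∈ pathI (jv k N) r (m - 1)) : s ∈ pathI (jv k N) r (m - 1) := by
  obtain _ | m := m
  · rw [Nat.zero_sub, pathI_zero, Ideal.mem_bot] at h ⊢
    exact (mul_eq_zero.1 h).resolve_right (jv_ne_zero hN)
  · exact mem_pathI_of_mul_mem (by omega) hN h

/-- The last edge contributes the colon ideal formed by a path shortened by two edges and one vertex
off that path, which is a nonzerodivisor on the quotient by the shorter path. -/
theorem hilbSeries_pathI {r m : ℕ} (hN : r + m < N) : hilbSeries (pathI (jv k N) r m) =
    pathSeries (hilbSeries (⊥ : Ideal (MvPolynomial (Fin N) k))) m := by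
  induction m using Nat.strong_induction_on with
  | _ m ih =>
    obtain _ | _ | m := m
    · rw [pathI_zero, pathSeries]
    · rw [pathI_succ, pathI_zero, hilbSeries_bot_sup (by omega) (by omega), pathSeries]
    · rw [pathI_succ, hilbSeries_sup_span (isGradedIdeal_pathI r (m + 1))
        (polyIn_stdW_of (polyIn_jv_mul _ _)), pathSeries_add_two,
        ih (m + 1) (by omega) (by omega), ← ih (m - 1) (by omega) (by omega),
        ← hilbSeries_sup_jv (isGradedIdeal_pathI r (m - 1))
          fun s hs => mem_pathI_pred_of_mul_mem (m := m) (by omega) hs]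
      congr 3
      refine le_antisymm (fun s hs => mem_of_mul_edge_mem (by omega) hs) fun s hs => ?_
      rw [mem_colonIdeal, ← mul_assoc]
      exact Ideal.mul_mem_right _ _ (mul_vertex_mem _ hs)

theorem hilbSeries_jI_sup {r m : ℕ} (hN : r < N) :
    hilbSeries (jI (jv k N) (r + 1) m ⊔ Ideal.span {jv k N r}) =
      (1 - PowerSeries.X) * hilbSeries (jI (jv k N) (r + 1) m) :=
  hilbSeries_sup_jv (isGradedIdeal_jI' _ _) fun _ hs => mem_jI_of_mul_mem (by omega) hN hs

variable [CharZero k]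

/-- Two inequalities: from above by dividing out x_r and bounding the colon ideal by x_r from below,
from the other side by degeneration from the path ideal. -/
theorem hilbSeries_jI {r m : ℕ} (hN : r + m < N) : hilbSeries (jI (jv k N) r m) =
    pathSeries (hilbSeries (⊥ : Ideal (MvPolynomial (Fin N) k))) m := by
  induction m using Nat.strong_induction_on generalizing r with
  | _ m ih =>
    obtain _ | _ | m := m
    · rw [jI_zero, pathSeries]
    · rw [jI_succ, jI_zero, jc_zero, hilbSeries_bot_sup (by omega) (by omega), pathSeries]
    · ext T
      apply le_antisymm
      -- Adding x_r gives a shorter jet ideal in the later variables together with x_r, and (I :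
      -- x_r) contains an ideal of known series. The resulting bound is the first-vertex recursion
      -- of the path series.
      · have h1 := hilbSeries_sup_span (isGradedIdeal_jI' (k := k) (N := N) r (m + 2))
          (polyIn_jv' r)
        rw [jI_sup_span, Nat.add_sub_cancel, hilbSeries_jI_sup (by omega),
          ih m (by omega) (by omega), pow_one, eq_sub_iff_add_eq] at h1
        have h2 : hilbSeries (jI (jv k N) (r + 2) (m - 1) ⊔ Ideal.span {jv k N r} ⊔
            Ideal.span {jv k N (r + 1)}) = (1 - PowerSeries.X) * ((1 - PowerSeries.X) *
              pathSeries (hilbSeries (⊥ : Ideal (MvPolynomial (Fin N) k))) (m - 1)) := by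
          rw [hilbSeries_sup_jv, hilbSeries_sup_jv, ih (m - 1) (by omega) (by omega)]
          · exact isGradedIdeal_jI' _ _
          · exact fun s hs => mem_jI_of_mul_mem (by omega) (by omega) hs
          · exact (isGradedIdeal_jI' _ _).sup (isGradedIdeal_span_singleton (polyIn_jv' r))
          · exact fun s hs => mem_jI_sup_of_mul_mem (by omega) (by omega) (by omega) hs
        rw [← h1, pathSeries_eq, map_add, map_add, ← h2]
        gcongr
        obtain _ | T := T
        · simp
        · rw [PowerSeries.coeff_succ_X_mul, PowerSeries.coeff_succ_X_mul]
          refine coeff_hilbSeries_le (fun s hs => ?_) T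
          exact mul_mem_jI (jv k N) k r (by omega) (by simpa using hs)
      -- The transformed path ideal has the path series and degenerates to an ideal containing the
      -- jet ideal.
      · obtain ⟨V, W, h, h', hd⟩ := exists_degeneration (k := k) hN
        rw [← hilbSeries_pathI hN, ← hilbSeries_map_linSubEquiv h h']
        exact coeff_hilbSeries_le_of_lift (isGradedIdeal_jI r (m + 2)) hd T

/-- The colon ideal of a jet ideal by the next generator. -/
theorem colonIdeal_jI {r m : ℕ} (hN : r + m + 2 < N) :
    colonIdeal (jI (jv k N) r (m + 1)) (jc (jv k N) r (m + 1)) =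
      jI (jv k N) (r + 1) (m - 1) ⊔ Ideal.span {jv k N r} := by
  symm
  refine eq_of_hilbSeries_eq ?_ ((isGradedIdeal_jI' r (m + 1)).colonIdeal
    (polyIn_stdW_of (polyIn_jc r (m + 1)))) ?_
  · rw [show m - 1 = m + 1 - 2 by omega, ← jI_sup_span]
    refine sup_le (fun s hs => Ideal.mul_mem_right _ _ hs) ?_
    rw [Ideal.span_singleton_le_iff_mem, mem_colonIdeal]
    exact mul_jc_mem (jv k N) k r (by omega)
  -- All other series being known, the exact sequence for adding the next generator determines that
  -- of the colon ideal: X^2 times it is the difference of two consecutive path series.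
  · have h1 := hilbSeries_sup_span (isGradedIdeal_jI' (k := k) (N := N) r (m + 1))
      (polyIn_stdW_of (polyIn_jc r (m + 1)))
    rw [← jI_succ, hilbSeries_jI (by omega), hilbSeries_jI (by omega), pathSeries_add_two] at h1
    rw [hilbSeries_jI_sup (by omega), hilbSeries_jI (by omega)]
    exact mul_left_cancel₀ (pow_ne_zero 2 PowerSeries.X_ne_zero) (sub_right_inj.1 h1)

end Series

/-! ### Resolutions of jet ideals and of path ideals -/

section Betti

variable {A : Type*} [CommRing A]

/-- The generating sequence of the ranks of a mapping cone. -/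
def coneSeq (f g : ℕ → A) (c : A) : ℕ → A
  | 0 => f 0
  | i + 1 => f (i + 1) + c * g i

/-- The sequence of ranks of the trivial resolution. -/
def unitSeq (A : Type*) [CommRing A] : ℕ → A
  | 0 => 1
  | _ + 1 => 0

/-- The bigraded ranks of the iterated mapping cones. -/
def bettiSeq (q : A) : ℕ → A → ℕ → A
  | 0, _ => unitSeq A
  | 1, t => coneSeq (unitSeq A) (unitSeq A) (t ^ 2)
  | m + 2, t => coneSeq (bettiSeq q (m + 1) t)
      (coneSeq (bettiSeq q (m - 1) (q * t)) (bettiSeq q (m - 1) (q * t)) t) (q ^ (m + 1) * t ^ 2)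

end Betti

namespace GradedRes

variable {k : Type*} [Field k] {σ M : Type*} [AddCommMonoid M] {w : σ → M}
  {J J' : Ideal (MvPolynomial σ k)} {A : Type*} [CommRing A] (χ : Multiplicative M →* A)

theorem exists_cone_hilb (F : GradedRes w J) (G : GradedRes w J') (hF : F.IsStd)
    {a b : MvPolynomial σ k} {ca cb : M} (ha : PolyIn w (fun m => m = ca) a)
    (hb : PolyIn w (fun m => m = cb) b) (hJ : ∀ s ∈ J', s * b ∈ J)
    (hJ' : ∀ s, s * (a * b) ∈ J → s ∈ J') :
    ∃ H : GradedRes w (J ⊔ Ideal.span {a * b}), H.IsStd ∧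
      (F.IsMin → G.IsMin → constantCoeff a = 0 → H.IsMin) ∧
      H.hilb (fun m => χ (.ofAdd m)) = coneSeq (F.hilb fun m => χ (.ofAdd m))
        (G.hilb fun m => χ (.ofAdd m)) (χ (.ofAdd (ca + cb))) := by
  obtain ⟨H, h1, h2, h3⟩ := exists_cone F G hF ha hb hJ hJ'
  obtain ⟨h4, h5⟩ := h3 fun m => χ (.ofAdd m)
  refine ⟨H, h1, h2, funext fun i => ?_⟩
  obtain _ | i := i
  · exact h4
  · rw [h5, coneSeq]
    congr 1
    rw [hilb, Finset.mul_sum]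
    exact Finset.sum_congr rfl fun e _ => by rw [← map_mul, ← ofAdd_add]

theorem exists_koszul (F : GradedRes w J) (hF : F.IsStd) {a : MvPolynomial σ k} {ca : M}
    (ha : PolyIn w (fun m => m = ca) a) (hJ : ∀ s, s * a ∈ J → s ∈ J) :
    ∃ H : GradedRes w (J ⊔ Ideal.span {a}), H.IsStd ∧
      (F.IsMin → constantCoeff a = 0 → H.IsMin) ∧
      H.hilb (fun m => χ (.ofAdd m)) = coneSeq (F.hilb fun m => χ (.ofAdd m))
        (F.hilb fun m => χ (.ofAdd m)) (χ (.ofAdd ca)) := by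
  have h1 : PolyIn w (fun m => m = 0) (1 : MvPolynomial σ k) :=
    polyIn_monomial (map_zero _)
  obtain ⟨H, h2, h3, h4⟩ := exists_cone_hilb χ F F hF ha h1 (fun s hs => by rwa [mul_one])
    (fun s hs => hJ s (by rwa [mul_one] at hs))
  rw [add_zero] at h4
  have e : J ⊔ Ideal.span {a * 1} = J ⊔ Ideal.span {a} := by rw [mul_one]
  exact e ▸ ⟨H, h2, fun h5 => h3 h5 h5, h4⟩

/-- Index types of the trivial resolution. -/
def trivι : ℕ → Type
  | 0 => Unit
  | _ + 1 => Empty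

theorem exists_trivial (w : σ → M) : ∃ H : GradedRes w (⊥ : Ideal (MvPolynomial σ k)), H.IsStd ∧
    H.IsMin ∧ H.hilb (fun m => χ (.ofAdd m)) = unitSeq A := by
  let aug : (Unit →₀ MvPolynomial σ k) →ₗ[MvPolynomial σ k]
      MvPolynomial σ k ⧸ (⊥ : Ideal (MvPolynomial σ k)) :=
    (Ideal.Quotient.mkₐ (MvPolynomial σ k) ⊥).toLinearMap ∘ₗ Finsupp.lapply ()
  have haug : ∀ v, aug v = Ideal.Quotient.mk ⊥ (v ()) := fun v => rfl
  have hinj : ∀ v, aug v = 0 → v = 0 := fun v hv => by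
    rw [haug, Ideal.Quotient.eq_zero_iff_mem, Ideal.mem_bot] at hv
    exact Finsupp.ext fun _ => hv
  have hempty : ∀ i, ∀ v : trivι (i + 1) →₀ MvPolynomial σ k, v = 0 := fun i v =>
    Finsupp.ext fun a => Empty.elim a
  let H : GradedRes w (⊥ : Ideal (MvPolynomial σ k)) :=
    { ι := trivι
      fin := fun i => match i with
        | 0 => inferInstanceAs (Fintype Unit)
        | _ + 1 => inferInstanceAs (Fintype Empty)
      deg := fun _ _ => 0
      d := fun _ => 0
      aug := aug
      d_hom := fun _ e => Empty.elim e
      aug_hom := fun e => ⟨1, polyIn_monomial (map_zero _), (haug _).trans (congrArg _ Finsupp.single_eq_same)⟩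
      aug_surjective := by
        intro x
        obtain ⟨p, rfl⟩ := Ideal.Quotient.mk_surjective x
        exact ⟨Finsupp.single () p, (haug _).trans (congrArg _ Finsupp.single_eq_same)⟩
      exact_zero := fun v => ⟨fun hv => ⟨0, (hinj v hv).symm⟩, by
        rintro ⟨u, rfl⟩
        exact map_zero aug⟩
      exact_succ := fun i v => ⟨fun _ => ⟨0, (hempty i v).symm⟩, fun _ => rfl⟩ }
  refine ⟨H, ⟨(), fun _ => rfl, rfl, ?_⟩, isMin_iff.2 fun _ e => Empty.elim e, ?_⟩
  · exact (haug _).trans (congrArg _ Finsupp.single_eq_same)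
  · funext i
    obtain _ | i := i
    · change ∑ _ : Unit, χ (.ofAdd 0) = 1
      simp
    · exact Finset.sum_of_isEmpty (ι := Empty) _

end GradedRes

open GradedRes

section Jets

variable {k : Type*} [Field k] [CharZero k] {N : ℕ} {A : Type*} [CommRing A]

/-- The character `(a, b) ↦ q^a t^b`. -/
def bichar (q t : A) : Multiplicative (ℕ × ℕ) →* A where
  toFun m := q ^ m.toAdd.1 * t ^ m.toAdd.2
  map_one' := by simp
  map_mul' a b := by
    simp only [toAdd_mul, Prod.fst_add, Prod.snd_add]
    ring

theorem bichar_ofAdd (q t : A) (a b : ℕ) : bichar q t (.ofAdd (a, b)) = q ^ a * t ^ b := rfl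

/-- Iterated mapping cones along `colonIdeal_jI`, the colon ideal being resolved by a Koszul step
for x_r. Passing from r to r + 1 replaces t by qt, since x_a has bidegree (a, 1). The cones are
formed with `a = 1` and `b` the new generator, so they say nothing about minimality. -/
theorem exists_res_jI (q t : A) {r m : ℕ} (hN : r + m < N) :
    ∃ H : GradedRes (biweight N) (jI (jv k N) r m), H.IsStd ∧
      H.hilb (fun d => bichar q t (.ofAdd d)) = bettiSeq q m (q ^ r * t) := by
  have one : PolyIn (biweight N) (fun m => m = 0) (1 : MvPolynomial (Fin N) k) :=
    polyIn_monomial (map_zero _)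
  induction m using Nat.strong_induction_on generalizing r with
  | _ m ih =>
    obtain _ | _ | m := m
    · obtain ⟨H, h1, -, h2⟩ := exists_trivial (k := k) (bichar q t) (biweight N)
      rw [jI_zero]
      exact ⟨H, h1, by rw [h2, bettiSeq]⟩
    · obtain ⟨F, h1, -, h2⟩ := exists_trivial (k := k) (bichar q t) (biweight N)
      obtain ⟨H, h3, -, h4⟩ := exists_cone_hilb (bichar q t) F F h1 one
        (polyIn_jc r 0) (fun s hs => Ideal.mul_mem_right _ _ hs) (fun s hs => by
          rw [Ideal.mem_bot, one_mul, jc_zero] at hs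
          exact (mul_eq_zero.1 hs).resolve_right
            (mul_ne_zero (jv_ne_zero (by omega)) (jv_ne_zero (by omega))))
      rw [jI_succ, jI_zero, ← one_mul (jc (jv k N) r 0)]
      refine ⟨H, h3, ?_⟩
      rw [h4, h2, bettiSeq, zero_add, bichar_ofAdd]
      congr 1
      ring
    · obtain ⟨F, h1, h2⟩ := ih (m + 1) (by omega) (r := r) (by omega)
      obtain ⟨K, h3, h4⟩ := ih (m - 1) (by omega) (r := r + 1) (by omega)
      obtain ⟨G, h5, -, h6⟩ := exists_koszul (bichar q t) K h3 (polyIn_jv r)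
        fun s hs => mem_jI_of_mul_mem (by omega) (by omega) hs
      have hc := colonIdeal_jI (k := k) (show r + m + 2 < N by omega)
      obtain ⟨H, h7, -, h8⟩ := exists_cone_hilb (bichar q t) F G h1 one
        (polyIn_jc r (m + 1)) (fun s hs => by rwa [← hc] at hs)
        (fun s hs => by
          rw [one_mul] at hs
          rw [← hc]
          exact hs)
      rw [jI_succ, ← one_mul (jc (jv k N) r (m + 1))]
      refine ⟨H, h7, ?_⟩
      rw [h8, h6, h4, h2, bettiSeq, zero_add, bichar_ofAdd, bichar_ofAdd, pow_one,
        show q ^ (r + 1) * t = q * (q ^ r * t) by ring]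
      congr 1
      ring

end Jets

section Paths

variable {k : Type*} [Field k] {σ : Type*} {y : ℕ → MvPolynomial σ k} {N : ℕ}

/-- The minimal resolution of a path ideal. -/
theorem exists_res_pathI (hy : ∀ a, constantCoeff (y a) = 0) (hy0 : ∀ a < N, y a ≠ 0) {r : ℕ}
    (h1 : ∀ m, r + m < N → ∀ s, s * y (r + m) ∈ pathI y r (m - 1) → s ∈ pathI y r (m - 1))
    (h2 : ∀ m, r + m + 2 < N → ∀ s, s * (y (r + m + 1) * y (r + m + 2)) ∈ pathI y r (m + 1) →
      s ∈ pathI y r (m - 1) ⊔ Ideal.span {y (r + m)}) {m : ℕ} (hN : r + m < N) :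
    ∃ H : GradedRes (fun _ : σ => ()) (pathI y r m), H.IsStd ∧ H.IsMin ∧
      H.hilb (fun d => (1 : Multiplicative Unit →* ℤ) (.ofAdd d)) = bettiSeq 1 m 1 := by
  have triv : ∀ {c : Unit} (p : MvPolynomial σ k), PolyIn (fun _ : σ => ()) (fun x => x = c) p :=
    fun _ _ _ => rfl
  induction m using Nat.strong_induction_on with
  | _ m ih =>
    obtain _ | _ | m := m
    · obtain ⟨H, h3, h4, h5⟩ := exists_trivial (k := k) (1 : Multiplicative Unit →* ℤ)
        (fun _ : σ => ())
      rw [pathI_zero]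
      exact ⟨H, h3, h4, by rw [h5, bettiSeq]⟩
    · obtain ⟨F, h3, h4, h5⟩ := exists_trivial (k := k) (1 : Multiplicative Unit →* ℤ)
        (fun _ : σ => ())
      obtain ⟨H, h6, h7, h8⟩ := exists_koszul (ca := ()) (1 : Multiplicative Unit →* ℤ) F h3
        (triv (y (r + 0) * y (r + 0 + 1))) (fun s hs => by
          rw [Ideal.mem_bot] at hs ⊢
          exact (mul_eq_zero.1 hs).resolve_right
            (mul_ne_zero (hy0 _ (by omega)) (hy0 _ (by omega))))
      rw [pathI_succ, pathI_zero]
      refine ⟨H, h6, h7 h4 (by rw [map_mul, hy, zero_mul]), ?_⟩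
      rw [h8, h5, bettiSeq]
      simp
    · obtain ⟨F, h3, h4, h5⟩ := ih (m + 1) (by omega) (by omega)
      obtain ⟨K, h6, h7, h8⟩ := ih (m - 1) (by omega) (by omega)
      obtain ⟨G, h9, h10, h11⟩ := exists_koszul (ca := ()) (1 : Multiplicative Unit →* ℤ) K h6 (triv (y (r + m)))
        (h1 m (by omega))
      -- The edge is split with `a` the far endpoint and `b` the near one; the comparison map is
      -- then divisible by the far endpoint, which has no constant term.
      obtain ⟨H, h12, h13, h14⟩ := exists_cone_hilb (ca := ()) (cb := ()) (1 : Multiplicative Unit →* ℤ) F G h3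
        (triv (y (r + m + 2))) (triv (y (r + m + 1)))
        (fun s hs => mul_vertex_mem y hs) (fun s hs => by
          rw [mul_comm (y _)] at hs
          exact h2 m (by omega) s hs)
      rw [pathI_succ, ← add_assoc, mul_comm (y _)]
      refine ⟨H, h12, h13 h4 (h10 h7 (hy _)) (hy _), ?_⟩
      rw [h14, h11, h5, h8, bettiSeq]
      simp

end Paths

/-! ### Minimality of the cone resolution of a jet ideal -/

section Minimal

variable {k : Type*} [Field k] {N : ℕ}

/-- The colon computations for the path transport through the automorphism, and the transformed
variables still have no constant term because the substitution is linear. -/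
theorem exists_res_map_pathI {V W : Matrix (Fin N) (Fin N) k} (h : V * W = 1) (h' : W * V = 1)
    {r m : ℕ} (hN : r + m < N) : ∃ H : GradedRes (fun _ : Fin N => ())
      ((pathI (jv k N) r m).map (linSubEquiv h h')), H.IsStd ∧ H.IsMin ∧
      H.hilb (fun d => (1 : Multiplicative Unit →* ℤ) (.ofAdd d)) = bettiSeq 1 m 1 := by
  set e := linSubEquiv h h'
  have hmap : ∀ m, pathI (fun a => e (jv k N a)) r m = (pathI (jv k N) r m).map e := fun m =>
    (map_pathI (e : MvPolynomial (Fin N) k →+* MvPolynomial (Fin N) k) (jv k N) r m).symm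
  have hmem : ∀ m s, s ∈ pathI (fun a => e (jv k N a)) r m ↔ e.symm s ∈ pathI (jv k N) r m :=
    fun m s => by rw [hmap, mem_map_algEquiv]
  rw [← hmap]
  refine exists_res_pathI (N := N) (fun a => ?_) (fun a ha => ?_) (fun m hm s hs => ?_)
    (fun m hm s hs => ?_) hN
  · rw [jv]
    split_ifs
    · change constantCoeff (linSub V (X _)) = 0
      rw [linSub_X, map_sum]
      simp
    · simp
  · exact (map_ne_zero_iff e e.injective).2 (jv_ne_zero ha)
  · rw [hmem, map_mul, e.symm_apply_apply] at hs
    rw [hmem]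
    exact mem_pathI_pred_of_mul_mem hm hs
  · rw [hmem, map_mul, map_mul, e.symm_apply_apply, e.symm_apply_apply] at hs
    obtain ⟨p, hp, z, hz, he⟩ := Submodule.mem_sup.1 (mem_of_mul_edge_mem hm hs)
    obtain ⟨a, rfl⟩ := Ideal.mem_span_singleton'.1 hz
    have e1 : s = e p + e a * e (jv k N (r + m)) := by
      rw [← map_mul, ← map_add, he, e.apply_symm_apply]
    rw [e1]
    refine Submodule.add_mem_sup ((hmem _ _).2 (by rwa [e.symm_apply_apply])) ?_
    exact Ideal.mul_mem_left _ _ (Ideal.mem_span_singleton_self _)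

theorem bichar_one (m : ℕ × ℕ) : bichar (1 : ℤ) 1 (.ofAdd m) = 1 := by
  rw [show m = (m.1, m.2) from rfl, bichar_ofAdd]
  simp

/-- The bigraded resolution of a jet ideal with the least ranks is minimal. -/
theorem isMin_of_hilb_eq [CharZero k] {m : ℕ} (hN : m < N)
    (G : GradedRes (biweight N) (jI (jv k N) 0 m)) (hG : G.IsStd)
    (hh : G.hilb (fun d => bichar (1 : ℤ) 1 (.ofAdd d)) = bettiSeq 1 m 1) : G.IsMin := by
  obtain ⟨V, W, h, h', hd⟩ := exists_degeneration (k := k) (N := N) (r := 0) (m := m) (by omega)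
  obtain ⟨P, hP, hPm, hPh⟩ := exists_res_map_pathI h h' (r := 0) (m := m) (by omega)
  have hgr : IsGradedIdeal (stdW (Fin N)) ((pathI (jv k N) 0 m).map (linSubEquiv h h')) := by
    rw [pathI, Ideal.map_span]
    refine isGradedIdeal_span ?_
    rintro _ ⟨_, ⟨j, -, rfl⟩, rfl⟩
    exact ⟨_, polyIn_linSub V (polyIn_stdW_of (polyIn_jv_mul _ _))⟩
  have hs : hilbSeries (jI (jv k N) 0 m) =
      hilbSeries ((pathI (jv k N) 0 m).map (linSubEquiv h h')) := by
    rw [hilbSeries_map_linSubEquiv, hilbSeries_jI (by omega), hilbSeries_pathI (by omega)]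
  -- By equality of Hilbert series the jet ideal contains every lowest form of the transformed path
  -- ideal, and the degeneration lifts its elements; linear substitutions keep the second degree.
  obtain ⟨H, hH, hcard, hmin⟩ := G.exists_deform biweight_fst_le hG
    (fun p q c => initial_mem_of_hilbSeries_eq (isGradedIdeal_jI 0 m) hd hs p q c) hd
    (fun p q T hpq hp hq => by
      have h1 := hgr (fun x => x = T) _ hpq
      rwa [polyPart_add, polyPart_eq_self (polyIn_stdW_iff.2 hp),
        polyPart_eq_zero (polyIn_stdW_iff.2 hq), add_zero] at h1)
  -- `H` and the minimal resolution `P` resolve the same quotient with the same ranks.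
  refine hmin (isMin_of_card_eq P H hPm hP.augLifts hH.augLifts fun i => ?_)
  rw [hcard]
  have h1 := congrFun (hPh.trans hh.symm) i
  simp only [hilb, bichar_one, MonoidHom.one_apply, Finset.sum_const, Finset.card_univ,
    nsmul_eq_mul, mul_one] at h1
  exact_mod_cast h1

end Minimal

/-! ### The closed formula -/

section Closed

variable {A : Type*} [CommRing A] (q t : A)

theorem gaussNat_zero_right (a : ℕ) : gaussNat q a 0 = 1 := by cases a <;> rfl

theorem gaussNat_succ_succ (a b : ℕ) :
    gaussNat q (a + 1) (b + 1) = gaussNat q a b + q ^ (b + 1) * gaussNat q a (b + 1) := rfl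

/-- The second `q`-Pascal rule. -/
theorem gaussNat_succ_succ' : ∀ b c : ℕ, gaussNat q (b + c + 1) (b + 1) =
    gaussNat q (b + c) (b + 1) + q ^ c * gaussNat q (b + c) b
  | 0, 0 => by simp [gaussNat]
  | 0, c + 1 => by
    have h := gaussNat_succ_succ' 0 c
    simp only [zero_add, gaussNat_succ_succ, gaussNat_zero_right] at h ⊢
    linear_combination q * h
  | b + 1, 0 => by
    rw [add_zero, gaussNat_succ_succ, gaussNat_eq_zero q (b + 1) (b + 1 + 1) (by omega)]
    ring
  | b + 1, c + 1 => by
    have h1 := gaussNat_succ_succ' b (c + 1)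
    have h2 := gaussNat_succ_succ' (b + 1) c
    have e : b + 1 + c = b + (c + 1) := by ring
    rw [show b + 1 + (c + 1) = b + (c + 1) + 1 by ring, gaussNat_succ_succ _ _ (b + 1)]
    rw [e] at h2
    linear_combination h1 + q ^ (b + 1 + 1) * h2 - gaussNat_succ_succ q (b + (c + 1)) (b + 1) -
      q ^ (c + 1) * gaussNat_succ_succ q (b + (c + 1)) b

/-- The pentagonal-type exponent `(5p² - 3p)/2`. -/
def pentExp : ℕ → ℕ
  | 0 => 0
  | p + 1 => pentExp p + (5 * p + 1)

theorem two_mul_pentExp : ∀ p, 2 * pentExp p + 3 * p = 5 * p ^ 2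
  | 0 => rfl
  | p + 1 => by
    have := two_mul_pentExp p
    rw [pentExp]
    linarith

/-- The summands of the closed formula. -/
def betTerm (s : ℕ) (n : ℤ) (p j : ℕ) : A :=
  q ^ (4 * s * p + pentExp p + j.choose 2) * t ^ (2 * p + j) * qbinom q (n - 2 * p) p *
    gaussNat q p j

/-- A half of the closed formula. -/
def betSum (s : ℕ) (n : ℤ) (i : ℕ) : A :=
  ∑ x ∈ Finset.HasAntidiagonal.antidiagonal i, betTerm q t s n x.1 x.2

theorem qbinom_natCast (a b : ℕ) : qbinom q a b = gaussNat q a b := by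
  rw [qbinom]
  split_ifs with h
  · rfl
  · rw [gaussNat_eq_zero q a b (by omega)]

/-- The second q-Pascal rule, whose exponent n - 3 - 3p may be negative in general; the extra power
of q keeps the exponents natural. When that difference is negative all three coefficients vanish. -/
theorem qbinom_pascal {n : ℤ} {p E s : ℕ} (hE : (E : ℤ) + 2 = n + 4 * s) :
    q ^ (4 * s + 5 * p + 1) * qbinom q (n - 2 * (p + 1 : ℕ)) (p + 1 : ℕ) =
      q ^ (4 * s + 5 * p + 1) * qbinom q (n - 1 - 2 * (p + 1 : ℕ)) (p + 1 : ℕ) +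
        q ^ (E + 2 * p) * qbinom q (n - 3 - 2 * p) p := by
  by_cases h : n - 3 - 2 * p < p
  · have h0 : ∀ a b : ℤ, a < b → qbinom q a b = 0 := fun a b hab => if_neg (by omega)
    rw [h0 _ _ (show n - 2 * (p + 1 : ℕ) < (p + 1 : ℕ) by push_cast; omega),
      h0 _ _ (show n - 1 - 2 * (p + 1 : ℕ) < (p + 1 : ℕ) by push_cast; omega), h0 _ _ h]
    ring
  · obtain ⟨K, hK⟩ := Int.eq_ofNat_of_zero_le (show 0 ≤ n - 3 - 2 * p - p by omega)
    rw [show n - 2 * (p + 1 : ℕ) = (p + K + 1 : ℕ) by push_cast; omega,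
      show n - 1 - 2 * (p + 1 : ℕ) = (p + K : ℕ) by push_cast; omega,
      show n - 3 - 2 * p = (p + K : ℕ) by push_cast; omega, qbinom_natCast, qbinom_natCast,
      qbinom_natCast, gaussNat_succ_succ', show E + 2 * p = 4 * s + 5 * p + 1 + K by omega]
    ring

theorem betTerm_succ_zero {n : ℤ} {p E s : ℕ} (hE : (E : ℤ) + 2 = n + 4 * s) :
    betTerm q t s n (p + 1) 0 = betTerm q t s (n - 1) (p + 1) 0 +
      q ^ E * t ^ 2 * betTerm q (q * t) s (n - 3) p 0 := by
  have h := qbinom_pascal q (p := p) hE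
  simp only [betTerm, pentExp, gaussNat_zero_right, Nat.choose_zero_succ]
  linear_combination (q ^ (4 * s * p + pentExp p) * t ^ (2 * p + 2)) * h

/-- The second Pascal rule on the coefficient with lower index p + 1, the first on the one with
lower index j + 1. Replacing t by qt supplies the missing power q^(2p + j). -/
theorem betTerm_succ_succ {n : ℤ} {p j E s : ℕ} (hE : (E : ℤ) + 2 = n + 4 * s) :
    betTerm q t s n (p + 1) (j + 1) = betTerm q t s (n - 1) (p + 1) (j + 1) +
      q ^ E * t ^ 2 * (betTerm q (q * t) s (n - 3) p (j + 1) +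
        t * betTerm q (q * t) s (n - 3) p j) := by
  have h := qbinom_pascal q (p := p) hE
  simp only [betTerm, pentExp, gaussNat_succ_succ, Nat.choose_succ_succ' j 1, Nat.choose_one_right]
  linear_combination (q ^ (4 * s * p + pentExp p + j + j.choose 2) * t ^ (2 * p + j + 3)) *
    (gaussNat q p j + q ^ (j + 1) * gaussNat q p (j + 1)) * h

theorem betTerm_zero (s : ℕ) (n : ℤ) (j : ℕ) :
    betTerm q t s n 0 j = if 0 ≤ n then unitSeq A j else 0 := by
  obtain _ | j := j
  · simp [betTerm, pentExp, qbinom, unitSeq, gaussNat]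
  · simp [betTerm, unitSeq, gaussNat]

theorem betTerm_of_lt {s : ℕ} {n : ℤ} {p : ℕ} (h : n - 2 * p < p) (j : ℕ) :
    betTerm q t s n p j = 0 := by
  rw [betTerm, qbinom, if_neg (by omega)]
  ring

theorem betSum_of_lt {s : ℕ} {n : ℤ} (h : n < 3) :
    betSum q t s n = if 0 ≤ n then unitSeq A else fun _ => 0 := by
  funext i
  rw [betSum]
  obtain _ | i := i
  · simp only [Finset.HasAntidiagonal.antidiagonal_zero, Finset.sum_singleton, betTerm_zero]
    split_ifs <;> rfl
  · rw [Finset.Nat.sum_antidiagonal_succ, betTerm_zero, Finset.sum_eq_zero fun x _ =>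
      betTerm_of_lt q t (by push_cast; omega) _]
    split_ifs <;> simp

/-- The summands with p = 0 on both sides coincide because n - 1 ≥ 0; those with p > 0 are matched
by the Pascal identities for `betTerm`. -/
theorem betSum_rec {n : ℤ} {E s : ℕ} (hn : 1 ≤ n) (hE : (E : ℤ) + 2 = n + 4 * s) :
    betSum q t s n = coneSeq (betSum q t s (n - 1))
      (coneSeq (betSum q (q * t) s (n - 3)) (betSum q (q * t) s (n - 3)) t) (q ^ E * t ^ 2) := by
  funext i
  obtain _ | i := i
  · simp [betSum, coneSeq, betTerm_zero, show 0 ≤ n by omega, hn]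
  · rw [coneSeq, betSum, betSum, Finset.Nat.sum_antidiagonal_succ,
      Finset.Nat.sum_antidiagonal_succ, betTerm_zero, betTerm_zero, if_pos (by omega),
      if_pos (by omega), add_assoc]
    congr 1
    obtain _ | i := i
    · simp [coneSeq, betSum, betTerm_succ_zero q t hE]
    · rw [coneSeq, betSum, betSum, Finset.Nat.sum_antidiagonal_succ',
        Finset.Nat.sum_antidiagonal_succ', Finset.Nat.sum_antidiagonal_succ']
      simp only [betTerm_succ_succ q t hE, betTerm_succ_zero q t hE, Finset.sum_add_distrib,
        ← Finset.mul_sum]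
      ring

/-- Both halves obey the recursion of `bettiSeq`. The second carries the prefactor t^2, which
becomes q^2 t^2 under t ↦ qt; the term 4sp in the exponent, with s = 1, compensates for this and for
the argument being smaller by 2. -/
theorem bettiSeq_eq (n : ℕ) : bettiSeq q n t =
    coneSeq (betSum q t 0 (n + 1)) (betSum q t 1 (n - 1)) (t ^ 2) := by
  induction n using Nat.strong_induction_on generalizing t with
  | _ n ih =>
    obtain _ | _ | n := n
    · rw [bettiSeq, betSum_of_lt q t (by norm_num), betSum_of_lt q t (by norm_num)]
      funext i
      obtain _ | i := i <;> simp [coneSeq]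
    · rw [bettiSeq, betSum_of_lt q t (by norm_num), betSum_of_lt q t (by norm_num)]
      simp
    · have h1 : betSum q t 0 ((n + 2 : ℕ) + 1) = _ :=
        betSum_rec q t (E := n + 1) (by omega) (by push_cast; ring)
      have h2 : betSum q t 1 ((n + 2 : ℕ) - 1) = _ :=
        betSum_rec q t (E := n + 3) (by omega) (by push_cast; ring)
      have h3 : bettiSeq q (n - 1) (q * t) = coneSeq (betSum q (q * t) 0 n)
          (betSum q (q * t) 1 (n - 2)) ((q * t) ^ 2) := by
        rw [ih (n - 1) (by omega)]
        -- For n = 0 the truncated n - 1 is 0 instead of -1; all arguments are then below 3, where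
        -- the sums depend only on their sign.
        obtain _ | n := n
        · rw [betSum_of_lt, betSum_of_lt, betSum_of_lt, betSum_of_lt] <;> simp
        · push_cast
          rw [show (n : ℤ) + 1 - 2 = n - 1 by ring]
      rw [bettiSeq, h3, ih (n + 1) (by omega), h1, h2]
      push_cast
      rw [show (n : ℤ) + 2 + 1 - 1 = n + 1 + 1 by ring, show (n : ℤ) + 2 + 1 - 3 = n by ring,
        show (n : ℤ) + 2 - 1 - 1 = n + 1 - 1 by ring, show (n : ℤ) + 2 - 1 - 3 = n - 2 by ring]
      funext i
      obtain _ | _ | _ | i := i <;> simp only [coneSeq, zero_add] <;> ring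

theorem bettiSeq_apply (n i : ℕ) : bettiSeq q n t i = ∑ p ∈ Finset.range (i + 1),
    (q ^ ((5 * p ^ 2 - 3 * p + (i - p) * (i - p - 1)) / 2) * t ^ (2 * p + (i - p)) *
        qbinom q ((n : ℤ) - 2 * p + 1) p * qbinom q p ((i : ℤ) - p) +
      q ^ ((5 * p ^ 2 + 5 * p + (i - p - 1) * (i - p - 2)) / 2) * t ^ (2 * p + 2 + (i - p - 1)) *
        qbinom q ((n : ℤ) - 2 * p - 1) p * qbinom q p ((i : ℤ) - p - 1)) := by
  have hT : ∀ j : ℕ, j * (j - 1) = 2 * j.choose 2 := fun j => by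
    rw [Nat.choose_two_right, Nat.mul_div_cancel' (Nat.even_mul_pred_self j).two_dvd]
  rw [Finset.sum_add_distrib, bettiSeq_eq]
  have h1 : ∀ i, betSum q t 0 (n + 1) i = ∑ p ∈ Finset.range (i + 1),
      q ^ ((5 * p ^ 2 - 3 * p + (i - p) * (i - p - 1)) / 2) * t ^ (2 * p + (i - p)) *
        qbinom q ((n : ℤ) - 2 * p + 1) p * qbinom q p ((i : ℤ) - p) := fun i => by
    rw [betSum, Finset.Nat.sum_antidiagonal_eq_sum_range_succ]
    refine Finset.sum_congr rfl fun p hp => ?_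
    have hp' := Finset.mem_range.1 hp
    have h2 := two_mul_pentExp p
    rw [betTerm, hT, show (5 * p ^ 2 - 3 * p + 2 * (i - p).choose 2) / 2 =
      4 * 0 * p + pentExp p + (i - p).choose 2 by omega,
      show (i : ℤ) - p = (i - p : ℕ) by omega, qbinom_natCast,
      show (n : ℤ) + 1 - 2 * p = n - 2 * p + 1 by ring]
  have h2 : ∀ i, t ^ 2 * betSum q t 1 (n - 1) i = ∑ p ∈ Finset.range (i + 1),
      q ^ ((5 * p ^ 2 + 5 * p + (i + 1 - p - 1) * (i + 1 - p - 2)) / 2) *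
        t ^ (2 * p + 2 + (i + 1 - p - 1)) *
        qbinom q ((n : ℤ) - 2 * p - 1) p * qbinom q p (((i + 1 : ℕ) : ℤ) - p - 1) := fun i => by
    rw [betSum, Finset.Nat.sum_antidiagonal_eq_sum_range_succ, Finset.mul_sum]
    refine Finset.sum_congr rfl fun p hp => ?_
    have hp' := Finset.mem_range.1 hp
    have h2 := two_mul_pentExp p
    rw [betTerm, show i + 1 - p - 1 = i - p by omega, show i + 1 - p - 2 = i - p - 1 by omega, hT,
      show (5 * p ^ 2 + 5 * p + 2 * (i - p).choose 2) / 2 =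
        4 * 1 * p + pentExp p + (i - p).choose 2 by omega,
      show ((i + 1 : ℕ) : ℤ) - p - 1 = (i - p : ℕ) by omega, qbinom_natCast,
      show (n : ℤ) - 1 - 2 * p = n - 2 * p - 1 by ring]
    ring
  obtain _ | i := i
  · rw [coneSeq, h1]
    simp [qbinom]
  · rw [coneSeq, h1, h2, Finset.sum_range_succ _ (i + 1), add_right_inj]
    -- The last index contributes nothing to the second half, its q-binomial having lower index -1.
    rw [Finset.sum_range_succ _ (i + 1), show ((i + 1 : ℕ) : ℤ) - (i + 1 : ℕ) - 1 = -1 by ring]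
    simp [qbinom]

theorem gaussNat_one : ∀ a b : ℕ, gaussNat (1 : A) a b = (a.choose b : A)
  | a, 0 => by rw [gaussNat_zero_right, Nat.choose_zero_right, Nat.cast_one]
  | 0, b + 1 => by rw [Nat.choose_zero_succ, Nat.cast_zero]; rfl
  | a + 1, b + 1 => by
    rw [gaussNat_succ_succ, gaussNat_one a b, gaussNat_one a (b + 1), Nat.choose_succ_succ',
      one_pow, one_mul, Nat.cast_add]

theorem qbinom_one (a b : ℤ) : qbinom (1 : A) a b = (binom a b : A) := by
  rw [qbinom, binom]
  split_ifs
  · exact gaussNat_one _ _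
  · exact Nat.cast_zero.symm

end Closed

open GradedRes

/-! ### Setting the last variable to zero -/

section LastVariable

variable {k : Type*} [Field k] {n : ℕ}

/-- The substitution `x_n = 0`. -/
noncomputable def dropLast (k : Type*) [Field k] (n : ℕ) :
    MvPolynomial (Fin (n + 1)) k →ₐ[k] MvPolynomial (Fin n) k :=
  aeval fun i => jv k n i

theorem dropLast_jv (a : ℕ) : dropLast k n (jv k (n + 1) a) = jv k n a := by
  by_cases h : a < n + 1
  · rw [jv_of_lt h, dropLast, aeval_X]
  · rw [jv, jv, dif_neg h, dif_neg (by omega), map_zero]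

theorem dropLast_rename (p : MvPolynomial (Fin n) k) :
    dropLast k n (rename Fin.castSucc p) = p := by
  rw [dropLast, aeval_rename]
  have : ((fun i : Fin (n + 1) => jv k n i) ∘ Fin.castSucc) = (X : Fin n → _) := by
    funext i
    exact jv_of_lt i.2
  rw [this, aeval_X_left_apply]

theorem rename_dropLast (p : MvPolynomial (Fin (n + 1)) k) :
    rename Fin.castSucc (dropLast k n p) = killVar (Fin.last n) p := by
  have : (rename Fin.castSucc).comp (dropLast k n) = killVar (k := k) (Fin.last n) := by
    refine MvPolynomial.algHom_ext fun i => ?_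
    rw [AlgHom.comp_apply, dropLast, killVar, aeval_X, aeval_X]
    refine Fin.lastCases ?_ (fun i => ?_) i
    · simp [jv]
    · rw [Fin.val_castSucc, jv_of_lt i.2, rename_X, if_neg (Fin.castSucc_ne_last i)]
  exact DFunLike.congr_fun this p

theorem exists_eq_mul_of_dropLast {p : MvPolynomial (Fin (n + 1)) k} (h : dropLast k n p = 0) :
    ∃ q, p = X (Fin.last n) * q := by
  obtain ⟨q, hq⟩ := exists_killVar (Fin.last n) p
  rw [← rename_dropLast, h, map_zero, add_zero] at hq
  exact ⟨q, hq⟩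

theorem coeff_dropLast (p : MvPolynomial (Fin (n + 1)) k) (μ : Fin n →₀ ℕ) :
    coeff μ (dropLast k n p) = coeff (μ.mapDomain Fin.castSucc) p := by
  obtain ⟨q, hq⟩ := exists_killVar (Fin.last n) p
  conv_rhs => rw [hq]
  rw [← rename_dropLast, coeff_add,
    coeff_rename_mapDomain _ (Fin.castSucc_injective n), mul_comm, coeff_mul_X', if_neg, zero_add]
  rw [Finsupp.mem_support_iff, not_not]
  refine Finsupp.mapDomain_of_notMem_range _ _ ?_
  rintro ⟨i, hi⟩
  exact Fin.castSucc_ne_last i hi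

theorem PolyIn.dropLast {Q : ℕ × ℕ → Prop} {p : MvPolynomial (Fin (n + 1)) k}
    (hp : PolyIn (biweight (n + 1)) Q p) : PolyIn (biweight n) Q (dropLast k n p) := by
  intro μ hμ
  rw [coeff_dropLast] at hμ
  have h := hp _ hμ
  rw [Finsupp.weight_apply, Finsupp.sum_mapDomain_index (by simp)
    (fun _ _ _ => add_smul _ _ _)] at h
  exact h

theorem constantCoeff_dropLast (p : MvPolynomial (Fin (n + 1)) k) :
    constantCoeff (dropLast k n p) = constantCoeff p := by
  have h := coeff_dropLast p 0
  rwa [Finsupp.mapDomain_zero] at h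

/-- The substitution `x_n = 0` in vectors. -/
noncomputable def dropVec {ι : Type*} (v : ι →₀ MvPolynomial (Fin (n + 1)) k) :
    ι →₀ MvPolynomial (Fin n) k :=
  Finsupp.mapRange (dropLast k n) (map_zero _) v

theorem dropVec_apply {ι : Type*} (v : ι →₀ MvPolynomial (Fin (n + 1)) k) (a : ι) :
    dropVec v a = dropLast k n (v a) := rfl

theorem dropVec_add {ι : Type*} (u v : ι →₀ MvPolynomial (Fin (n + 1)) k) :
    dropVec (u + v) = dropVec u + dropVec v := by
  ext1 a
  simp [dropVec_apply]

theorem dropVec_smul {ι : Type*} (p : MvPolynomial (Fin (n + 1)) k)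
    (v : ι →₀ MvPolynomial (Fin (n + 1)) k) :
    dropVec (p • v) = dropLast k n p • dropVec v := by
  ext1 a
  simp [dropVec_apply]

theorem dropVec_X_smul {ι : Type*} (v : ι →₀ MvPolynomial (Fin (n + 1)) k) :
    dropVec ((X (Fin.last n) : MvPolynomial (Fin (n + 1)) k) • v) = 0 := by
  rw [dropVec_smul, dropLast, aeval_X]
  simp [jv]

theorem dropVec_surjective {ι : Type*} :
    Function.Surjective (dropVec : (ι →₀ MvPolynomial (Fin (n + 1)) k) → _) := fun v =>
  ⟨Finsupp.mapRange (rename Fin.castSucc) (map_zero _) v, by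
    ext1 a
    rw [dropVec_apply, Finsupp.mapRange_apply, dropLast_rename]⟩

theorem exists_eq_smul_of_dropVec {ι : Type*} {v : ι →₀ MvPolynomial (Fin (n + 1)) k}
    (h : dropVec v = 0) : ∃ w : ι →₀ MvPolynomial (Fin (n + 1)) k,
      v = (X (Fin.last n) : MvPolynomial (Fin (n + 1)) k) • w := by
  have h1 : ∀ a, ∃ q, v a = X (Fin.last n) * q := fun a =>
    exists_eq_mul_of_dropLast (by rw [← dropVec_apply, h, Finsupp.coe_zero, Pi.zero_apply])
  choose f hf using h1
  refine ⟨Finsupp.onFinset v.support f fun a ha => ?_, ?_⟩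
  · rw [Finsupp.mem_support_iff, hf]
    exact mul_ne_zero (X_ne_zero _) ha
  · ext1 a
    rw [Finsupp.smul_apply, Finsupp.onFinset_apply, smul_eq_mul, hf]

/-- The substitution `x_n = 0` in linear maps. -/
noncomputable def dropMap {ι κ : Type*} (f : (ι →₀ MvPolynomial (Fin (n + 1)) k) →ₗ[
    MvPolynomial (Fin (n + 1)) k] (κ →₀ MvPolynomial (Fin (n + 1)) k)) :
    (ι →₀ MvPolynomial (Fin n) k) →ₗ[MvPolynomial (Fin n) k] (κ →₀ MvPolynomial (Fin n) k) :=
  Finsupp.linearCombination _ fun e => dropVec (f (Finsupp.single e 1))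

theorem dropMap_single {ι κ : Type*} (f : (ι →₀ MvPolynomial (Fin (n + 1)) k) →ₗ[
    MvPolynomial (Fin (n + 1)) k] (κ →₀ MvPolynomial (Fin (n + 1)) k)) (e : ι) :
    dropMap f (Finsupp.single e 1) = dropVec (f (Finsupp.single e 1)) := by
  simp [dropMap]

theorem dropMap_dropVec {ι κ : Type*} (f : (ι →₀ MvPolynomial (Fin (n + 1)) k) →ₗ[
    MvPolynomial (Fin (n + 1)) k] (κ →₀ MvPolynomial (Fin (n + 1)) k))
    (v : ι →₀ MvPolynomial (Fin (n + 1)) k) : dropMap f (dropVec v) = dropVec (f v) := by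
  induction v using Finsupp.induction_linear with
  | zero => simp [dropVec]
  | add u v hu hv => rw [dropVec_add, map_add, hu, hv, map_add, dropVec_add]
  | single e p =>
    have h : (Finsupp.single e p : ι →₀ MvPolynomial (Fin (n + 1)) k) =
      p • Finsupp.single e 1 := by simp
    have h1 : dropVec (Finsupp.single e (1 : MvPolynomial (Fin (n + 1)) k)) =
        Finsupp.single e 1 := by simp [dropVec]
    rw [h, map_smul, dropVec_smul, dropVec_smul, map_smul, h1, dropMap_single]

/-- A resolution of `R[x_n]/I` reduces to a resolution modulo the nonzerodivisor `x_n`. -/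
theorem exists_res_dropLast {I : Ideal (MvPolynomial (Fin (n + 1)) k)}
    (F : GradedRes (biweight (n + 1)) I) (hF : F.IsStd)
    (hI : ∀ s, s * X (Fin.last n) ∈ I → s ∈ I) :
    ∃ H : GradedRes (biweight n) (I.map (dropLast k n)), H.IsStd ∧ (F.IsMin → H.IsMin) ∧
      ∀ {A : Type*} [CommRing A] (χ : ℕ × ℕ → A), H.hilb χ = F.hilb χ := by
  obtain ⟨e₀, he₀, hdeg, haug⟩ := hF
  have hv0 : ∀ v : F.X 0, v = v e₀ • Finsupp.single e₀ 1 := fun v => by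
    rw [Finsupp.smul_single, smul_eq_mul, mul_one]
    ext a : 1
    rw [he₀ a, Finsupp.single_eq_same]
  have hcyc : ∀ v, v ∈ F.cycles 0 ↔ v e₀ ∈ I := fun v => by
    change F.aug v = 0 ↔ _
    rw [hv0 v, map_smul, haug, ← Ideal.Quotient.mk_eq_mk, ← Submodule.Quotient.mk_smul,
      Submodule.Quotient.mk_eq_zero]
    simp
  -- The last variable is a nonzerodivisor modulo the cycles: by hypothesis on the ideal at level 0,
  -- and because free modules are torsion-free above it.
  have hX : ∀ i v, (X (Fin.last n) : MvPolynomial (Fin (n + 1)) k) • v ∈ F.cycles i →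
      v ∈ F.cycles i := by
    rintro (_ | i) v hv
    · rw [hcyc] at hv ⊢
      refine hI _ ?_
      rwa [mul_comm]
    · have h : F.d i ((X (Fin.last n) : MvPolynomial (Fin (n + 1)) k) • v) = 0 := hv
      rw [map_smul] at h
      exact (smul_eq_zero.1 h).resolve_left (X_ne_zero _)
  have hlift : ∀ i (v : F.X i), v ∈ F.cycles i → ∃ u, F.d i u = v := fun i v hv => by
    rwa [← F.range_d] at hv
  let aug : (F.ι 0 →₀ MvPolynomial (Fin n) k) →ₗ[MvPolynomial (Fin n) k]
      MvPolynomial (Fin n) k ⧸ I.map (dropLast k n) :=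
    (Ideal.Quotient.mkₐ (MvPolynomial (Fin n) k) _).toLinearMap ∘ₗ Finsupp.lapply e₀
  have haug' : ∀ v, aug v = Ideal.Quotient.mk _ (v e₀) := fun v => rfl
  have hsurj : Function.Surjective (dropLast k n) := fun p => ⟨_, dropLast_rename p⟩
  let H : GradedRes (biweight n) (I.map (dropLast k n)) :=
    { ι := F.ι
      fin := F.fin
      deg := F.deg
      d := fun i => dropMap (F.d i)
      aug := aug
      d_hom := fun i e a => by
        rw [dropMap_single, dropVec_apply]
        exact (F.d_hom i e a).dropLast
      aug_hom := fun e => ⟨1, by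
        rw [he₀ e, hdeg]
        exact polyIn_monomial (map_zero _), by
        rw [he₀ e]
        exact (haug' _).trans (congrArg _ Finsupp.single_eq_same)⟩
      aug_surjective := by
        intro x
        obtain ⟨p, rfl⟩ := Ideal.Quotient.mk_surjective x
        exact ⟨Finsupp.single e₀ p, (haug' _).trans (congrArg _ Finsupp.single_eq_same)⟩
      exact_zero := by
        intro v
        obtain ⟨v, rfl⟩ := dropVec_surjective v
        rw [haug', Ideal.Quotient.eq_zero_iff_mem]
        constructor
        · intro hv
          obtain ⟨p, hp, he⟩ := (Ideal.mem_map_iff_of_surjective _ hsurj).1 hv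
          obtain ⟨w, hw⟩ := exists_eq_mul_of_dropLast (p := v e₀ - p) (by
            rw [map_sub, he, dropVec_apply, sub_self])
          obtain ⟨u, hu⟩ := hlift 0
              (v - (X (Fin.last n) : MvPolynomial (Fin (n + 1)) k) • Finsupp.single e₀ w) (by
            rw [hcyc]
            convert hp using 1
            rw [Finsupp.sub_apply, Finsupp.smul_apply, Finsupp.single_eq_same, smul_eq_mul]
            linear_combination hw)
          refine ⟨dropVec u, ?_⟩
          rw [dropMap_dropVec, hu]
          have e := dropVec_add (v - (X (Fin.last n) : MvPolynomial (Fin (n + 1)) k) • Finsupp.single e₀ w)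
            ((X (Fin.last n) : MvPolynomial (Fin (n + 1)) k) • Finsupp.single e₀ w)
          rw [sub_add_cancel, dropVec_X_smul, add_zero] at e
          exact e.symm
        · rintro ⟨u, hu⟩
          obtain ⟨u, rfl⟩ := dropVec_surjective u
          rw [← hu, dropMap_dropVec, dropVec_apply]
          exact Ideal.mem_map_of_mem _ ((hcyc _).1 (F.d_mem_cycles 0 u))
      exact_succ := by
        intro i v
        obtain ⟨v, rfl⟩ := dropVec_surjective v
        rw [dropMap_dropVec]
        constructor
        · intro hv
          -- If d v = x_n w, then w is a cycle, w = d u, and v - x_n u is a cycle with the same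
          -- reduction as v.
          obtain ⟨w, hw⟩ := exists_eq_smul_of_dropVec hv
          obtain ⟨u, hu⟩ := hlift i w (hX i w (hw ▸ F.d_mem_cycles i v))
          obtain ⟨z, hz⟩ := hlift (i + 1) (v - (X (Fin.last n) : MvPolynomial (Fin (n + 1)) k) • u) (by
            change F.d i _ = 0
            rw [map_sub, map_smul, hu, hw, sub_self])
          refine ⟨dropVec z, ?_⟩
          rw [dropMap_dropVec, hz]
          have e := dropVec_add (v - (X (Fin.last n) : MvPolynomial (Fin (n + 1)) k) • u)
            ((X (Fin.last n) : MvPolynomial (Fin (n + 1)) k) • u)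
          rw [sub_add_cancel, dropVec_X_smul, add_zero] at e
          exact e.symm
        · rintro ⟨u, hu⟩
          obtain ⟨u, rfl⟩ := dropVec_surjective u
          rw [← dropMap_dropVec, ← hu, dropMap_dropVec, dropMap_dropVec, F.d_d]
          simp [dropVec] }
  refine ⟨H, ⟨e₀, he₀, hdeg, (haug' _).trans (congrArg _ Finsupp.single_eq_same)⟩,
    fun h => ?_, fun χ => rfl⟩
  rw [isMin_iff] at h ⊢
  intro i e a
  change constantCoeff (dropMap (F.d i) (Finsupp.single e 1) a) = 0
  rw [dropMap_single, dropVec_apply, constantCoeff_dropLast]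
  exact h i e a

end LastVariable

/-! ### Bigraded free resolutions -/

section Bigraded

variable {k : Type*} [Field k] {n : ℕ}

theorem isBihomVec_iff {ι : Type} {deg : ι → ℕ × ℕ} {v : ι →₀ MvPolynomial (Fin n) k}
    {m : ℕ × ℕ} : IsBihomVec deg v m ↔ VecIn (biweight n) deg (fun x => x = m) v := by
  constructor
  · intro h a μ hμ
    obtain ⟨c, hc, hb⟩ := h a (fun h0 => hμ (by rw [h0, coeff_zero]))
    rw [hb hμ, hc]
  · intro h a ha
    obtain ⟨μ, hμ⟩ := ne_zero_iff.1 ha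
    exact ⟨_, h a μ hμ, fun ν hν => add_right_cancel ((h a ν hν).trans (h a μ hμ).symm)⟩

variable {I : Ideal (MvPolynomial (Fin n) k)}

/-- Bigraded free resolutions as graded resolutions. -/
noncomputable def BigradedFreeResolution.toGradedRes (F : BigradedFreeResolution I) :
    GradedRes (biweight n) I where
  ι := F.ι
  fin := F.fin
  deg := F.deg
  d := F.d
  aug := F.aug
  d_hom i e := isBihomVec_iff.1 (F.d_bihom i e)
  aug_hom e := (F.aug_bihom e).imp fun _ h => ⟨polyIn_iff_isWeightedHomogeneous.2 h.1, h.2⟩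
  aug_surjective := F.aug_surjective
  exact_zero := F.exact_zero
  exact_succ := F.exact_succ

/-- Graded resolutions as bigraded free resolutions. -/
noncomputable def GradedRes.toBigraded (F : GradedRes (biweight n) I) :
    BigradedFreeResolution I where
  ι := F.ι
  fin := F.fin
  deg := F.deg
  d := F.d
  aug := F.aug
  d_bihom i e := isBihomVec_iff.2 (F.d_hom i e)
  aug_bihom e := (F.aug_hom e).imp fun _ h => ⟨polyIn_iff_isWeightedHomogeneous.1 h.1, h.2⟩
  aug_surjective := F.aug_surjective
  exact_zero := F.exact_zero
  exact_succ := F.exact_succ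

theorem mem_span_X_iff {p : MvPolynomial (Fin n) k} :
    p ∈ Ideal.span (Set.range (X : Fin n → MvPolynomial (Fin n) k)) ↔ constantCoeff p = 0 := by
  rw [← Set.image_univ, mem_ideal_span_X_image]
  constructor
  · intro h
    by_contra h0
    obtain ⟨i, -, hi⟩ := h 0 (mem_support_iff.2 h0)
    exact hi rfl
  · intro h μ hμ
    by_contra hall
    have : μ = 0 := by
      ext i
      by_contra hi
      exact hall ⟨i, trivial, hi⟩
    rw [this, mem_support_iff] at hμ
    exact hμ h

theorem mem_smul_top_iff {R ι : Type*} [CommRing R] {J : Ideal R} {v : ι →₀ R} :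
    v ∈ J • (⊤ : Submodule R (ι →₀ R)) ↔ ∀ a, v a ∈ J := by
  constructor
  · intro h a
    induction h using Submodule.smul_induction_on' with
    | smul r hr u _ => exact J.mul_mem_right _ hr
    | add u _ v _ hu hv => exact J.add_mem hu hv
  · intro h
    rw [← Finsupp.sum_single v]
    refine Submodule.sum_mem _ fun a _ => ?_
    have e : Finsupp.single a (v a) = v a • Finsupp.single a (1 : R) := by simp
    rw [e]
    exact Submodule.smul_mem_smul (h a) trivial

theorem isMinimal_iff (F : BigradedFreeResolution I) : F.IsMinimal ↔ F.toGradedRes.IsMin := by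
  rw [isMin_iff]
  constructor
  · intro h i e a
    exact mem_span_X_iff.1 (mem_smul_top_iff.1 (h i (LinearMap.mem_range_self _ _)) a)
  · rintro h i _ ⟨v, rfl⟩
    rw [← Finsupp.sum_single v, Finsupp.sum, map_sum]
    refine Submodule.sum_mem _ fun e _ => ?_
    have h1 : Finsupp.single e (v e) = v e • Finsupp.single e (1 : MvPolynomial (Fin n) k) := by
      simp
    rw [h1, map_smul]
    exact Submodule.smul_mem _ _ (mem_smul_top_iff.2 fun a => mem_span_X_iff.2 (h i e a))

/-- For an arbitrary resolution F_0 need not be R. Any preimage of `p` is cut down to its component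
of degree `m`; the error stays in `I` because `I` is graded. -/
theorem GradedRes.augLifts_of_isGradedIdeal {σ M : Type*} [AddCommMonoid M] {w : σ → M}
    {I : Ideal (MvPolynomial σ k)} (hI : IsGradedIdeal w I) (F : GradedRes w I) : F.AugLifts := by
  intro p m hp
  choose g hg hg' using F.aug_hom
  let L := Finsupp.linearCombination (MvPolynomial σ k) g
  have hL : ∀ v, F.aug v = Ideal.Quotient.mk I (L v) := by
    intro v
    have e : F.aug = (Ideal.Quotient.mkₐ (MvPolynomial σ k) I).toLinearMap ∘ₗ L := by
      refine Finsupp.lhom_ext' fun e => LinearMap.ext_ring ?_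
      change F.aug (Finsupp.single e 1) = Ideal.Quotient.mk I (L (Finsupp.single e 1))
      rw [hg']
      simp [L]
    exact LinearMap.congr_fun e v
  have hLQ : ∀ {Q : M → Prop} {v : F.X 0}, VecIn w (F.deg 0) Q v → PolyIn w Q (L v) := by
    intro Q v hv
    refine PolyIn.sum fun e _ => ((hv e).mul (hg e)).mono ?_
    rintro _ ⟨a, _, ha, rfl, rfl⟩
    exact ha
  obtain ⟨v, hv⟩ := F.aug_surjective (Ideal.Quotient.mk I p)
  obtain ⟨v₁, v₂, rfl, h1, h2⟩ := exists_split w (F.deg 0) (fun x => x = m) v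
  refine ⟨v₁, h1, ?_⟩
  rw [hL, Ideal.Quotient.eq, map_add] at hv
  have h3 := hI (fun x => x = m) _ hv
  rw [show L v₁ + L v₂ - p = (L v₁ - p) + L v₂ by ring, polyPart_add,
    polyPart_eq_self ((hLQ h1).sub hp), polyPart_eq_zero (hLQ h2), add_zero] at h3
  rw [hL, Ideal.Quotient.eq]
  exact h3

theorem rank_eq (F : BigradedFreeResolution I) (i : ℕ) :
    (F.rank i : ℤ) = F.toGradedRes.hilb (fun d => bichar 1 1 (.ofAdd d)) i := by
  rw [BigradedFreeResolution.rank, Module.finrank_finsupp_self]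
  simp only [hilb, bichar_one, Finset.sum_const, Finset.card_univ, nsmul_eq_mul, mul_one]
  rfl

theorem jetIdeal_eq : jetIdeal k n = jI (jv k n) 0 n := by
  rw [jetIdeal, jI]
  congr 1
  have h : ∀ j : Fin n, jetGen k n j = jc (jv k n) 0 j := fun j => by
    rw [jetGen, jc_eq_sum _ _ j.2, Finset.sum_range]
    refine Finset.sum_congr rfl fun a _ => ?_
    rw [Finset.sum_range]
    refine Finset.sum_congr rfl fun b _ => ?_
    rw [zero_add, zero_add, jv_of_lt a.2, jv_of_lt b.2]
  ext p
  constructor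
  · rintro ⟨j, rfl⟩
    exact ⟨j, j.2, (h j).symm⟩
  · rintro ⟨j, hj, rfl⟩
    exact ⟨⟨j, hj⟩, h ⟨j, hj⟩⟩

theorem map_dropLast_jI : (jI (jv k (n + 1)) 0 n).map (dropLast k n) = jetIdeal k n := by
  rw [jetIdeal_eq, jI, Ideal.map_span, jI, ← Set.image_comp]
  congr 1
  refine Set.image_congr fun j _ => ?_
  simp only [Function.comp_apply, jc, map_sum, map_mul, dropLast_jv]

theorem mem_jI_of_mul_last_mem {s : MvPolynomial (Fin (n + 1)) k}
    (h : s * X (Fin.last n) ∈ jI (jv k (n + 1)) 0 n) : s ∈ jI (jv k (n + 1)) 0 n := by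
  refine mem_span_of_mul_X_mem ?_ h
  rintro _ ⟨j, hj, rfl⟩
  have hj' : j < n := hj
  rw [jc, map_sum]
  refine Finset.sum_congr rfl fun p hp => ?_
  have := Finset.HasAntidiagonal.mem_antidiagonal.1 hp
  rw [map_mul, killVar_jv (by simp only [Fin.val_last]; omega),
    killVar_jv (by simp only [Fin.val_last]; omega)]

end Bigraded

/-! ### Specialization of the generating functions and the main theorem -/

theorem map_coneSeq {A B : Type*} [CommRing A] [CommRing B] (φ : A →+* B) (f g : ℕ → A) (c : A) :
    (fun i => φ (coneSeq f g c i)) = coneSeq (fun i => φ (f i)) (fun i => φ (g i)) (φ c) := by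
  funext i
  obtain _ | i := i <;> simp [coneSeq]

theorem map_bettiSeq {A B : Type*} [CommRing A] [CommRing B] (φ : A →+* B) (q t : A) (m : ℕ) :
    (fun i => φ (bettiSeq q m t i)) = bettiSeq (φ q) m (φ t) := by
  have h0 : (fun i => φ (unitSeq A i)) = unitSeq B := by
    funext i
    obtain _ | i := i <;> simp [unitSeq]
  induction m using Nat.strong_induction_on generalizing t with
  | _ m ih =>
    obtain _ | _ | m := m
    · rw [bettiSeq, bettiSeq, h0]
    · rw [bettiSeq, bettiSeq, map_coneSeq, h0, map_pow]
    · rw [bettiSeq, bettiSeq, map_coneSeq, map_coneSeq, ih _ (by omega), ih _ (by omega)]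
      simp

theorem map_hilb {k : Type*} [Field k] {σ : Type*} {w : σ → ℕ × ℕ} {I : Ideal (MvPolynomial σ k)}
    {A B : Type*} [CommRing A] [CommRing B] (φ : A →+* B) (q t : A) (F : GradedRes w I) :
    (fun i => φ (F.hilb (fun d => bichar q t (.ofAdd d)) i)) =
      F.hilb fun d => bichar (φ q) (φ t) (.ofAdd d) := by
  funext i
  simp [hilb, bichar]

/-- The degeneration needs one variable more than there are generators, so the resolution is built
in n + 1 variables. As c_j with j < n involves only x_0, …, x_j, the last variable is a
nonzerodivisor and may be set to 0. Minimality is tested on ranks, i.e. at q = t = 1. -/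
theorem exists_isMin_jetIdeal (k : Type*) [Field k] [CharZero k] (n : ℕ) :
    ∃ H : GradedRes (biweight n) (jetIdeal k n), H.IsMin ∧ H.AugLifts ∧
      H.hilb (fun d => bichar (X 0 : MvPolynomial (Fin 2) ℤ) (X 1) (.ofAdd d)) =
        bettiSeq (X 0) n (X 1) := by
  obtain ⟨G, hG, hh⟩ := exists_res_jI (k := k) (N := n + 1) (X 0 : MvPolynomial (Fin 2) ℤ) (X 1)
    (r := 0) (m := n) (by omega)
  rw [pow_zero, one_mul] at hh
  have h1 : G.hilb (fun d => bichar (1 : ℤ) 1 (.ofAdd d)) = bettiSeq 1 n 1 := by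
    have h2 := map_hilb (eval fun _ => (1 : ℤ)) (X 0 : MvPolynomial (Fin 2) ℤ) (X 1) G
    rw [hh, map_bettiSeq, eval_X, eval_X] at h2
    exact h2.symm
  obtain ⟨H, hH, hmin, hhilb⟩ := exists_res_dropLast G hG fun s hs => mem_jI_of_mul_last_mem hs
  rw [← map_dropLast_jI]
  exact ⟨H, hmin (isMin_of_hilb_eq (by omega) G hG h1), hH.augLifts, (hhilb _).trans hh⟩

end JetDoublePoint

-- The sums stop at p = i because the lower indices i - p and i - p - 1 are negative beyond.
-- Truncated subtraction in the exponents is harmless: where it changes a factor, either the product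
-- is 0 anyway or the accompanying q-binomial vanishes.
open JetDoublePoint MvPolynomial in
theorem mainTheorem10 (k : Type*) [Field k] [CharZero k] (n : ℕ) :
    (∃ F : BigradedFreeResolution (jetIdeal k n), F.IsMinimal) ∧
    ∀ F : BigradedFreeResolution (jetIdeal k n), F.IsMinimal → ∀ i : ℕ,
      F.rank i = ∑ p ∈ Finset.range (i + 1),
        (binom ((n : ℤ) - 2 * p + 1) p * binom p ((i : ℤ) - p) +
          binom ((n : ℤ) - 2 * p - 1) p * binom p ((i : ℤ) - p - 1)) ∧
      F.hilbertGen i = ∑ p ∈ Finset.range (i + 1),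
        ((X 0 : MvPolynomial (Fin 2) ℤ) ^ ((5 * p ^ 2 - 3 * p + (i - p) * (i - p - 1)) / 2) *
            X 1 ^ (2 * p + (i - p)) *
            qbinom (X 0) ((n : ℤ) - 2 * p + 1) p * qbinom (X 0) p ((i : ℤ) - p) +
          X 0 ^ ((5 * p ^ 2 + 5 * p + (i - p - 1) * (i - p - 2)) / 2) *
            X 1 ^ (2 * p + 2 + (i - p - 1)) *
            qbinom (X 0) ((n : ℤ) - 2 * p - 1) p * qbinom (X 0) p ((i : ℤ) - p - 1)) := by
  obtain ⟨H, hmin, hlift, hh⟩ := exists_isMin_jetIdeal k n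
  refine ⟨⟨H.toBigraded, (isMinimal_iff H.toBigraded).2 hmin⟩, fun F hF i => ?_⟩
  have hgr : IsGradedIdeal (biweight n) (jetIdeal k n) := by
    rw [jetIdeal_eq]
    exact isGradedIdeal_jI 0 n
  have hFh : F.toGradedRes.hilb
      (fun d => bichar (X 0 : MvPolynomial (Fin 2) ℤ) (X 1) (.ofAdd d)) =
        bettiSeq (X 0) n (X 1) := by
    rw [← hh]
    exact funext fun i => GradedRes.hilb_eq _ _ ((isMinimal_iff F).1 hF) hmin
      (GradedRes.augLifts_of_isGradedIdeal hgr _) hlift _ i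
  constructor
  · have h2 := map_hilb (eval fun _ => (1 : ℤ)) (X 0 : MvPolynomial (Fin 2) ℤ) (X 1)
      F.toGradedRes
    rw [hFh, map_bettiSeq, eval_X, eval_X] at h2
    have h3 := rank_eq F i
    rw [← congrFun h2 i, bettiSeq_apply] at h3
    simp only [one_pow, one_mul, qbinom_one] at h3
    exact_mod_cast h3
  · rw [← bettiSeq_apply, ← hFh]
    rfl
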